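/- Let $d\in\mathbb N$, $T>0$, and let $\mathcal P_2(\mathbb R^d)$ be the set of Borel probability measures on $\mathbb R^d$ with finite second moment, endowed with the Wasserstein distance $W_2$, $W_2^2(\mu,\nu)=\inf_{\gamma\in\Pi(\mu,\nu)}\int|x-y|^2\,d\gamma$. For $\mu\in\mathcal P_2(\mathbb R^d)$ let $\bar\mu=\int x\,d\mu(x)$ be its barycenter. Let $b(t,x,\mu)\in\mathbb R^d$ be a vector field, defined for $t\in(0,T)$, $x\in\mathbb R^d$, $\mu\in\mathcal P_2(\mathbb R^d)$, continuous in $t$, such that for some constants $L,C$ and all $t,x,y,\mu,\nu$ $$|b(t,x,\mu)-b(t,y,\nu)|\le L\,(W_2(\mu,\nu)+|x-y|),\qquad |b(t,x,\mu)|\le C\Big(1+|x|+\int|y|\,d\mu(y)\Big).$$ Let $\mu_0$ be a probability measure on $\mathbb R^d$ that is absolutely continuous with respect to Lebesgue measure and has compact support. Given $\varepsilon\ge0$, a solution of $$\partial_t\mu_t+\operatorname{div}(b(t,x,\mu_t)\mu_t)=\varepsilon\Delta\mu_t,\qquad \mu_t|_{t=0}=\mu_0 \tag{1}$$ is a curve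 $\mu\in C([0,T];\mathcal P_2(\mathbb R^d))$ that starts at $\mu_0$ and satisfies, for all $\varphi\in C_c^\infty(\mathbb R^d)$ and $t\in(0,T)$, $$\frac{d}{dt}\int\varphi\,d\mu_t=\int\big(b(t,x,\mu_t)\cdot\nabla\varphi(x)+\varepsilon\Delta\varphi(x)\big)\,d\mu_t(x).$$ Fix a control $u\in L^1((0,T);\mathrm{Lip}(\mathbb R^d))$, where $\mathrm{Lip}(\mathbb R^d)$ is the space of Lipschitz maps $\mathbb R^d\to\mathbb R^d$, with $|u(t,x)|\le k(t)(1+|x|)$ for a.e. $t$ and all $x$, for some $k\in L^2(0,T)$. Let $Q,R,S,\bar Q$ be $d\times d$ matrices depending continuously on $t\in[0,T]$, let $Q_T,S_T,\bar Q_T$ be constant $d\times d$ matrices, and set $$J(\mu,u)=\int_0^T\!\!\int f(t,x,\mu_t,u(t,x))\,d\mu_t(x)\,dt+\int g(x,\mu_T)\,d\mu_T(x),$$ $$f(t,x,\mu,v)=\tfrac12\big[x'Q(t)x+v'R(t)v+(x-S(t)\bar\mu)'\bar Q(t)(x-S(t)\bar\mu)\big],$$ $$g(x,\mu)=\tfrac12\big[x'Q_Tx+(x-S_T\bar\mu)'\bar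 Q_T(x-S_T\bar\mu)\big].$$ Let $\mu$ be a solution of (1) with $\varepsilon=0$ and, for every $\varepsilon>0$, let $\mu^\varepsilon$ be a solution of (1). Then $$\lim_{\varepsilon\to0^+}\ \sup_{t\in[0,T]}W_2(\mu^\varepsilon_t,\mu_t)=0 .$$ Moreover $\bar\mu^\varepsilon_t\to\bar\mu_t$ as $\varepsilon\to0^+$, uniformly in $t\in[0,T]$; all integrals in $J(\mu,u)$ and $J(\mu^\varepsilon,u)$ converge absolutely, and $J(\mu^\varepsilon,u)\to J(\mu,u)$ as $\varepsilon\to0^+$. -/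

import Mathlib

open MeasureTheory Filter Topology Set
open scoped ENNReal ContDiff Gradient Laplacian

noncomputable section

namespace VanishingViscosity

/-- The Euclidean space `ℝ^d`. -/
abbrev Eucl (d : ℕ) : Type := EuclideanSpace ℝ (Fin d)

/-- `𝒫₂(ℝ^d)`: Borel probability measures with finite second moment. -/
def P2 (d : ℕ) : Type :=
  {μ : ProbabilityMeasure (Eucl d) // ∫⁻ x, ‖x‖ₑ ^ 2 ∂(μ : Measure (Eucl d)) < ⊤}

/-- The underlying measure of an element of `𝒫₂(ℝ^d)`. -/
def P2.meas {d : ℕ} (μ : P2 d) : Measure (Eucl d) := (μ.1 : Measure (Eucl d))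

/-- `𝒫_c^{ac}(ℝ^d)`: absolutely continuous with respect to Lebesgue measure, with compact
support. -/
def P2.IsCompactAC {d : ℕ} (μ : P2 d) : Prop :=
  μ.meas ≪ volume ∧ ∃ K : Set (Eucl d), IsCompact K ∧ μ.meas Kᶜ = 0

/-- The transport plans between `μ` and `ν`. -/
def couplings {d : ℕ} (μ ν : P2 d) : Set (Measure (Eucl d × Eucl d)) :=
  {γ | γ.map Prod.fst = μ.meas ∧ γ.map Prod.snd = ν.meas}

/-- The Wasserstein distance `W₂`. (The infimum is finite on `𝒫₂(ℝ^d)`.) -/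
def W2 {d : ℕ} (μ ν : P2 d) : ℝ :=
  Real.sqrt (⨅ γ ∈ couplings μ ν, ∫⁻ p, ‖p.1 - p.2‖ₑ ^ 2 ∂γ).toReal

/-- The barycenter of a measure. -/
def barycenter {d : ℕ} (μ : P2 d) : Eucl d := ∫ x, x ∂μ.meas

/-- A curve `μ ∈ C([0,T]; 𝒫₂(ℝ^d))` that is a weak solution of
`∂ₜ μₜ + div (b(t,x,μₜ) μₜ) = ε Δ μₜ` with initial datum `μ₀`; the case `ε = 0` is the continuity
equation. -/
structure IsWeakSolution {d : ℕ} (T ε : ℝ) (b : ℝ → Eucl d → P2 d → Eucl d) (μ₀ : P2 d)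
    (μ : ℝ → P2 d) : Prop where
  continuous : ∀ s ∈ Icc 0 T, Tendsto (fun t => W2 (μ t) (μ s)) (𝓝[Icc 0 T] s) (𝓝 0)
  initial : μ 0 = μ₀
  equation : ∀ φ : Eucl d → ℝ, ContDiff ℝ ∞ φ → HasCompactSupport φ → ∀ t ∈ Ioo 0 T,
    HasDerivAt (fun s => ∫ x, φ x ∂(μ s).meas)
      (∫ x, (inner ℝ (b t x (μ t)) (∇ φ x) + ε * Δ φ x) ∂(μ t).meas) t

/-- The control class `𝒰 = L¹((0,T); Lip(ℝ^d))`, where `Lip(ℝ^d)` carries the norm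
`|v(0)| + Lip(v)`. -/
structure IsControl {d : ℕ} (T : ℝ) (u : ℝ → Eucl d → Eucl d) : Prop where
  measurable : ∀ x, AEStronglyMeasurable (fun t => u t x) (volume.restrict (Ioo 0 T))
  integrable_zero : IntegrableOn (fun t => u t 0) (Ioo 0 T)
  lipschitz : ∃ l : ℝ → ℝ, IntegrableOn l (Ioo 0 T) ∧
    ∀ᵐ t ∂volume.restrict (Ioo 0 T), ∀ x y, ‖u t x - u t y‖ ≤ l t * ‖x - y‖

/-- The matrices of a quadratic cost on `[0,T]`. -/
structure QuadraticCost (d : ℕ) (T : ℝ) where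
  Q : ℝ → Eucl d →L[ℝ] Eucl d
  R : ℝ → Eucl d →L[ℝ] Eucl d
  S : ℝ → Eucl d →L[ℝ] Eucl d
  Qbar : ℝ → Eucl d →L[ℝ] Eucl d
  QT : Eucl d →L[ℝ] Eucl d
  ST : Eucl d →L[ℝ] Eucl d
  QbarT : Eucl d →L[ℝ] Eucl d
  continuous_Q : ContinuousOn Q (Icc 0 T)
  continuous_R : ContinuousOn R (Icc 0 T)
  continuous_S : ContinuousOn S (Icc 0 T)
  continuous_Qbar : ContinuousOn Qbar (Icc 0 T)

namespace QuadraticCost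

variable {d : ℕ} {T : ℝ} (c : QuadraticCost d T)

/-- The running cost
`f(t,x,μ,u) = (x'Q(t)x + u'R(t)u + (x - S(t)μ̄)'Q̄(t)(x - S(t)μ̄)) / 2`. -/
def running (t : ℝ) (x : Eucl d) (μ : P2 d) (u : Eucl d) : ℝ :=
  (1 / 2) * (inner ℝ x (c.Q t x) + inner ℝ u (c.R t u) +
    inner ℝ (x - c.S t (barycenter μ)) (c.Qbar t (x - c.S t (barycenter μ))))

/-- The final cost `g(x,μ) = (x'Q_T x + (x - S_T μ̄)'Q̄_T(x - S_T μ̄)) / 2`. -/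
def final (x : Eucl d) (μ : P2 d) : ℝ :=
  (1 / 2) * (inner ℝ x (c.QT x) +
    inner ℝ (x - c.ST (barycenter μ)) (c.QbarT (x - c.ST (barycenter μ))))

/-- The cost `J(μ,u) = ∫₀ᵀ ∫ f(t,x,μₜ,u(t,x)) dμₜ(x) dt + ∫ g(x,μ_T) dμ_T(x)`. -/
def J (μ : ℝ → P2 d) (u : ℝ → Eucl d → Eucl d) : ℝ :=
  (∫ t in (0 : ℝ)..T, ∫ x, c.running t x (μ t) (u t x) ∂(μ t).meas) +
    ∫ x, c.final x (μ T) ∂(μ T).meas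

/-- All the integrals in `J(μ,u)` converge absolutely. -/
structure IsFinite (μ : ℝ → P2 d) (u : ℝ → Eucl d → Eucl d) : Prop where
  inner_integrable : ∀ᵐ t ∂volume.restrict (Ioo 0 T),
    Integrable (fun x => c.running t x (μ t) (u t x)) (μ t).meas
  time_integrable :
    IntervalIntegrable (fun t => ∫ x, c.running t x (μ t) (u t x) ∂(μ t).meas) volume 0 T
  final_integrable : Integrable (fun x => c.final x (μ T)) (μ T).meas

end QuadraticCost

end VanishingViscosity

end

open VanishingViscosity

/-!
Testing the equation against mollified truncations of `‖x‖²` bounds the second moments of all the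
solutions uniformly in `ε ∈ [0, 1]`. Freezing the measure, `b(t, ·, μ^ε_t)` is a Lipschitz field
with a flow `X^ε`, and `μ^ε` solves a linear equation.

Let `w` be the backward transport of a test function `φ` along the flow. Mollifying `w` at scale
`δ` makes it admissible in the weak formulation at the price of a commutator `O(L δ)` and of a
viscous term `O(ε / δ)`, so that `∫ φ dμ^ε_t` is close to `∫ φ(X^ε_t) dμ₀`, uniformly over the
fields with given constants and exactly for `ε = 0`. Taking for `φ` the members of a fine partition
of unity and a truncation of `(‖x‖ - R)₊²`, one transports `(X^ε_t)_# μ₀` to `μ^ε_t` cell by cell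
and controls what happens far away: `W₂(μ^ε_t, (X^ε_t)_# μ₀)` is small.

Comparing the flow of `b(t, ·, μ^ε_t)` with that of `b(t, ·, μ_t)`, Gronwall's inequality turns
this into smallness of `W₂(μ^ε_t, μ_t)`. The integrands of the cost are locally Lipschitz with
constant `O(1 + ‖x‖)`, hence their integrals are continuous for `W₂`, and dominated convergence in
time concludes.
-/

noncomputable section

namespace VanishingViscosity

section QuadLip

variable {E F : Type*} [NormedAddCommGroup E] [NormedAddCommGroup F]

/-- Maps whose local Lipschitz constant grows at most linearly: the natural test functions for
`W₂`, since their integrals are locally Lipschitz on `𝒫₂`. -/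
def QuadLip (K : ℝ) (f : E → F) : Prop :=
  ∀ x y, ‖f x - f y‖ ≤ K * (1 + ‖x‖ + ‖y‖) * ‖x - y‖

lemma QuadLip.continuous {K : ℝ} {f : E → F}
    (hf : QuadLip K f) : Continuous f := by
  refine continuous_iff_continuousAt.2 fun x => ?_
  rw [ContinuousAt, tendsto_iff_norm_sub_tendsto_zero]
  refine squeeze_zero (fun _ => norm_nonneg _) (fun y => hf y x) ?_
  have : Continuous fun y : E => K * (1 + ‖y‖ + ‖x‖) * ‖y - x‖ := by fun_prop
  simpa using this.tendsto x

lemma QuadLip.norm_le {K : ℝ} {f : E → F}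
    (hf : QuadLip K f) (hK : 0 ≤ K) (x : E) : ‖f x‖ ≤ (‖f 0‖ + 2 * K) * (1 + ‖x‖ ^ 2) := by
  have h := hf x 0
  simp only [norm_zero, add_zero, sub_zero] at h
  have hsub := norm_sub_norm_le (f x) (f 0)
  have hf0 := norm_nonneg (f 0)
  have := norm_nonneg x
  have : K * (1 + ‖x‖) * ‖x‖ ≤ 2 * K * (1 + ‖x‖ ^ 2) := by
    have : (1 + ‖x‖) * ‖x‖ ≤ 2 * (1 + ‖x‖ ^ 2) := by nlinarith [sq_nonneg (‖x‖ - 1)]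
    nlinarith
  nlinarith [mul_nonneg hf0 (sq_nonneg ‖x‖)]

lemma QuadLip.of_lipschitz {K : ℝ} {f : E → F}
    (hK : 0 ≤ K) (hf : ∀ x y, ‖f x - f y‖ ≤ K * ‖x - y‖) : QuadLip K f := fun x y => by
  refine (hf x y).trans (mul_le_mul_of_nonneg_right ?_ (norm_nonneg _))
  nlinarith [norm_nonneg x, norm_nonneg y]

end QuadLip

section Wasserstein

variable {d : ℕ} {F : Type*} [NormedAddCommGroup F]

instance P2.isProbabilityMeasure_meas (μ : P2 d) : IsProbabilityMeasure μ.meas := by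
  unfold P2.meas; infer_instance

lemma P2.integrable_norm_sq (μ : P2 d) : Integrable (fun x => ‖x‖ ^ 2) μ.meas := by
  refine ⟨by fun_prop, ?_⟩
  have h := μ.2
  simpa [HasFiniteIntegral, P2.meas, enorm_pow] using h

lemma integrable_norm_of_sq {μ : Measure (Eucl d)} [IsFiniteMeasure μ]
    (h : Integrable (fun x => ‖x‖ ^ 2) μ) : Integrable (fun x => ‖x‖) μ := by
  refine ((integrable_const (1 : ℝ)).add h).mono' (by fun_prop) (.of_forall fun x => ?_)
  simp only [norm_norm, Pi.add_apply]
  nlinarith [sq_nonneg (‖x‖ - 1), norm_nonneg x]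

lemma P2.integrable_norm (μ : P2 d) : Integrable (fun x => ‖x‖) μ.meas :=
  integrable_norm_of_sq μ.integrable_norm_sq

lemma P2.integrable_of_le_sq (μ : P2 d) {f : Eucl d → F}
    (hf : AEStronglyMeasurable f μ.meas) {K : ℝ} (h : ∀ x, ‖f x‖ ≤ K * (1 + ‖x‖ ^ 2)) :
    Integrable f μ.meas :=
  (((integrable_const (1 : ℝ)).add μ.integrable_norm_sq).const_mul K).mono' hf
    (.of_forall fun x => h x)

lemma QuadLip.integrable {K : ℝ} {f : Eucl d → F}
    (hf : QuadLip K f) (hK : 0 ≤ K) (μ : P2 d) : Integrable f μ.meas :=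
  μ.integrable_of_le_sq hf.continuous.aestronglyMeasurable (hf.norm_le hK)

lemma P2.sq_integral_norm_le (μ : P2 d) :
    (∫ x, ‖x‖ ∂μ.meas) ^ 2 ≤ ∫ x, ‖x‖ ^ 2 ∂μ.meas := by
  have hmem : MemLp (fun x : Eucl d => ‖x‖) 2 μ.meas :=
    (memLp_two_iff_integrable_sq (by fun_prop)).2 μ.integrable_norm_sq
  have hvar := ProbabilityTheory.variance_nonneg (fun x : Eucl d => ‖x‖) μ.meas
  rw [ProbabilityTheory.variance_eq_sub hmem] at hvar
  exact sub_nonneg.1 hvar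

lemma isProbabilityMeasure_of_coupling {μ ν : P2 d} {γ : Measure (Eucl d × Eucl d)}
    (hγ : γ ∈ couplings μ ν) : IsProbabilityMeasure γ := by
  have h : IsProbabilityMeasure (γ.map Prod.fst) := by rw [hγ.1]; infer_instance
  exact (Measure.isProbabilityMeasure_map_iff measurable_fst.aemeasurable).1 h

lemma coupling_integrable_fst {μ ν : P2 d}
    {γ : Measure (Eucl d × Eucl d)} (hγ : γ ∈ couplings μ ν) {f : Eucl d → F}
    (hf : Integrable f μ.meas) : Integrable (fun p => f p.1) γ := by
  rw [← hγ.1] at hf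
  exact hf.comp_measurable measurable_fst

lemma coupling_integrable_snd {μ ν : P2 d}
    {γ : Measure (Eucl d × Eucl d)} (hγ : γ ∈ couplings μ ν) {f : Eucl d → F}
    (hf : Integrable f ν.meas) : Integrable (fun p => f p.2) γ := by
  rw [← hγ.2] at hf
  exact hf.comp_measurable measurable_snd

variable [NormedSpace ℝ F]

lemma coupling_integral_fst {μ ν : P2 d}
    {γ : Measure (Eucl d × Eucl d)} (hγ : γ ∈ couplings μ ν) {f : Eucl d → F}
    (hf : Integrable f μ.meas) : ∫ p, f p.1 ∂γ = ∫ x, f x ∂μ.meas := by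
  have h := hγ.1
  rw [← h] at hf ⊢
  exact (integral_map measurable_fst.aemeasurable hf.1).symm

lemma coupling_integral_snd {μ ν : P2 d}
    {γ : Measure (Eucl d × Eucl d)} (hγ : γ ∈ couplings μ ν) {f : Eucl d → F}
    (hf : Integrable f ν.meas) : ∫ p, f p.2 ∂γ = ∫ x, f x ∂ν.meas := by
  have h := hγ.2
  rw [← h] at hf ⊢
  exact (integral_map measurable_snd.aemeasurable hf.1).symm

lemma coupling_integrable_dist_sq {μ ν : P2 d} {γ : Measure (Eucl d × Eucl d)}
    (hγ : γ ∈ couplings μ ν) : Integrable (fun p : Eucl d × Eucl d => ‖p.1 - p.2‖ ^ 2) γ := by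
  refine (((coupling_integrable_fst hγ μ.integrable_norm_sq).add
    (coupling_integrable_snd hγ ν.integrable_norm_sq)).const_mul 2).mono'
    (by fun_prop) (.of_forall fun p => ?_)
  have h := norm_sub_le p.1 p.2
  simp only [Pi.add_apply, norm_pow, norm_norm]
  nlinarith [sq_nonneg (‖p.1‖ - ‖p.2‖), norm_nonneg (p.1 - p.2)]

lemma coupling_lintegral_eq {μ ν : P2 d} {γ : Measure (Eucl d × Eucl d)}
    (hγ : γ ∈ couplings μ ν) :
    ∫⁻ p, ‖p.1 - p.2‖ₑ ^ 2 ∂γ = ENNReal.ofReal (∫ p, ‖p.1 - p.2‖ ^ 2 ∂γ) := by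
  rw [ofReal_integral_eq_lintegral_ofReal (coupling_integrable_dist_sq hγ)
    (.of_forall fun p => by positivity)]
  refine lintegral_congr fun p => ?_
  rw [ENNReal.ofReal_pow (norm_nonneg _), ofReal_norm]

lemma W2_nonneg (μ ν : P2 d) : 0 ≤ W2 μ ν := Real.sqrt_nonneg _

lemma W2_sq_le {μ ν : P2 d} {γ : Measure (Eucl d × Eucl d)} (hγ : γ ∈ couplings μ ν) :
    W2 μ ν ^ 2 ≤ ∫ p, ‖p.1 - p.2‖ ^ 2 ∂γ := by
  unfold W2
  rw [Real.sq_sqrt ENNReal.toReal_nonneg]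
  refine ENNReal.toReal_le_of_le_ofReal (integral_nonneg fun p => by positivity) ?_
  rw [← coupling_lintegral_eq hγ]
  exact iInf₂_le γ hγ

lemma exists_coupling_lt {μ ν : P2 d} {c : ℝ} (hc : W2 μ ν ^ 2 < c) :
    ∃ γ ∈ couplings μ ν, ∫ p, ‖p.1 - p.2‖ ^ 2 ∂γ < c := by
  unfold W2 at hc
  rw [Real.sq_sqrt ENNReal.toReal_nonneg] at hc
  have hprod : μ.meas.prod ν.meas ∈ couplings μ ν := by
    constructor <;> simp
  have htop : (⨅ γ ∈ couplings μ ν, ∫⁻ p, ‖p.1 - p.2‖ₑ ^ 2 ∂γ) ≠ ⊤ := by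
    refine ne_top_of_le_ne_top ?_ (iInf₂_le _ hprod)
    rw [coupling_lintegral_eq hprod]
    exact ENNReal.ofReal_ne_top
  have h := (ENNReal.lt_ofReal_iff_toReal_lt htop).2 hc
  simp only [iInf_lt_iff] at h
  obtain ⟨γ, hγ, h⟩ := h
  refine ⟨γ, hγ, ?_⟩
  rw [coupling_lintegral_eq hγ] at h
  exact (ENNReal.ofReal_lt_ofReal_iff_of_nonneg (integral_nonneg fun p => by positivity)).1 h

lemma coupling_integral_mul_dist_le {μ ν : P2 d} {γ : Measure (Eucl d × Eucl d)}
    (hγ : γ ∈ couplings μ ν) {g : Eucl d × Eucl d → ℝ} (hg0 : ∀ p, 0 ≤ g p)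
    (hg : MemLp g 2 γ) :
    ∫ p, g p * ‖p.1 - p.2‖ ∂γ ≤ √(∫ p, g p ^ 2 ∂γ) * √(∫ p, ‖p.1 - p.2‖ ^ 2 ∂γ) := by
  have hdist : MemLp (fun p : Eucl d × Eucl d => ‖p.1 - p.2‖) 2 γ :=
    (memLp_two_iff_integrable_sq (by fun_prop)).2 (coupling_integrable_dist_sq hγ)
  have h := integral_mul_le_Lp_mul_Lq_of_nonneg (μ := γ) (f := g)
    (g := fun p : Eucl d × Eucl d => ‖p.1 - p.2‖) (p := 2) (q := 2)
    Real.HolderConjugate.two_two (.of_forall hg0) (.of_forall fun p => norm_nonneg _)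
    (by simpa using hg) (by simpa using hdist)
  simpa only [Real.rpow_two, ← Real.sqrt_eq_rpow] using h

lemma norm_integral_sub_le_of_coupling {μ ν : P2 d} {f : Eucl d → F}
    (hμ : Integrable f μ.meas) (hν : Integrable f ν.meas)
    {g : Eucl d × Eucl d → ℝ} (hg0 : ∀ p, 0 ≤ g p) {G : ℝ}
    (hfg : ∀ x y, ‖f x - f y‖ ≤ g (x, y) * ‖x - y‖)
    (hg : ∀ γ ∈ couplings μ ν, MemLp g 2 γ ∧ ∫ p, g p ^ 2 ∂γ ≤ G) :
    ‖∫ x, f x ∂μ.meas - ∫ x, f x ∂ν.meas‖ ≤ √G * W2 μ ν := by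
  have key : ∀ c, W2 μ ν ^ 2 < c →
      ‖∫ x, f x ∂μ.meas - ∫ x, f x ∂ν.meas‖ ≤ √G * √c := by
    intro c hc
    obtain ⟨γ, hγ, hlt⟩ := exists_coupling_lt hc
    obtain ⟨hgL, hgG⟩ := hg γ hγ
    have hdist : MemLp (fun p : Eucl d × Eucl d => ‖p.1 - p.2‖) 2 γ :=
      (memLp_two_iff_integrable_sq (by fun_prop)).2 (coupling_integrable_dist_sq hγ)
    rw [← coupling_integral_fst hγ hμ, ← coupling_integral_snd hγ hν,
      ← integral_sub (coupling_integrable_fst hγ hμ) (coupling_integrable_snd hγ hν)]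
    refine (norm_integral_le_of_norm_le (g := fun p => g p * ‖p.1 - p.2‖)
      (hgL.integrable_mul hdist) (.of_forall fun p => hfg p.1 p.2)).trans ?_
    refine (coupling_integral_mul_dist_le hγ hg0 hgL).trans ?_
    gcongr
  have hlim : Tendsto (fun c => √G * √c) (𝓝[>] (W2 μ ν ^ 2)) (𝓝 (√G * √(W2 μ ν ^ 2))) :=
    ((continuous_const.mul Real.continuous_sqrt).tendsto _).mono_left nhdsWithin_le_nhds
  rw [Real.sqrt_sq (W2_nonneg μ ν)] at hlim
  exact ge_of_tendsto hlim (eventually_nhdsWithin_of_forall key)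

/-- The second moment of a measure in `𝒫₂(ℝ^d)`. -/
def P2.m2 (μ : P2 d) : ℝ := ∫ x, ‖x‖ ^ 2 ∂μ.meas

lemma P2.m2_nonneg (μ : P2 d) : 0 ≤ μ.m2 := integral_nonneg fun x => by positivity

lemma QuadLip.norm_integral_sub_le {K : ℝ} {f : Eucl d → F} (hf : QuadLip K f) (hK : 0 ≤ K)
    (μ ν : P2 d) :
    ‖∫ x, f x ∂μ.meas - ∫ x, f x ∂ν.meas‖ ≤ K * √(3 * (1 + μ.m2 + ν.m2)) * W2 μ ν := by
  have h := norm_integral_sub_le_of_coupling (hf.integrable hK μ) (hf.integrable hK ν)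
    (g := fun p => K * (1 + ‖p.1‖ + ‖p.2‖)) (fun p => by positivity) hf
    (G := K ^ 2 * (3 * (1 + μ.m2 + ν.m2))) ?_
  · rwa [Real.sqrt_mul (sq_nonneg K), Real.sqrt_sq hK] at h
  intro γ hγ
  have := isProbabilityMeasure_of_coupling hγ
  have hfst := coupling_integrable_fst hγ μ.integrable_norm_sq
  have hsnd := coupling_integrable_snd hγ ν.integrable_norm_sq
  have hbound : Integrable
      (fun p : Eucl d × Eucl d => K ^ 2 * (3 * (1 + ‖p.1‖ ^ 2 + ‖p.2‖ ^ 2))) γ :=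
    ((((integrable_const 1).add hfst).add hsnd).const_mul 3).const_mul _
  have hle : ∀ p : Eucl d × Eucl d, (K * (1 + ‖p.1‖ + ‖p.2‖)) ^ 2 ≤
      K ^ 2 * (3 * (1 + ‖p.1‖ ^ 2 + ‖p.2‖ ^ 2)) := fun p => by
    rw [mul_pow]
    gcongr
    nlinarith [sq_nonneg (‖p.1‖ - 1), sq_nonneg (‖p.2‖ - 1), sq_nonneg (‖p.1‖ - ‖p.2‖)]
  have hsq : Integrable (fun p : Eucl d × Eucl d => (K * (1 + ‖p.1‖ + ‖p.2‖)) ^ 2) γ :=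
    hbound.mono' (by fun_prop) (.of_forall fun p => by
      rw [Real.norm_of_nonneg (sq_nonneg _)]; exact hle p)
  refine ⟨(memLp_two_iff_integrable_sq (by fun_prop)).2 hsq, ?_⟩
  refine (integral_mono hsq hbound hle).trans (le_of_eq ?_)
  have hone_add : Integrable (fun p : Eucl d × Eucl d => 1 + ‖p.1‖ ^ 2) γ :=
    (integrable_const 1).add hfst
  rw [integral_const_mul, integral_const_mul, integral_add hone_add hsnd,
    integral_add (integrable_const 1) hfst, coupling_integral_fst hγ μ.integrable_norm_sq,
    coupling_integral_snd hγ ν.integrable_norm_sq]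
  simp [P2.m2]

lemma norm_integral_sub_le_of_lipschitz {K : ℝ} {f : Eucl d → F} (hK : 0 ≤ K)
    (hf : ∀ x y, ‖f x - f y‖ ≤ K * ‖x - y‖) (μ ν : P2 d) :
    ‖∫ x, f x ∂μ.meas - ∫ x, f x ∂ν.meas‖ ≤ K * W2 μ ν := by
  have hq := QuadLip.of_lipschitz hK hf
  have h := norm_integral_sub_le_of_coupling (hq.integrable hK μ) (hq.integrable hK ν)
    (g := fun _ => K) (fun _ => hK) hf (G := K ^ 2) ?_
  · rwa [Real.sqrt_sq hK] at h
  intro γ hγ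
  have := isProbabilityMeasure_of_coupling hγ
  exact ⟨memLp_const K, by simp⟩

lemma P2.m2_le (μ ν : P2 d) : μ.m2 ≤ 2 * ν.m2 + 2 * W2 μ ν ^ 2 := by
  have key : ∀ c, W2 μ ν ^ 2 < c → (μ.m2 - 2 * ν.m2) / 2 ≤ c := by
    intro c hc
    obtain ⟨γ, hγ, hlt⟩ := exists_coupling_lt hc
    have hfst := coupling_integrable_fst hγ μ.integrable_norm_sq
    have hsnd := coupling_integrable_snd hγ ν.integrable_norm_sq
    have hdist := coupling_integrable_dist_sq hγ
    have h : ∫ p, ‖p.1‖ ^ 2 ∂γ ≤ ∫ p, (2 * ‖p.2‖ ^ 2 + 2 * ‖p.1 - p.2‖ ^ 2) ∂γ := by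
      refine integral_mono hfst ((hsnd.const_mul 2).add (hdist.const_mul 2)) fun p => ?_
      have h := norm_le_norm_add_norm_sub' p.1 p.2
      change ‖p.1‖ ^ 2 ≤ 2 * ‖p.2‖ ^ 2 + 2 * ‖p.1 - p.2‖ ^ 2
      nlinarith [sq_nonneg (‖p.2‖ - ‖p.1 - p.2‖), norm_nonneg p.1]
    rw [integral_add (hsnd.const_mul 2) (hdist.const_mul 2), integral_const_mul, integral_const_mul,
      coupling_integral_fst hγ μ.integrable_norm_sq,
      coupling_integral_snd hγ ν.integrable_norm_sq] at h
    unfold P2.m2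
    linarith
  have := le_of_forall_gt_imp_ge_of_dense key
  linarith

/-- Continuity on `[0,T]` of a curve in `𝒫₂(ℝ^d)` for the Wasserstein distance. -/
def W2ContinuousOn (T : ℝ) (μ : ℝ → P2 d) : Prop :=
  ∀ s ∈ Icc 0 T, Tendsto (fun t => W2 (μ t) (μ s)) (𝓝[Icc 0 T] s) (𝓝 0)

lemma W2ContinuousOn.exists_m2_le {T : ℝ} {μ : ℝ → P2 d} (hμ : W2ContinuousOn T μ) :
    ∃ M, ∀ t ∈ Icc 0 T, (μ t).m2 ≤ M := by
  refine isCompact_Icc.induction_on (p := fun s => ∃ M, ∀ t ∈ s, (μ t).m2 ≤ M) ⟨0, by simp⟩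
    (fun s t hst ⟨M, hM⟩ => ⟨M, fun x hx => hM x (hst hx)⟩) ?_ ?_
  · rintro s t ⟨M, hM⟩ ⟨N, hN⟩
    exact ⟨max M N, fun x hx => hx.elim (fun h => (hM x h).trans (le_max_left _ _))
      (fun h => (hN x h).trans (le_max_right _ _))⟩
  · intro s hs
    refine ⟨_, (hμ s hs).eventually (Iio_mem_nhds one_pos), 2 * (μ s).m2 + 2, fun t ht => ?_⟩
    have hm2 := (μ t).m2_le (μ s)
    have hW0 := W2_nonneg (μ t) (μ s)
    have hW1 : W2 (μ t) (μ s) < 1 := ht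
    nlinarith

lemma QuadLip.continuousOn_integral {K : ℝ} {f : Eucl d → F} (hf : QuadLip K f) (hK : 0 ≤ K)
    {T : ℝ} {μ : ℝ → P2 d} (hμ : W2ContinuousOn T μ) :
    ContinuousOn (fun t => ∫ x, f x ∂(μ t).meas) (Icc 0 T) := by
  intro s hs
  obtain ⟨M, hM⟩ := hμ.exists_m2_le
  rw [ContinuousWithinAt, tendsto_iff_norm_sub_tendsto_zero]
  have hlim := (hμ s hs).const_mul (K * √(3 * (1 + M + M)))
  rw [mul_zero] at hlim
  refine squeeze_zero' (.of_forall fun _ => norm_nonneg _) ?_ hlim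
  filter_upwards [self_mem_nhdsWithin] with t ht
  refine (hf.norm_integral_sub_le hK (μ t) (μ s)).trans ?_
  have := hM t ht
  have := hM s hs
  have := W2_nonneg (μ t) (μ s)
  gcongr

end Wasserstein

section MeanValue

variable {F : Type*} [NormedAddCommGroup F] [NormedSpace ℝ F]

lemma le_of_forall_Ioo_le {f g : ℝ → ℝ} {a b : ℝ} (hab : a < b)
    (hf : ContinuousWithinAt f (Ioo a b) a) (hg : ContinuousWithinAt g (Ioo a b) a)
    (h : ∀ t ∈ Ioo a b, f t ≤ g t) : f a ≤ g a := by
  refine ContinuousWithinAt.closure_le ?_ hf hg h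
  rw [closure_Ioo hab.ne]
  exact left_mem_Icc.2 hab.le

lemma norm_image_sub_le_of_interior {f f' : ℝ → F} {a b : ℝ} {B B' : ℝ → ℝ}
    (hf : ContinuousOn f (Icc a b)) (hf' : ∀ t ∈ Ioo a b, HasDerivAt f (f' t) t)
    (hB : ∀ t, HasDerivAt B (B' t) t) (bound : ∀ t ∈ Ioo a b, ‖f' t‖ ≤ B' t) :
    ∀ t ∈ Icc a b, ‖f t - f a‖ ≤ B t - B a := by
  intro t ht
  rcases ht.1.eq_or_lt with rfl | hat
  · simp
  have hfa : ContinuousWithinAt f (Ioo a t) a :=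
    (hf a (left_mem_Icc.2 (ht.1.trans ht.2))).mono
      (Ioo_subset_Icc_self.trans (Icc_subset_Icc_right ht.2))
  refine le_of_forall_Ioo_le (f := fun r => ‖f t - f r‖) (g := fun r => B t - B r) hat
    (continuousWithinAt_const.sub hfa).norm
    (continuousWithinAt_const.sub (hB a).continuousAt.continuousWithinAt) fun a' ha' => ?_
  exact image_norm_le_of_norm_deriv_right_le_deriv_boundary
    (f := fun r => f r - f a') (f' := f') (B := fun r => B r - B a') (B' := B')
    ((hf.mono (Icc_subset_Icc ha'.1.le ht.2)).sub continuousOn_const)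
    (fun r hr => ((hf' r ⟨ha'.1.trans_le hr.1, hr.2.trans_le ht.2⟩).sub_const _).hasDerivWithinAt)
    (by simp) (fun r => (hB r).sub_const _)
    (fun r hr => bound r ⟨ha'.1.trans_le hr.1, hr.2.trans_le ht.2⟩) (right_mem_Icc.2 ha'.2.le)

lemma norm_image_sub_le_of_interior_const {f f' : ℝ → F} {a b C : ℝ}
    (hf : ContinuousOn f (Icc a b)) (hf' : ∀ t ∈ Ioo a b, HasDerivAt f (f' t) t)
    (bound : ∀ t ∈ Ioo a b, ‖f' t‖ ≤ C) : ∀ t ∈ Icc a b, ‖f t - f a‖ ≤ C * (t - a) := by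
  intro t ht
  have h := norm_image_sub_le_of_interior hf hf' (B := fun t => C * t) (B' := fun _ => C)
    (fun t => by simpa using (hasDerivAt_id t).const_mul C) bound t ht
  linarith

lemma gronwall_interior {f f' : ℝ → F} {a b K κ : ℝ}
    (hf : ContinuousOn f (Icc a b)) (hf' : ∀ t ∈ Ioo a b, HasDerivAt f (f' t) t)
    (bound : ∀ t ∈ Ioo a b, ‖f' t‖ ≤ K * (κ + ‖f t‖)) :
    ∀ t ∈ Icc a b, κ + ‖f t‖ ≤ (κ + ‖f a‖) * Real.exp (K * (t - a)) := by
  intro t ht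
  rcases ht.1.eq_or_lt with rfl | hat
  · simp
  have hfa : ContinuousWithinAt f (Ioo a t) a :=
    (hf a (left_mem_Icc.2 (ht.1.trans ht.2))).mono
      (Ioo_subset_Icc_self.trans (Icc_subset_Icc_right ht.2))
  have hexp : ContinuousWithinAt (fun r => Real.exp (K * (t - r))) (Ioo a t) a := by fun_prop
  refine le_of_forall_Ioo_le (f := fun _ => κ + ‖f t‖)
    (g := fun r => (κ + ‖f r‖) * Real.exp (K * (t - r))) hat continuousWithinAt_const
    ((continuousWithinAt_const.add hfa.norm).mul hexp) fun a' ha' => ?_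
  have h := norm_le_gronwallBound_of_norm_deriv_right_le (a := a') (b := t)
    (f := f) (f' := f') (δ := ‖f a'‖) (K := K) (ε := K * κ)
    (hf.mono (Icc_subset_Icc ha'.1.le ht.2))
    (fun r hr => (hf' r ⟨ha'.1.trans_le hr.1, hr.2.trans_le ht.2⟩).hasDerivWithinAt) le_rfl
    (fun r hr => (bound r ⟨ha'.1.trans_le hr.1, hr.2.trans_le ht.2⟩).trans (by linarith))
    t (right_mem_Icc.2 ha'.2.le)
  unfold gronwallBound at h
  split_ifs at h with hK
  · subst hK
    simp only [zero_mul, Real.exp_zero, mul_one, add_zero] at h ⊢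
    linarith
  · rw [mul_div_cancel_left₀ _ hK] at h
    linarith

lemma gronwall_interior_backward {f f' : ℝ → F} {a b K κ : ℝ} (hab : a ≤ b)
    (hf : ContinuousOn f (Icc a b)) (hf' : ∀ t ∈ Ioo a b, HasDerivAt f (f' t) t)
    (bound : ∀ t ∈ Ioo a b, ‖f' t‖ ≤ K * (κ + ‖f t‖)) :
    κ + ‖f a‖ ≤ (κ + ‖f b‖) * Real.exp (K * (b - a)) := by
  have hmem : ∀ t ∈ Ioo a b, a + b - t ∈ Ioo a b := fun t ht =>
    ⟨by linarith [ht.2], by linarith [ht.1]⟩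
  have h := gronwall_interior (f := fun t => f (a + b - t)) (f' := fun t => -f' (a + b - t))
    (a := a) (b := b) (K := K) (κ := κ)
    (hf.comp (by fun_prop) fun t ht => ⟨by linarith [ht.2], by linarith [ht.1]⟩)
    (fun t ht => by
      simpa [Function.comp_def] using
        (hf' _ (hmem t ht)).scomp t ((hasDerivAt_id t).const_sub (a + b)))
    (fun t ht => by simpa using bound _ (hmem t ht)) b (right_mem_Icc.2 hab)
  simpa using h

lemma abs_sub_le_of_right_slope {A : ℝ → ℝ} {a b c : ℝ} (hab : a ≤ b)
    (hA : ContinuousOn A (Icc a b))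
    (h : ∀ t ∈ Ioo a b, ∀ κ > 0, ∀ᶠ z in 𝓝[>] t, |A z - A t| ≤ (c + κ) * (z - t)) :
    |A b - A a| ≤ c * (b - a) := by
  rcases hab.eq_or_lt with rfl | hab
  · simp
  have hAa : ContinuousWithinAt A (Ioo a b) a :=
    (hA a (left_mem_Icc.2 hab.le)).mono Ioo_subset_Icc_self
  refine le_of_forall_Ioo_le (f := fun s => |A b - A s|) (g := fun s => c * (b - s)) hab
    (continuousWithinAt_const.sub hAa).abs (by fun_prop) fun a' ha' => ?_
  refine image_le_of_liminf_slope_right_le_deriv_boundary (a := a') (b := b)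
    (f := fun s => |A s - A a'|) (B := fun s => c * (s - a')) (B' := fun _ => c)
    ((hA.mono (Icc_subset_Icc_left ha'.1.le)).sub continuousOn_const).abs (by simp)
    (by fun_prop) (fun x _ => ?_) (fun x hx r hr => ?_) (right_mem_Icc.2 ha'.2.le)
  · simpa using (((hasDerivAt_id x).sub_const a').const_mul c).hasDerivWithinAt
  · have hx' : x ∈ Ioo a b := ⟨ha'.1.trans_le hx.1, hx.2⟩
    refine Eventually.frequently ?_
    filter_upwards [h x hx' ((r - c) / 2) (by linarith), self_mem_nhdsWithin] with z hz hxz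
    have hzx : 0 < z - x := sub_pos.2 hxz
    rw [slope_def_field, div_lt_iff₀ hzx]
    have h1 : |A z - A a'| - |A x - A a'| ≤ |A z - A x| := by
      simpa using abs_sub_abs_le_abs_sub (A z - A a') (A x - A a')
    nlinarith

lemma le_two_mul_of_self_improving {ι : Type*} {f : ι → ℝ} (hf : ∃ M, ∀ i, f i ≤ M) {q : ℝ}
    (hq : 0 ≤ q) (h : ∀ B, 0 ≤ B → (∀ i, f i ≤ B) → ∀ i, f i ≤ q + B / 2) (i : ι) :
    f i ≤ 2 * q := by
  obtain ⟨M, hM⟩ := hf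
  have : Nonempty ι := ⟨i⟩
  have hbdd : BddAbove (range f) := ⟨M, by rintro _ ⟨j, rfl⟩; exact hM j⟩
  set S := max 0 (⨆ j, f j)
  have hfS : ∀ j, f j ≤ S := fun j => (le_ciSup hbdd j).trans (le_max_right _ _)
  have hfq := h S (le_max_left _ _) hfS
  have hSq : S ≤ q + S / 2 :=
    max_le (by have := le_max_left 0 (⨆ j, f j); linarith) (ciSup_le hfq)
  linarith [hfS i]

end MeanValue

section Flow

variable {E : Type*} [NormedAddCommGroup E] {T L C : ℝ} {v : ℝ → E → E}

/-- A time dependent vector field on `(0,T)`, continuous in time, `L`-Lipschitz in space and of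
linear growth. Nothing is required at the end points of the time interval, where the fields
`b(t, ·, μₜ)` need not extend continuously. -/
structure IsLipField (T L C : ℝ) (v : ℝ → E → E) : Prop where
  L_nonneg : 0 ≤ L
  C_nonneg : 0 ≤ C
  time : ∀ x, ContinuousOn (fun t => v t x) (Ioo 0 T)
  lip : ∀ t ∈ Ioo 0 T, ∀ x y, ‖v t x - v t y‖ ≤ L * ‖x - y‖
  growth : ∀ t ∈ Ioo 0 T, ∀ x, ‖v t x‖ ≤ C * (1 + ‖x‖)

lemma IsLipField.continuousOn_uncurry (hv : IsLipField T L C v) :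
    ContinuousOn (fun p : ℝ × E => v p.1 p.2) (Ioo 0 T ×ˢ univ) :=
  continuousOn_prod_of_continuousOn_lipschitzOnWith' (fun p : ℝ × E => v p.1 p.2) L.toNNReal
    (fun t ht => LipschitzOnWith.of_dist_le_mul fun x _ y _ => by
      rw [dist_eq_norm, dist_eq_norm, Real.coe_toNNReal _ hv.L_nonneg]
      exact hv.lip t ht x y) fun x _ => hv.time x

lemma IsLipField.continuousOn_comp (hv : IsLipField T L C v) {y : ℝ → E} {s : ℝ}
    (hs : 0 ≤ s) (hy : ContinuousOn y (Ioo s T)) :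
    ContinuousOn (fun r => v r (y r)) (Ioo s T) :=
  hv.continuousOn_uncurry.comp (continuousOn_id.prodMk hy)
    fun _ hr => ⟨⟨hs.trans_lt hr.1, hr.2⟩, mem_univ _⟩

lemma IsLipField.integrableOn_comp (hv : IsLipField T L C v) {y : ℝ → E} {s : ℝ}
    (hs : 0 ≤ s) (hy : Continuous y) : IntegrableOn (fun r => v r (y r)) (Icc s T) := by
  rw [integrableOn_Icc_iff_integrableOn_Ioo]
  obtain ⟨M, hM⟩ := (isCompact_Icc (a := s) (b := T)).exists_bound_of_continuousOn hy.continuousOn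
  refine (integrable_const (C * (1 + M))).mono'
    ((hv.continuousOn_comp hs hy.continuousOn).aestronglyMeasurable measurableSet_Ioo) ?_
  filter_upwards [ae_restrict_mem measurableSet_Ioo] with r hr
  refine (hv.growth r ⟨hs.trans_lt hr.1, hr.2⟩ _).trans ?_
  have := hM r (Ioo_subset_Icc_self hr)
  have := hv.C_nonneg
  gcongr

lemma IsLipField.intervalIntegrable_comp (hv : IsLipField T L C v) {y : ℝ → E} {s t : ℝ}
    (hs : 0 ≤ s) (ht : t ∈ Icc s T) (hy : Continuous y) :
    IntervalIntegrable (fun r => v r (y r)) volume s t := by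
  rw [intervalIntegrable_iff_integrableOn_Icc_of_le ht.1]
  exact (hv.integrableOn_comp hs hy).mono_set (Icc_subset_Icc_right ht.2)

variable [NormedSpace ℝ E]

lemma IsLipField.continuousOn_picard (hv : IsLipField T L C v) {s : ℝ} (hs : s ∈ Icc 0 T)
    {y : ℝ → E} (hy : Continuous y) (x : E) : ContinuousOn (ODE.picard v s x y) (Icc s T) := by
  have h := intervalIntegral.continuousOn_primitive_interval (μ := volume)
    (f := fun r => v r (y r)) (a := s) (b := T) (by
      rw [uIcc_of_le hs.2]
      exact hv.integrableOn_comp hs.1 hy)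
  rw [uIcc_of_le hs.2] at h
  exact continuousOn_const.add h

lemma IsLipField.hasDerivAt_picard [CompleteSpace E] (hv : IsLipField T L C v) {s t : ℝ}
    (hs : 0 ≤ s) (ht : t ∈ Ioo s T) {y : ℝ → E} (hy : Continuous y) (x : E) :
    HasDerivAt (ODE.picard v s x y) (v t (y t)) t := by
  have hc := hv.continuousOn_comp hs hy.continuousOn
  exact HasDerivAt.const_add x (intervalIntegral.integral_hasDerivAt_right
    (hv.intervalIntegrable_comp hs (Ioo_subset_Icc_self ht) hy)
    (hc.stronglyMeasurableAtFilter isOpen_Ioo t ht)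
    ((hc t ht).continuousAt (Ioo_mem_nhds ht.1 ht.2)))

lemma intervalIntegral_exp_mul_le {l : ℝ} (hl : 0 < l) (s t : ℝ) :
    ∫ r in s..t, Real.exp (l * r) ≤ Real.exp (l * t) / l := by
  rw [intervalIntegral.integral_comp_mul_left (fun r => Real.exp r) hl.ne', integral_exp,
    smul_eq_mul, ← div_eq_inv_mul]
  gcongr
  linarith [Real.exp_pos (l * s)]

lemma IsLipField.norm_picard_sub_le (hv : IsLipField T L C v) {s t : ℝ} (hs : 0 ≤ s)
    (ht : t ∈ Icc s T) {y z : ℝ → E} (hy : Continuous y) (hz : Continuous z) {l D : ℝ}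
    (hl : 0 < l) (hD : 0 ≤ D) (h : ∀ r ∈ Ioo s T, ‖y r - z r‖ ≤ D * Real.exp (l * r)) (x : E) :
    ‖ODE.picard v s x y t - ODE.picard v s x z t‖ ≤ L * D * (Real.exp (l * t) / l) := by
  have hL := hv.L_nonneg
  rw [ODE.picard_apply, ODE.picard_apply, add_sub_add_left_eq_sub,
    ← intervalIntegral.integral_sub (hv.intervalIntegrable_comp hs ht hy)
      (hv.intervalIntegrable_comp hs ht hz)]
  calc ‖∫ r in s..t, (v r (y r) - v r (z r))‖
      ≤ ∫ r in s..t, L * D * Real.exp (l * r) := by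
        refine intervalIntegral.norm_integral_le_of_norm_le ht.1 ?_
          (Continuous.intervalIntegrable (by fun_prop) _ _)
        rw [← ae_restrict_iff' measurableSet_Ioc, ← Measure.restrict_congr_set Ioo_ae_eq_Ioc]
        filter_upwards [ae_restrict_mem measurableSet_Ioo] with r hr
        have hrT : r ∈ Ioo s T := ⟨hr.1, hr.2.trans_le ht.2⟩
        refine (hv.lip r ⟨hs.trans_lt hr.1, hrT.2⟩ _ _).trans ?_
        rw [mul_assoc]
        exact mul_le_mul_of_nonneg_left (h r hrT) hL
    _ ≤ L * D * (Real.exp (l * t) / l) := by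
        rw [intervalIntegral.integral_const_mul]
        exact mul_le_mul_of_nonneg_left (intervalIntegral_exp_mul_le hl s t) (by positivity)

/-- The continuous extension to `ℝ` of the curve `t ↦ e^{lt} z(t)`. The weight turns the Picard
operator into a contraction of the whole of `C([s,T], E)`. -/
def weightedCurve {s : ℝ} (hs : s ≤ T) (l : ℝ) (z : C(Icc s T, E)) (r : ℝ) : E :=
  Real.exp (l * r) • z (projIcc s T hs r)

lemma continuous_weightedCurve {s : ℝ} (hs : s ≤ T) (l : ℝ) (z : C(Icc s T, E)) :
    Continuous (weightedCurve hs l z) :=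
  Continuous.smul (by fun_prop) (z.continuous.comp continuous_projIcc)

lemma norm_weightedCurve_sub_le {s : ℝ} (hs : s ≤ T) (l : ℝ) (y z : C(Icc s T, E)) (r : ℝ) :
    ‖weightedCurve hs l y r - weightedCurve hs l z r‖ ≤ dist y z * Real.exp (l * r) := by
  rw [weightedCurve, weightedCurve, ← smul_sub, norm_smul, Real.norm_of_nonneg (Real.exp_pos _).le,
    mul_comm, ← dist_eq_norm]
  gcongr
  exact ContinuousMap.dist_apply_le_dist _

/-- The Picard operator of `v` conjugated with the weight `e^{lt}`. -/
def IsLipField.weightedPicard (hv : IsLipField T L C v) {s : ℝ} (hs : s ∈ Icc 0 T) (l : ℝ) (x : E)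
    (z : C(Icc s T, E)) : C(Icc s T, E) where
  toFun t := Real.exp (-(l * t)) • ODE.picard v s x (weightedCurve hs.2 l z) t
  continuous_toFun := Continuous.smul (by fun_prop)
    (hv.continuousOn_picard hs (continuous_weightedCurve hs.2 l z) x).domRestrict

lemma IsLipField.contractingWith_weightedPicard (hv : IsLipField T L C v) {s : ℝ}
    (hs : s ∈ Icc 0 T) (x : E) :
    ContractingWith (1 / 2) (hv.weightedPicard hs (2 * L + 1) x) := by
  have hL := hv.L_nonneg
  refine ⟨by norm_num, LipschitzWith.of_dist_le_mul fun y z => ?_⟩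
  rw [ContinuousMap.dist_le (by positivity)]
  intro t
  set l := 2 * L + 1 with hl
  have hl0 : 0 < l := by positivity
  have h := hv.norm_picard_sub_le hs.1 t.2 (continuous_weightedCurve hs.2 l y)
    (continuous_weightedCurve hs.2 l z) hl0 dist_nonneg
    (fun r _ => norm_weightedCurve_sub_le hs.2 l y z r) x
  rw [dist_eq_norm]
  simp only [weightedPicard, ContinuousMap.coe_mk]
  rw [← smul_sub, norm_smul, Real.norm_of_nonneg (Real.exp_pos _).le]
  calc Real.exp (-(l * t)) * _
      ≤ Real.exp (-(l * t)) * (L * dist y z * (Real.exp (l * t) / l)) := by gcongr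
    _ = (L / l) * dist y z := by rw [Real.exp_neg]; field_simp
    _ ≤ ((1 / 2 : NNReal) : ℝ) * dist y z := by
        refine mul_le_mul_of_nonneg_right ?_ dist_nonneg
        push_cast
        rw [div_le_div_iff₀ hl0 two_pos]
        linarith [hl]

/-- `y` is an integral curve of `v` on `[s,T]` starting at `x`. -/
structure IsTrajectory (T : ℝ) (v : ℝ → E → E) (s : ℝ) (x : E) (y : ℝ → E) : Prop where
  initial : y s = x
  continuousOn : ContinuousOn y (Icc s T)
  hasDerivAt : ∀ t ∈ Ioo s T, HasDerivAt y (v t (y t)) t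

lemma IsLipField.dist_trajectory_le (hv : IsLipField T L C v) {s : ℝ} (hs : 0 ≤ s)
    {x x' : E} {y z : ℝ → E} (hy : IsTrajectory T v s x y) (hz : IsTrajectory T v s x' z) {t : ℝ}
    (ht : t ∈ Icc s T) : ‖y t - z t‖ ≤ ‖x - x'‖ * Real.exp (L * (t - s)) := by
  have h := gronwall_interior (f := fun t => y t - z t) (κ := 0) (K := L)
    (hy.continuousOn.sub hz.continuousOn)
    (fun t ht => (hy.hasDerivAt t ht).sub (hz.hasDerivAt t ht))
    (fun t ht => by simpa using hv.lip t ⟨hs.trans_lt ht.1, ht.2⟩ _ _) t ht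
  simpa [hy.initial, hz.initial] using h

open Classical in
/-- The flow of `v`: `flow T v s t x` is the value at time `t` of the integral curve that is at `x`
at time `s`. -/
def flow (T : ℝ) (v : ℝ → E → E) (s t : ℝ) (x : E) : E :=
  if h : ∃ y, IsTrajectory T v s x y then h.choose t else x

variable [CompleteSpace E]

lemma IsLipField.exists_trajectory (hv : IsLipField T L C v) {s : ℝ} (hs : s ∈ Icc 0 T)
    (x : E) : ∃ y, IsTrajectory T v s x y := by
  set l := 2 * L + 1
  have : Nonempty (C(Icc s T, E)) := ⟨0⟩
  have hN := hv.contractingWith_weightedPicard hs x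
  set z := hN.fixedPoint
  have hcont := continuous_weightedCurve hs.2 l z
  have hfix : ∀ t ∈ Icc s T,
      weightedCurve hs.2 l z t = ODE.picard v s x (weightedCurve hs.2 l z) t := by
    intro t ht
    have hz : hv.weightedPicard hs l x z ⟨t, ht⟩ = z ⟨t, ht⟩ :=
      DFunLike.congr_fun hN.fixedPoint_isFixedPt _
    rw [weightedCurve, projIcc_of_mem hs.2 ht, ← hz]
    simp only [weightedPicard, ContinuousMap.coe_mk]
    rw [smul_smul, ← Real.exp_add, add_neg_cancel, Real.exp_zero, one_smul]
  refine ⟨_, ?_, hcont.continuousOn, fun t ht => ?_⟩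
  · rw [hfix s ⟨le_rfl, hs.2⟩, ODE.picard_apply₀]
  · refine (hv.hasDerivAt_picard hs.1 ht hcont x).congr_of_eventuallyEq ?_
    filter_upwards [Ioo_mem_nhds ht.1 ht.2] with r hr
    exact hfix r (Ioo_subset_Icc_self hr)

lemma IsLipField.flow_trajectory (hv : IsLipField T L C v) {s : ℝ} (hs : s ∈ Icc 0 T)
    (x : E) : IsTrajectory T v s x (fun t => flow T v s t x) := by
  have h := hv.exists_trajectory hs x
  have hflow : (fun t => flow T v s t x) = h.choose := funext fun t => dif_pos h
  rw [hflow]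
  exact h.choose_spec

lemma IsLipField.flow_self (hv : IsLipField T L C v) {s : ℝ} (hs : s ∈ Icc 0 T)
    (x : E) : flow T v s s x = x := (hv.flow_trajectory hs x).initial

lemma IsLipField.flow_lipschitz (hv : IsLipField T L C v) {s t : ℝ} (hs : 0 ≤ s)
    (ht : t ∈ Icc s T) (x y : E) :
    ‖flow T v s t x - flow T v s t y‖ ≤ Real.exp (L * T) * ‖x - y‖ := by
  have hs' : s ∈ Icc 0 T := ⟨hs, ht.1.trans ht.2⟩
  refine (hv.dist_trajectory_le hs (hv.flow_trajectory hs' x) (hv.flow_trajectory hs' y) ht).trans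
    ?_
  rw [mul_comm]
  have := hv.L_nonneg
  gcongr
  linarith [ht.2]

lemma IsLipField.continuous_flow (hv : IsLipField T L C v) {s t : ℝ} (hs : 0 ≤ s)
    (ht : t ∈ Icc s T) : Continuous (flow T v s t) :=
  (LipschitzWith.of_dist_le_mul (K := (Real.exp (L * T)).toNNReal) fun x y => by
    rw [dist_eq_norm, dist_eq_norm, Real.coe_toNNReal _ (Real.exp_pos _).le]
    exact hv.flow_lipschitz hs ht x y).continuous

lemma IsLipField.flow_flow (hv : IsLipField T L C v) {s r t : ℝ} (hs : 0 ≤ s)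
    (hsr : s ≤ r) (hrt : r ≤ t) (htT : t ≤ T) (x : E) :
    flow T v r t (flow T v s r x) = flow T v s t x := by
  have hr : r ∈ Icc 0 T := ⟨hs.trans hsr, hrt.trans htT⟩
  have hx := hv.flow_trajectory ⟨hs, hsr.trans hr.2⟩ x
  have hrest : IsTrajectory T v r (flow T v s r x) (fun t => flow T v s t x) :=
    ⟨rfl, hx.continuousOn.mono (Icc_subset_Icc_left hsr),
      fun q hq => hx.hasDerivAt q ⟨hsr.trans_lt hq.1, hq.2⟩⟩
  have h := hv.dist_trajectory_le hr.1 (hv.flow_trajectory hr (flow T v s r x)) hrest ⟨hrt, htT⟩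
  simpa [sub_eq_zero] using h

lemma IsLipField.flow_growth (hv : IsLipField T L C v) {s t : ℝ} (hs : 0 ≤ s)
    (ht : t ∈ Icc s T) (x : E) :
    1 + ‖flow T v s t x‖ ≤ Real.exp (C * T) * (1 + ‖x‖) := by
  have hx := hv.flow_trajectory ⟨hs, ht.1.trans ht.2⟩ x
  have h := gronwall_interior (κ := 1) (K := C) hx.continuousOn hx.hasDerivAt
    (fun t ht => hv.growth t ⟨hs.trans_lt ht.1, ht.2⟩ _) t ht
  rw [hx.initial, mul_comm] at h
  refine h.trans ?_
  have := hv.C_nonneg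
  gcongr
  linarith [ht.2]

lemma IsLipField.flow_growth_backward (hv : IsLipField T L C v) {s t : ℝ} (hs : 0 ≤ s)
    (ht : t ∈ Icc s T) (x : E) :
    1 + ‖x‖ ≤ Real.exp (C * T) * (1 + ‖flow T v s t x‖) := by
  have hx := hv.flow_trajectory ⟨hs, ht.1.trans ht.2⟩ x
  have h := gronwall_interior_backward (κ := 1) (K := C) ht.1
    (hx.continuousOn.mono (Icc_subset_Icc_right ht.2))
    (fun r hr => hx.hasDerivAt r ⟨hr.1, hr.2.trans_le ht.2⟩)
    (fun r hr => hv.growth r ⟨hs.trans_lt hr.1, hr.2.trans_le ht.2⟩ _)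
  rw [hx.initial, mul_comm] at h
  refine h.trans ?_
  have := hv.C_nonneg
  gcongr
  linarith [ht.2]

lemma IsLipField.norm_flow_sub_le (hv : IsLipField T L C v) {s t : ℝ} (hs : 0 ≤ s)
    (ht : t ∈ Icc s T) (x : E) :
    ‖flow T v s t x - x‖ ≤ C * Real.exp (C * T) * (1 + ‖x‖) * (t - s) := by
  have hx := hv.flow_trajectory ⟨hs, ht.1.trans ht.2⟩ x
  have h := norm_image_sub_le_of_interior_const hx.continuousOn hx.hasDerivAt
    (C := C * Real.exp (C * T) * (1 + ‖x‖)) (fun r hr => ?_) t ht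
  · rwa [hx.initial] at h
  · refine (hv.growth r ⟨hs.trans_lt hr.1, hr.2⟩ _).trans ?_
    rw [mul_assoc]
    exact mul_le_mul_of_nonneg_left (hv.flow_growth hs (Ioo_subset_Icc_self hr) x) hv.C_nonneg

end Flow

section Laplacian

variable {d : ℕ}

lemma norm_gradient_eq (φ : Eucl d → ℝ) (x : Eucl d) : ‖∇ φ x‖ = ‖fderiv ℝ φ x‖ := by
  simp [gradient]

lemma inner_gradient (φ : Eucl d → ℝ) (x y : Eucl d) : inner ℝ y (∇ φ x) = fderiv ℝ φ x y := by
  rw [real_inner_comm]; simp [gradient]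

lemma abs_laplacian_le (φ : Eucl d → ℝ) (x : Eucl d) :
    |Δ φ x| ≤ d * ‖fderiv ℝ (fderiv ℝ φ) x‖ := by
  rw [InnerProductSpace.laplacian_eq_iteratedFDeriv_orthonormalBasis φ
    (EuclideanSpace.basisFun (Fin d) ℝ)]
  refine (Finset.abs_sum_le_sum_abs _ _).trans ?_
  refine (Finset.sum_le_card_nsmul _ _ (‖fderiv ℝ (fderiv ℝ φ) x‖) fun i _ => ?_).trans ?_
  · rw [iteratedFDeriv_two_apply]
    simp only [Matrix.cons_val_zero, Matrix.cons_val_one]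
    refine ((fderiv ℝ (fderiv ℝ φ) x _).le_opNorm _).trans ?_
    refine (mul_le_mul_of_nonneg_right (ContinuousLinearMap.le_opNorm _ _) (norm_nonneg _)).trans ?_
    simp
  · simp

end Laplacian

section Mollification

variable {d : ℕ}

/-- Mollification of `w` by a normalized bump function. -/
def mollify (η : ContDiffBump (0 : Eucl d)) (w : Eucl d → ℝ) : Eucl d → ℝ :=
  MeasureTheory.convolution (η.normed volume) w (ContinuousLinearMap.lsmul ℝ ℝ) volume

/-- The constant that controls the second derivatives of mollifications. -/
def bumpConst (η : ContDiffBump (0 : Eucl d)) : ℝ := ∫ z, ‖fderiv ℝ (η.normed volume) z‖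

variable {η : ContDiffBump (0 : Eucl d)} {w : Eucl d → ℝ} {K : ℝ}

lemma mollify_apply (x : Eucl d) : mollify η w x = ∫ z, w (x - z) • η.normed volume z :=
  integral_congr_ae (.of_forall fun _ => mul_comm _ _)

lemma contDiff_mollify (hw : Continuous w) : ContDiff ℝ ∞ (mollify η w) :=
  η.hasCompactSupport_normed.contDiff_convolution_left _ η.contDiff_normed hw.locallyIntegrable

lemma hasCompactSupport_mollify (hw : HasCompactSupport w) :
    HasCompactSupport (mollify η w) :=
  η.hasCompactSupport_normed.convolution _ hw

lemma bumpConst_nonneg (η : ContDiffBump (0 : Eucl d)) : 0 ≤ bumpConst η :=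
  integral_nonneg fun _ => norm_nonneg _

lemma fderiv_mollify (hw : Continuous w) (x : Eucl d) :
    fderiv ℝ (mollify η w) x = ∫ z, w (x - z) • fderiv ℝ (η.normed volume) z := by
  rw [mollify, (η.hasCompactSupport_normed.hasFDerivAt_convolution_left
    (ContinuousLinearMap.lsmul ℝ ℝ) η.contDiff_normed hw.locallyIntegrable x).fderiv]
  refine integral_congr_ae (.of_forall fun z => ?_)
  ext y
  simp [ContinuousLinearMap.precompL, mul_comm]

lemma norm_integral_smul_sub_integral_smul_le {G : Type*} [NormedAddCommGroup G] [NormedSpace ℝ G]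
    {k : Eucl d → G} {r B : ℝ} (hk : Continuous k) (hs : tsupport k ⊆ Metric.closedBall 0 r)
    {f g : Eucl d → ℝ} (hf : Continuous f) (hg : Continuous g)
    (hB : ∀ z, ‖z‖ ≤ r → |f z - g z| ≤ B) :
    ‖(∫ z, f z • k z) - ∫ z, g z • k z‖ ≤ B * ∫ z, ‖k z‖ := by
  have hc : HasCompactSupport k := (isCompact_closedBall 0 r).of_isClosed_subset isClosed_closure hs
  have hint {h : Eucl d → ℝ} (hh : Continuous h) : Integrable fun z => h z • k z :=
    (hh.smul hk).integrable_of_hasCompactSupport hc.smul_left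
  rw [← integral_sub (hint hf) (hint hg), ← integral_const_mul]
  refine norm_integral_le_of_norm_le ((hk.integrable_of_hasCompactSupport hc).norm.const_mul B)
    (.of_forall fun z => ?_)
  rw [← sub_smul, norm_smul]
  by_cases hz : k z = 0
  · simp [hz]
  · gcongr
    exact hB z (by simpa using hs (subset_closure hz))

lemma tsupport_bump_subset : tsupport (η.normed volume) ⊆ Metric.closedBall 0 η.rOut := by
  rw [η.tsupport_normed_eq]

lemma integral_norm_bump : ∫ z, ‖η.normed volume z‖ = 1 := by
  simp only [Real.norm_of_nonneg (η.nonneg_normed _), η.integral_normed]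

lemma abs_mollify_sub_mollify_le {w' : Eucl d → ℝ} (hw : Continuous w) (hw' : Continuous w')
    {x y : Eucl d} {B : ℝ} (hB : ∀ z, ‖z‖ ≤ η.rOut → |w (x - z) - w' (y - z)| ≤ B) :
    |mollify η w x - mollify η w' y| ≤ B := by
  have h := norm_integral_smul_sub_integral_smul_le (η.continuous_normed (μ := volume))
    tsupport_bump_subset (f := fun z => w (x - z)) (g := fun z => w' (y - z))
    (by fun_prop) (by fun_prop) hB
  rwa [integral_norm_bump, mul_one, ← mollify_apply, ← mollify_apply] at h

lemma QuadLip.abs_mollify_sub_le (hw : QuadLip K w) (hK : 0 ≤ K) (hη : η.rOut ≤ 1) (x : Eucl d) :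
    |mollify η w x - w x| ≤ 2 * K * η.rOut * (1 + ‖x‖) := by
  have hc := hw.continuous
  have hB : ∀ z, ‖z‖ ≤ η.rOut → |w (x - z) - w x| ≤ 2 * K * η.rOut * (1 + ‖x‖) := by
    intro z hz
    have hxz := norm_sub_le x z
    calc |w (x - z) - w x| ≤ K * (1 + ‖x - z‖ + ‖x‖) * ‖x - z - x‖ := hw _ _
      _ ≤ K * (2 * (1 + ‖x‖)) * η.rOut := by
        rw [sub_sub_cancel_left, norm_neg]
        gcongr
        linarith
      _ = 2 * K * η.rOut * (1 + ‖x‖) := by ring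
  have h := norm_integral_smul_sub_integral_smul_le (η.continuous_normed (μ := volume))
    tsupport_bump_subset (f := fun z => w (x - z)) (g := fun _ => w x)
    (by fun_prop) (by fun_prop) hB
  rwa [integral_norm_bump, mul_one, ← mollify_apply, integral_smul, η.integral_normed, smul_eq_mul,
    mul_one] at h

lemma QuadLip.abs_translate_sub_translate_le (hw : QuadLip K w) (hK : 0 ≤ K) (hη : η.rOut ≤ 1)
    (x y : Eucl d) {z : Eucl d} (hz : ‖z‖ ≤ η.rOut) :
    |w (x - z) - w (y - z)| ≤ 3 * K * (1 + ‖x‖ + ‖y‖) * ‖x - y‖ := by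
  refine (hw _ _).trans ?_
  rw [sub_sub_sub_cancel_right]
  refine mul_le_mul_of_nonneg_right ?_ (norm_nonneg _)
  rw [mul_comm 3 K, mul_assoc]
  refine mul_le_mul_of_nonneg_left ?_ hK
  linarith [norm_sub_le x z, norm_sub_le y z, norm_nonneg x, norm_nonneg y]

protected lemma QuadLip.mollify (hw : QuadLip K w) (hK : 0 ≤ K) (hη : η.rOut ≤ 1) :
    QuadLip (3 * K) (mollify η w) := fun x y =>
  abs_mollify_sub_mollify_le hw.continuous hw.continuous fun _ hz =>
    hw.abs_translate_sub_translate_le hK hη x y hz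

protected lemma QuadLip.fderiv_mollify (hw : QuadLip K w) (hK : 0 ≤ K) (hη : η.rOut ≤ 1) :
    QuadLip (3 * K * bumpConst η) (fderiv ℝ (mollify η w)) := by
  intro x y
  have hc := hw.continuous
  have hη₁ : ContDiff ℝ 1 (η.normed volume) := η.contDiff_normed
  rw [fderiv_mollify hc, fderiv_mollify hc]
  refine (norm_integral_smul_sub_integral_smul_le (hη₁.continuous_fderiv one_ne_zero)
    ((tsupport_fderiv_subset ℝ).trans tsupport_bump_subset) (by fun_prop) (by fun_prop)
    fun z hz => hw.abs_translate_sub_translate_le hK hη x y hz).trans_eq ?_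
  rw [← bumpConst]
  ring

lemma QuadLip.norm_fderiv_le {E F : Type*} [NormedAddCommGroup E] [NormedSpace ℝ E]
    [NormedAddCommGroup F] [NormedSpace ℝ F] {f : E → F} (hf : QuadLip K f) (hK : 0 ≤ K) (x : E) :
    ‖fderiv ℝ f x‖ ≤ K * (1 + 2 * ‖x‖) := by
  have hlim : Tendsto (fun κ : ℝ => K * (1 + 2 * ‖x‖ + κ)) (𝓝[>] 0) (𝓝 (K * (1 + 2 * ‖x‖ + 0))) :=
    (Continuous.tendsto (by fun_prop) 0).mono_left nhdsWithin_le_nhds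
  rw [add_zero] at hlim
  refine ge_of_tendsto hlim (eventually_nhdsWithin_of_forall fun κ (hκ : 0 < κ) => ?_)
  refine norm_fderiv_le_of_lip' ℝ (by positivity) ?_
  filter_upwards [Metric.ball_mem_nhds x hκ] with y hy
  refine (hf y x).trans ?_
  have hyx : ‖y - x‖ < κ := by rwa [← dist_eq_norm]
  have hy' := norm_le_norm_add_norm_sub' y x
  exact mul_le_mul_of_nonneg_right (mul_le_mul_of_nonneg_left (by linarith) hK) (norm_nonneg _)

lemma QuadLip.abs_laplacian_mollify_le (hw : QuadLip K w) (hK : 0 ≤ K) (hη : η.rOut ≤ 1)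
    (x : Eucl d) :
    |Δ (mollify η w) x| ≤ d * (3 * K * bumpConst η * (1 + 2 * ‖x‖)) := by
  refine (abs_laplacian_le _ x).trans (mul_le_mul_of_nonneg_left ?_ (Nat.cast_nonneg _))
  have := bumpConst_nonneg η
  exact (hw.fderiv_mollify hK hη).norm_fderiv_le (by positivity) x

lemma exists_lipschitz_of_hasCompactSupport {E F : Type*} [NormedAddCommGroup E] [NormedSpace ℝ E]
    [NormedAddCommGroup F] [NormedSpace ℝ F] {f : E → F} (hf : ContDiff ℝ 1 f)
    (hc : HasCompactSupport f) : ∃ K, 0 ≤ K ∧ ∀ x y, ‖f x - f y‖ ≤ K * ‖x - y‖ := by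
  obtain ⟨K, hK⟩ := hf.lipschitzWith_of_hasCompactSupport hc one_ne_zero
  exact ⟨K, K.2, fun x y => by simpa [dist_eq_norm] using hK.dist_le_mul x y⟩

lemma norm_image_add_sub_le_of_lipschitz_fderiv {E F : Type*} [NormedAddCommGroup E]
    [NormedSpace ℝ E] [NormedAddCommGroup F] [NormedSpace ℝ F] {f : E → F}
    (hf : Differentiable ℝ f) {A : ℝ} (hA : 0 ≤ A)
    (hLip : ∀ x y, ‖fderiv ℝ f x - fderiv ℝ f y‖ ≤ A * ‖x - y‖) (x k : E) :
    ‖f (x + k) - f x - fderiv ℝ f x k‖ ≤ A * ‖k‖ ^ 2 := by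
  have h := (convex_closedBall x ‖k‖).norm_image_sub_le_of_norm_fderiv_le' (𝕜 := ℝ)
    (f := f) (φ := fderiv ℝ f x) (C := A * ‖k‖) (x := x) (y := x + k) (fun z _ => hf z)
    (fun z hz => (hLip z x).trans (by gcongr; simpa [dist_eq_norm] using hz)) (by simp) (by simp)
  rwa [add_sub_cancel_left, mul_assoc, ← sq] at h

end Mollification

section Moments

variable {d : ℕ}

lemma P2.norm_integral_le {F : Type*} [NormedAddCommGroup F] [NormedSpace ℝ F] {μ : P2 d} {M : ℝ}
    (hM : μ.m2 ≤ M) {f : Eucl d → F} {A B : ℝ} (hB : 0 ≤ B) (hf : ∀ x, ‖f x‖ ≤ A + B * ‖x‖ ^ 2) :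
    ‖∫ x, f x ∂μ.meas‖ ≤ A + B * M := by
  have hi := μ.integrable_norm_sq.const_mul B
  refine (norm_integral_le_of_norm_le ((integrable_const A).add hi) (.of_forall hf)).trans ?_
  rw [integral_add' (integrable_const A) hi, integral_const_mul, ← P2.m2]
  simp only [integral_const, probReal_univ, smul_eq_mul, one_mul]
  gcongr

/-- A compactly supported truncation of `(‖x‖ - R)₊`, at distance `N` from the origin. -/
def shell (R N : ℝ) (x : Eucl d) : ℝ := max 0 (min (‖x‖ - R) (N - ‖x‖))

variable {R N : ℝ}

lemma shell_nonneg (R N : ℝ) (x : Eucl d) : 0 ≤ shell R N x := le_max_left _ _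

lemma shell_le (R N : ℝ) (x : Eucl d) : shell R N x ≤ max 0 (‖x‖ - R) :=
  max_le_max_left 0 (min_le_left _ _)

lemma shell_le_norm (hR : 0 ≤ R) (x : Eucl d) : shell R N x ≤ ‖x‖ :=
  (shell_le R N x).trans (max_le (norm_nonneg x) (by linarith))

lemma shell_eq_zero {x : Eucl d} (hx : N ≤ ‖x‖) : shell R N x = 0 :=
  max_eq_left ((min_le_right _ _).trans (sub_nonpos.2 hx))

lemma abs_shell_sub_le (R N : ℝ) (x y : Eucl d) : |shell R N x - shell R N y| ≤ ‖x - y‖ := by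
  refine (abs_max_sub_max_le_max _ _ _ _).trans (max_le (by simp) ?_)
  refine (abs_min_sub_min_le_max _ _ _ _).trans (max_le ?_ ?_)
  · simpa using abs_norm_sub_norm_le x y
  · rw [sub_sub_sub_cancel_left, norm_sub_rev]
    exact abs_norm_sub_norm_le y x

lemma quadLip_sq_shell (hR : 0 ≤ R) : QuadLip 1 (fun x : Eucl d => shell R N x ^ 2) := by
  intro x y
  have hx := shell_le_norm (N := N) hR x
  have hy := shell_le_norm (N := N) hR y
  have hx0 := shell_nonneg R N x
  have hy0 := shell_nonneg R N y
  rw [sq_sub_sq, norm_mul, Real.norm_of_nonneg (by positivity), one_mul]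
  exact mul_le_mul (by linarith) (abs_shell_sub_le R N x y) (norm_nonneg _) (by positivity)

lemma tendsto_shell (R : ℝ) (x : Eucl d) :
    Tendsto (fun N => shell R N x) atTop (𝓝 (max 0 (‖x‖ - R))) := by
  refine tendsto_const_nhds.congr' ?_
  filter_upwards [eventually_ge_atTop (2 * ‖x‖ - R)] with N hN
  rw [shell, min_eq_left (by linarith)]

lemma integral_sq_tail_le {c : ℝ} (hR : 0 ≤ R) (μ : P2 d)
    (h : ∀ N, ∫ x, shell R N x ^ 2 ∂μ.meas ≤ c) :
    ∫ x, max 0 (‖x‖ - R) ^ 2 ∂μ.meas ≤ c := by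
  refine le_of_tendsto' (tendsto_integral_filter_of_dominated_convergence (fun x => ‖x‖ ^ 2)
    (.of_forall fun N => (quadLip_sq_shell hR).continuous.aestronglyMeasurable)
    (.of_forall fun N => .of_forall fun x => ?_) μ.integrable_norm_sq
    (.of_forall fun x => (tendsto_shell R x).pow 2)) h
  rw [norm_pow, Real.norm_of_nonneg (shell_nonneg R N x)]
  exact pow_le_pow_left₀ (shell_nonneg R N x) (shell_le_norm hR x) 2

end Moments

section SecondMoment

variable {d : ℕ} {T ε C : ℝ} {b : ℝ → Eucl d → P2 d → Eucl d} {μ₀ : P2 d} {ρ : ℝ → P2 d}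
  {η : ContDiffBump (0 : Eucl d)}

lemma norm_integral_generator_mollify_le {K M : ℝ} (hC : 0 ≤ C) {B : Eucl d → Eucl d} {μ : P2 d}
    (hB : ∀ x, ‖B x‖ ≤ C * (1 + ‖x‖ + ∫ y, ‖y‖ ∂μ.meas)) (hM : μ.m2 ≤ M) (hε : ε ∈ Icc 0 1)
    (hη : η.rOut ≤ 1) {w : Eucl d → ℝ} (hw : QuadLip K w) (hK : 0 ≤ K) :
    ‖∫ x, (inner ℝ (B x) (∇ (mollify η w) x) + ε * Δ (mollify η w) x) ∂μ.meas‖ ≤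
      6 * K * (3 * C + d * bumpConst η) * (1 + M) := by
  have hb := bumpConst_nonneg η
  set m := ∫ y, ‖y‖ ∂μ.meas
  have : 0 ≤ m := integral_nonneg fun _ => norm_nonneg _
  have hmM : m ^ 2 ≤ M := μ.sq_integral_norm_le.trans hM
  have : 0 ≤ d * bumpConst η := by positivity
  have hpt : ∀ x, ‖inner ℝ (B x) (∇ (mollify η w) x) + ε * Δ (mollify η w) x‖ ≤
      3 * K * (3 * C * (1 + M / 2) + 2 * (d * bumpConst η)) +
        3 * K * (9 / 2 * C + d * bumpConst η) * ‖x‖ ^ 2 := fun x => by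
    have hgrad : |inner ℝ (B x) (∇ (mollify η w) x)| ≤
        C * (1 + ‖x‖ + m) * (3 * K * (1 + 2 * ‖x‖)) := by
      refine (abs_real_inner_le_norm _ _).trans ?_
      rw [norm_gradient_eq]
      exact mul_le_mul (hB x) ((hw.mollify hK hη).norm_fderiv_le (by positivity) x)
        (norm_nonneg _) (by positivity)
    have hlap : |ε * Δ (mollify η w) x| ≤ d * (3 * K * bumpConst η * (1 + 2 * ‖x‖)) := by
      rw [abs_mul, abs_of_nonneg hε.1]
      exact (mul_le_of_le_one_left (abs_nonneg _) hε.2).trans (hw.abs_laplacian_mollify_le hK hη x)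
    have hyoung : (1 + ‖x‖ + m) * (1 + 2 * ‖x‖) ≤ 3 * (1 + M / 2) + 9 / 2 * ‖x‖ ^ 2 := by
      nlinarith [sq_nonneg (‖x‖ - 1), sq_nonneg (m - 1), sq_nonneg (m - ‖x‖)]
    have hdriftK := mul_le_mul_of_nonneg_left hyoung (by positivity : 0 ≤ 3 * K * C)
    have hlapK := mul_le_mul_of_nonneg_left (by nlinarith [sq_nonneg (‖x‖ - 1)] :
      1 + 2 * ‖x‖ ≤ 2 + ‖x‖ ^ 2) (by positivity : 0 ≤ 3 * K * (d * bumpConst η))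
    refine (abs_add_le _ _).trans ?_
    linarith
  refine (P2.norm_integral_le hM (by positivity) hpt).trans ?_
  have hM0 : 0 ≤ M := (sq_nonneg m).trans hmM
  have : 0 ≤ K * C * (1 + M) := by positivity
  have : 0 ≤ K * (d * bumpConst η) * M := by positivity
  have : 0 ≤ K * C * M := by positivity
  nlinarith

lemma IsWeakSolution.norm_integral_mollify_sub_le (hρ : IsWeakSolution T ε b μ₀ ρ) (hC : 0 ≤ C)
    (hb : ∀ t ∈ Ioo 0 T, ∀ x μ, ‖b t x μ‖ ≤ C * (1 + ‖x‖ + ∫ y, ‖y‖ ∂μ.meas))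
    (hε : ε ∈ Icc 0 1) (hη : η.rOut ≤ 1) {B l : ℝ} (hl : l ≠ 0)
    (hB : ∀ t ∈ Icc 0 T, 1 + (ρ t).m2 ≤ B * Real.exp (l * t)) {K : ℝ} {w : Eucl d → ℝ}
    (hw : QuadLip K w) (hK : 0 ≤ K) (hc : HasCompactSupport w) {t : ℝ} (ht : t ∈ Icc 0 T) :
    ‖∫ x, mollify η w x ∂(ρ t).meas - ∫ x, mollify η w x ∂μ₀.meas‖ ≤
      6 * K * (3 * C + d * bumpConst η) * B / l * (Real.exp (l * t) - 1) := by
  have hbump := bumpConst_nonneg η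
  set k := 6 * K * (3 * C + d * bumpConst η)
  have h := norm_image_sub_le_of_interior (B := fun t => k * B / l * Real.exp (l * t))
    (B' := fun t => k * (B * Real.exp (l * t)))
    ((hw.mollify hK hη).continuousOn_integral (by positivity) hρ.continuous)
    (hρ.equation _ (contDiff_mollify hw.continuous) (hasCompactSupport_mollify hc))
    (fun t => ?_) (fun t ht => ?_) t ht
  · rw [hρ.initial] at h
    simpa [mul_sub] using h
  · refine (((hasDerivAt_id t).const_mul l).exp.const_mul (k * B / l)).congr_deriv ?_
    simp only [id]
    field_simp
  · refine (norm_integral_generator_mollify_le hC (hb t ht · _) le_rfl hε hη hw hK).trans ?_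
    exact mul_le_mul_of_nonneg_left (hB t (Ioo_subset_Icc_self ht)) (by positivity)

lemma QuadLip.abs_integral_mollify_sub_le {K : ℝ} {w : Eucl d → ℝ} (hw : QuadLip K w) (hK : 0 ≤ K)
    (hη : η.rOut ≤ 1) (μ : P2 d) :
    |∫ x, mollify η w x ∂μ.meas - ∫ x, w x ∂μ.meas| ≤
      2 * K * η.rOut * (1 + ∫ x, ‖x‖ ∂μ.meas) := by
  rw [← integral_sub ((hw.mollify hK hη).integrable (by positivity) μ) (hw.integrable hK μ)]
  have hi : Integrable (fun x : Eucl d => 1 + ‖x‖) μ.meas :=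
    (integrable_const 1).add μ.integrable_norm
  refine (norm_integral_le_of_norm_le (f := fun x => mollify η w x - w x) (hi.const_mul _)
    (.of_forall (hw.abs_mollify_sub_le hK hη))).trans_eq ?_
  rw [integral_const_mul, integral_add (integrable_const 1) μ.integrable_norm]
  simp

lemma hasCompactSupport_sq_shell (R N : ℝ) :
    HasCompactSupport fun x : Eucl d => shell R N x ^ 2 := by
  refine HasCompactSupport.intro (isCompact_closedBall (0 : Eucl d) N) fun x hx => ?_
  rw [shell_eq_zero (by simpa using (not_le.1 fun h => hx (mem_closedBall_zero_iff.2 h)).le)]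
  exact zero_pow two_ne_zero

lemma P2.m2_le_of_shell {c : ℝ} (μ : P2 d) (h : ∀ N, ∫ x, shell 0 N x ^ 2 ∂μ.meas ≤ c) :
    μ.m2 ≤ c := by
  simpa [P2.m2] using integral_sq_tail_le le_rfl μ h

lemma P2.integral_sq_shell_le (μ : P2 d) (N : ℝ) : ∫ x, shell 0 N x ^ 2 ∂μ.meas ≤ μ.m2 :=
  integral_mono ((quadLip_sq_shell le_rfl).integrable zero_le_one μ) μ.integrable_norm_sq
    fun x => pow_le_pow_left₀ (shell_nonneg 0 N x) (shell_le_norm le_rfl x) 2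

lemma IsWeakSolution.one_add_m2_le_of_le (hρ : IsWeakSolution T ε b μ₀ ρ) (hC : 0 ≤ C)
    (hb : ∀ t ∈ Ioo 0 T, ∀ x μ, ‖b t x μ‖ ≤ C * (1 + ‖x‖ + ∫ y, ‖y‖ ∂μ.meas))
    (hε : ε ∈ Icc 0 1) (hη : η.rOut ≤ 1) {B l : ℝ} (hl : 0 < l)
    (hlη : 24 * (3 * C + d * bumpConst η) ≤ l) (hB0 : 0 ≤ B)
    (hB : ∀ t ∈ Icc 0 T, 1 + (ρ t).m2 ≤ B * Real.exp (l * t)) {t : ℝ} (ht : t ∈ Icc 0 T) :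
    1 + (ρ t).m2 ≤ (2 * μ₀.m2 + 21 + B / 2) * Real.exp (l * t) := by
  have hexp : 1 ≤ Real.exp (l * t) := Real.one_le_exp (mul_nonneg hl.le ht.1)
  have hend (μ : P2 d) (N : ℝ) : |∫ x, mollify η (fun x => shell 0 N x ^ 2) x ∂μ.meas -
      ∫ x, shell 0 N x ^ 2 ∂μ.meas| ≤ 10 + μ.m2 / 8 := by
    have hm := μ.sq_integral_norm_le
    have : 0 ≤ ∫ x, ‖x‖ ∂μ.meas := integral_nonneg fun _ => norm_nonneg _
    refine ((quadLip_sq_shell le_rfl).abs_integral_mollify_sub_le zero_le_one hη μ).trans ?_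
    rw [P2.m2]
    nlinarith [sq_nonneg (∫ x, ‖x‖ ∂μ.meas - 8), η.rOut_pos]
  have hshell : (ρ t).m2 ≤ μ₀.m2 + B / 4 * Real.exp (l * t) + 20 + (μ₀.m2 + (ρ t).m2) / 8 := by
    refine P2.m2_le_of_shell _ fun N => ?_
    have hmain := hρ.norm_integral_mollify_sub_le hC hb hε hη hl.ne' hB
      (quadLip_sq_shell (N := N) le_rfl) zero_le_one (hasCompactSupport_sq_shell 0 N) ht
    have hrate : 6 * 1 * (3 * C + d * bumpConst η) * B / l * (Real.exp (l * t) - 1) ≤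
        B / 4 * Real.exp (l * t) := by
      refine mul_le_mul ?_ (by linarith) (by linarith) (by positivity)
      rw [div_le_iff₀ hl]
      nlinarith
    have hinit := μ₀.integral_sq_shell_le N
    have hfarInit := abs_le.1 (hend μ₀ N)
    have hfarFinal := abs_le.1 (hend (ρ t) N)
    have hevolution := (Real.le_norm_self _).trans hmain
    linarith
  have := hB t ht
  have := mul_le_mul_of_nonneg_left hexp (by positivity [μ₀.m2_nonneg] : 0 ≤ 2 * μ₀.m2 + 21)
  nlinarith [μ₀.m2_nonneg]

lemma exists_m2_le_of_isWeakSolution (T : ℝ) (hC : 0 ≤ C) (μ₀ : P2 d) :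
    ∃ M, ∀ (b : ℝ → Eucl d → P2 d → Eucl d) (ε : ℝ) (ρ : ℝ → P2 d),
      (∀ t ∈ Ioo 0 T, ∀ x μ, ‖b t x μ‖ ≤ C * (1 + ‖x‖ + ∫ y, ‖y‖ ∂μ.meas)) → ε ∈ Icc 0 1 →
      IsWeakSolution T ε b μ₀ ρ → ∀ t ∈ Icc 0 T, (ρ t).m2 ≤ M := by
  let η : ContDiffBump (0 : Eucl d) := ⟨1 / 2, 1, by norm_num, by norm_num⟩
  set l := 24 * (3 * C + d * bumpConst η) + 1
  have hl : 0 < l := by have := bumpConst_nonneg η; positivity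
  set q := 2 * μ₀.m2 + 21
  have hq : 0 ≤ q := by have := μ₀.m2_nonneg; positivity
  refine ⟨2 * q * Real.exp (l * T), fun b ε ρ hb hε hρ t ht => ?_⟩
  have hdiv {a c s : ℝ} : a * Real.exp (-(l * s)) ≤ c ↔ a ≤ c * Real.exp (l * s) := by
    rw [Real.exp_neg, ← div_eq_mul_inv, div_le_iff₀ (Real.exp_pos _)]
  have h := le_two_mul_of_self_improving (ι := Icc 0 T)
    (f := fun s => (1 + (ρ s).m2) * Real.exp (-(l * s))) ?_ hq (fun B hB0 hB s => ?_) ⟨t, ht⟩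
  · have hmono : Real.exp (l * t) ≤ Real.exp (l * T) := by gcongr; exact ht.2
    have := mul_le_mul_of_nonneg_left hmono (by positivity : 0 ≤ 2 * q)
    linarith [hdiv.1 h]
  · obtain ⟨M, hM⟩ := W2ContinuousOn.exists_m2_le hρ.continuous
    refine ⟨1 + M, fun s => ?_⟩
    have hm2 := (ρ s).m2_nonneg
    have hexp_le : Real.exp (-(l * s)) ≤ 1 :=
      Real.exp_le_one_iff.2 (neg_nonpos.2 (mul_nonneg hl.le s.2.1))
    exact (mul_le_of_le_one_right (by positivity) hexp_le).trans (by linarith [hM s s.2])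
  · exact hdiv.2 (hρ.one_add_m2_le_of_le (η := η) hC hb hε le_rfl hl (by simp [l]) hB0
      (fun s hs => hdiv.1 (hB ⟨s, hs⟩)) s.2)

end SecondMoment

section Expansion

variable {E : Type*} [NormedAddCommGroup E] {T L C t κ : ℝ} {v : ℝ → E → E}

lemma eventually_mul_le (N : ℝ) (hκ : 0 < κ) : ∀ᶠ h in 𝓝[>] (0 : ℝ), N * h ≤ κ := by
  have h : Tendsto (fun h => N * h) (𝓝[>] 0) (𝓝 (N * 0)) :=
    (Continuous.tendsto (by fun_prop) 0).mono_left nhdsWithin_le_nhds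
  rw [mul_zero] at h
  exact h.eventually (ge_mem_nhds hκ)

lemma IsLipField.eventually_norm_sub_le [ProperSpace E] (hv : IsLipField T L C v)
    (ht : t ∈ Ioo 0 T) (R : ℝ) (hκ : 0 < κ) :
    ∀ᶠ s in 𝓝 t, ∀ x ∈ Metric.closedBall 0 R, ‖v s x - v t x‖ ≤ κ := by
  refine (isCompact_closedBall 0 R).eventually_forall_of_forall_eventually fun x _ => ?_
  have hjoint : ContinuousAt (fun p : ℝ × E => v p.1 p.2) (t, x) :=
    hv.continuousOn_uncurry.continuousAt
      (prod_mem_nhds (Ioo_mem_nhds ht.1 ht.2) univ_mem)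
  have hspace : ContinuousAt (fun p : ℝ × E => v t p.2) (t, x) :=
    ContinuousAt.comp (x := (t, x)) (g := fun p : ℝ × E => v p.1 p.2)
      (f := fun p : ℝ × E => (t, p.2)) hjoint (by fun_prop)
  have hlim : Tendsto (fun p : ℝ × E => ‖v p.1 p.2 - v t p.2‖) (𝓝 (t, x)) (𝓝 0) := by
    simpa using (hjoint.sub hspace).norm.tendsto
  exact hlim.eventually (ge_mem_nhds hκ)

variable [NormedSpace ℝ E]

lemma IsLipField.norm_flow_sub_sub_le [CompleteSpace E] (hv : IsLipField T L C v)
    (ht : t ∈ Icc 0 T) {h : ℝ} (hh : 0 ≤ h) (hth : t + h ≤ T) {p V : E} {B : ℝ}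
    (hB : ∀ r ∈ Ioo t (t + h), ‖v r (flow T v t r p) - V‖ ≤ B) :
    ‖flow T v t (t + h) p - h • V - p‖ ≤ B * h := by
  have hp := hv.flow_trajectory ht p
  have hder : ∀ r ∈ Ioo t (t + h), HasDerivAt (fun r => flow T v t r p - (r - t) • V)
      (v r (flow T v t r p) - V) r := fun r hr =>
    (hp.hasDerivAt r ⟨hr.1, hr.2.trans_le hth⟩).sub
      (by simpa using ((hasDerivAt_id r).sub_const t).smul_const V)
  have h := norm_image_sub_le_of_interior_const
    ((hp.continuousOn.mono (Icc_subset_Icc_right hth)).sub (by fun_prop)) hder hB (t + h)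
    (right_mem_Icc.2 (by linarith))
  simpa [hv.flow_self ht] using h

variable [ProperSpace E]

lemma IsLipField.norm_flow_sub_le_of_near (hv : IsLipField T L C v) (ht : t ∈ Ioo 0 T)
    {r R δ h : ℝ} (hr : r ∈ Ioo t (t + h)) (hh : h ≤ 1) (hrT : r < T) {x z : E} (hx : ‖x‖ ≤ R)
    (hz : ‖z‖ ≤ δ) :
    ‖flow T v t r (x - h • v t x - z) - x‖ ≤
      (C * Real.exp (C * T) * (1 + R + C * (1 + R) + δ) + C * (1 + R)) * h + δ := by
  have hC := hv.C_nonneg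
  have hh0 : 0 ≤ h := by linarith [hr.1, hr.2]
  set p := x - h • v t x - z
  have hV : ‖h • v t x‖ ≤ h * (C * (1 + R)) := by
    rw [norm_smul, Real.norm_of_nonneg hh0]
    exact mul_le_mul_of_nonneg_left ((hv.growth t ht x).trans (by gcongr)) hh0
  have hpx : ‖p - x‖ ≤ h * (C * (1 + R)) + δ := by
    rw [show p - x = -(h • v t x) - z by simp only [p]; abel]
    exact (norm_sub_le _ _).trans (add_le_add (by rwa [norm_neg]) hz)
  have hp : 1 + ‖p‖ ≤ 1 + R + C * (1 + R) + δ := by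
    have := norm_le_norm_add_norm_sub' p x
    have := mul_le_of_le_one_left ((norm_nonneg _).trans ((hv.growth t ht x).trans
      (by gcongr : C * (1 + ‖x‖) ≤ C * (1 + R)))) hh
    linarith
  have hflow : ‖flow T v t r p - p‖ ≤ C * Real.exp (C * T) * (1 + R + C * (1 + R) + δ) * h := by
    have hp0 := (by positivity : 0 ≤ 1 + ‖p‖).trans hp
    have hrt : 0 ≤ r - t := by linarith [hr.1]
    have hrh : r - t ≤ h := by linarith [hr.2]
    exact (hv.norm_flow_sub_le ht.1.le ⟨hr.1.le, hrT.le⟩ p).trans (by gcongr)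
  linarith [norm_sub_le_norm_sub_add_norm_sub (flow T v t r p) p x]

/-- Following the frozen field backwards and the flow forwards returns to the same point, up to
the oscillation `L δ` of the field at the scale `δ` of the perturbation. -/
lemma IsLipField.eventually_norm_flow_sub_sub_le (hv : IsLipField T L C v) (ht : t ∈ Ioo 0 T)
    (R : ℝ) {δ : ℝ} (hκ : 0 < κ) : ∀ᶠ h in 𝓝[>] 0, ∀ x ∈ Metric.closedBall 0 R, ∀ z, ‖z‖ ≤ δ →
      ‖flow T v t (t + h) (x - h • v t x - z) - (x - z)‖ ≤ h * (L * δ + κ) := by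
  have hL := hv.L_nonneg
  set N := C * Real.exp (C * T) * (1 + R + C * (1 + R) + δ) + C * (1 + R)
  obtain ⟨r₀, hr₀, hmod⟩ :=
    Metric.eventually_nhds_iff.1 (hv.eventually_norm_sub_le ht R (half_pos hκ))
  filter_upwards [eventually_mul_le (L * N) (half_pos hκ), Ioo_mem_nhdsGT one_pos,
    Ioo_mem_nhdsGT hr₀, Ioo_mem_nhdsGT (sub_pos.2 ht.2)] with h hN hh₁ hhr hhT x hx z hz
  have hx' : ‖x‖ ≤ R := by simpa using hx
  have hsub : flow T v t (t + h) (x - h • v t x - z) - (x - z) =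
    flow T v t (t + h) (x - h • v t x - z) - h • v t x - (x - h • v t x - z) := by abel
  rw [hsub, mul_comm]
  refine hv.norm_flow_sub_sub_le (Ioo_subset_Icc_self ht) hh₁.1.le (by linarith [hhT.2])
    fun r hr => ?_
  have hr₀T : r ∈ Ioo 0 T := ⟨ht.1.trans hr.1, by linarith [hr.2, hhT.2]⟩
  have hspace := (hv.lip r hr₀T (flow T v t r (x - h • v t x - z)) x).trans
    (mul_le_mul_of_nonneg_left
      (hv.norm_flow_sub_le_of_near ht hr hh₁.2.le hr₀T.2 hx' hz) hL)
  have htime := hmod (y := r)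
    (by rw [Real.dist_eq, abs_of_pos (by linarith [hr.1])]; linarith [hr.2, hhr.2]) x hx
  linarith [norm_sub_le_norm_sub_add_norm_sub (v r (flow T v t r (x - h • v t x - z))) (v r x)
    (v t x)]

end Expansion

section BackwardTransport

variable {d : ℕ} {T L C t₁ K R : ℝ} {v : ℝ → Eucl d → Eucl d} {w : ℝ → Eucl d → ℝ}
  {η : ContDiffBump (0 : Eucl d)}

/-- A solution `w` on `[0,t₁]` of the backward transport equation `∂ₛw + v · ∇w = 0`, expressed by
its constancy along the flow so that no differentiability of `w` is required. The data `K` and `R`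
control its growth and its support uniformly in time. -/
structure IsBackwardTransport (T : ℝ) (v : ℝ → Eucl d → Eucl d) (t₁ K R : ℝ)
    (w : ℝ → Eucl d → ℝ) : Prop where
  K_nonneg : 0 ≤ K
  quadLip : ∀ s ∈ Icc 0 t₁, QuadLip K (w s)
  support : ∀ s ∈ Icc 0 t₁, ∀ x, R < ‖x‖ → w s x = 0
  apply_flow : ∀ s r, 0 ≤ s → s ≤ r → r ≤ t₁ → ∀ x, w r (flow T v s r x) = w s x

lemma QuadLip.comp_flow {φ : Eucl d → ℝ} (hφ : QuadLip K φ) (hK : 0 ≤ K) (hv : IsLipField T L C v)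
    {s t : ℝ} (hs : 0 ≤ s) (ht : t ∈ Icc s T) :
    QuadLip (2 * K * Real.exp (C * T) * Real.exp (L * T)) (fun x => φ (flow T v s t x)) := by
  intro x y
  have hx := hv.flow_growth hs ht x
  have hy := hv.flow_growth hs ht y
  have := Real.exp_pos (C * T)
  have hsum : 1 + ‖flow T v s t x‖ + ‖flow T v s t y‖ ≤
      2 * Real.exp (C * T) * (1 + ‖x‖ + ‖y‖) := by
    have : 0 ≤ Real.exp (C * T) * (‖x‖ + ‖y‖) := by positivity
    linarith
  calc ‖φ (flow T v s t x) - φ (flow T v s t y)‖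
      ≤ K * (1 + ‖flow T v s t x‖ + ‖flow T v s t y‖) * ‖flow T v s t x - flow T v s t y‖ :=
        hφ _ _
    _ ≤ K * (2 * Real.exp (C * T) * (1 + ‖x‖ + ‖y‖)) * (Real.exp (L * T) * ‖x - y‖) := by
        gcongr
        exact hv.flow_lipschitz hs ht x y
    _ = _ := by ring

lemma IsLipField.isBackwardTransport (hv : IsLipField T L C v) {φ : Eucl d → ℝ}
    (hφ : QuadLip K φ) (hK : 0 ≤ K) (hR : ∀ x, R < ‖x‖ → φ x = 0) (ht₁ : t₁ ≤ T) :
    IsBackwardTransport T v t₁ (2 * K * Real.exp (C * T) * Real.exp (L * T))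
      (Real.exp (C * T) * (1 + R)) (fun s x => φ (flow T v s t₁ x)) where
  K_nonneg := by positivity
  quadLip s hs := hφ.comp_flow hK hv hs.1 ⟨hs.2, ht₁⟩
  support s hs x hx := hR _ <| by
    have h := hx.trans (lt_one_add _) |>.trans_le (hv.flow_growth_backward hs.1 ⟨hs.2, ht₁⟩ x)
    linarith [lt_of_mul_lt_mul_left h (Real.exp_pos _).le]
  apply_flow s r hs hsr hr x := by rw [hv.flow_flow hs hsr hr ht₁]

lemma IsBackwardTransport.mollify_eq_zero (hw : IsBackwardTransport T v t₁ K R w)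
    (hη : η.rOut ≤ 1) {s : ℝ} (hs : s ∈ Icc 0 t₁) {x : Eucl d} (hx : R + 1 < ‖x‖) :
    mollify η (w s) x = 0 := by
  rw [mollify_apply]
  refine integral_eq_zero_of_ae (.of_forall fun z => ?_)
  by_cases hz : ‖z‖ ≤ 1
  · have := norm_sub_norm_le x z
    simp [hw.support s hs (x - z) (by linarith)]
  · have hz' : z ∉ tsupport (η.normed volume) := fun h =>
      hz ((mem_closedBall_zero_iff.1 (tsupport_bump_subset h)).trans hη)
    simp [image_eq_zero_of_notMem_tsupport hz']

lemma IsBackwardTransport.fderiv_mollify_eq_zero (hw : IsBackwardTransport T v t₁ K R w)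
    (hη : η.rOut ≤ 1) {s : ℝ} (hs : s ∈ Icc 0 t₁) {x : Eucl d} (hx : R + 1 < ‖x‖) :
    fderiv ℝ (mollify η (w s)) x = 0 := by
  have hnear : mollify η (w s) =ᶠ[𝓝 x] fun _ => 0 := by
    filter_upwards [(isOpen_lt continuous_const continuous_norm).mem_nhds hx] with y hy
    exact hw.mollify_eq_zero hη hs hy
  rw [hnear.fderiv_eq, fderiv_fun_const, Pi.zero_apply]

lemma IsBackwardTransport.hasCompactSupport_mollify (hw : IsBackwardTransport T v t₁ K R w)
    (hη : η.rOut ≤ 1) {s : ℝ} (hs : s ∈ Icc 0 t₁) : HasCompactSupport (mollify η (w s)) :=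
  .intro (isCompact_closedBall 0 (R + 1)) fun x hx =>
    hw.mollify_eq_zero hη hs (by simpa using hx)

lemma IsBackwardTransport.abs_sub_le (hw : IsBackwardTransport T v t₁ K R w)
    (hv : IsLipField T L C v) (ht₁ : t₁ ≤ T) {s r : ℝ} (hs : s ∈ Icc 0 t₁) (hr : r ∈ Icc 0 t₁)
    (x : Eucl d) :
    |w s x - w r x| ≤ 2 * K * C * Real.exp (C * T) ^ 2 * (1 + ‖x‖) ^ 2 * |s - r| := by
  wlog hsr : s ≤ r generalizing s r
  · rw [abs_sub_comm, abs_sub_comm s r]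
    exact this hr hs (le_of_not_ge hsr)
  have hK := hw.K_nonneg
  have hC := hv.C_nonneg
  have hrT : r ∈ Icc s T := ⟨hsr, hr.2.trans ht₁⟩
  have hgrowth := hv.flow_growth hs.1 hrT x
  have hexp : 1 ≤ Real.exp (C * T) :=
    Real.one_le_exp (mul_nonneg hC (hs.1.trans (hsr.trans hrT.2)))
  have hsum : 1 + ‖flow T v s r x‖ + ‖x‖ ≤ 2 * Real.exp (C * T) * (1 + ‖x‖) := by
    nlinarith [norm_nonneg x]
  rw [← hw.apply_flow s r hs.1 hsr hr.2, abs_sub_comm s r, abs_of_nonneg (sub_nonneg.2 hsr)]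
  calc |w r (flow T v s r x) - w r x|
      ≤ K * (1 + ‖flow T v s r x‖ + ‖x‖) * ‖flow T v s r x - x‖ := hw.quadLip r hr _ _
    _ ≤ K * (2 * Real.exp (C * T) * (1 + ‖x‖)) *
        (C * Real.exp (C * T) * (1 + ‖x‖) * (r - s)) := by
      gcongr
      exact hv.norm_flow_sub_le hs.1 hrT x
    _ = _ := by ring

lemma IsBackwardTransport.abs_mollify_sub_le (hw : IsBackwardTransport T v t₁ K R w)
    (hv : IsLipField T L C v) (ht₁ : t₁ ≤ T) (hη : η.rOut ≤ 1) {s r : ℝ} (hs : s ∈ Icc 0 t₁)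
    (hr : r ∈ Icc 0 t₁) (x : Eucl d) :
    |mollify η (w s) x - mollify η (w r) x| ≤
      2 * K * C * Real.exp (C * T) ^ 2 * (2 + ‖x‖) ^ 2 * |s - r| := by
  have hK := hw.K_nonneg
  have hC := hv.C_nonneg
  refine abs_mollify_sub_mollify_le (hw.quadLip s hs).continuous (hw.quadLip r hr).continuous
    fun z hz => (hw.abs_sub_le hv ht₁ hs hr (x - z)).trans ?_
  have hxz : 1 + ‖x - z‖ ≤ 2 + ‖x‖ := by linarith [norm_sub_le x z]
  gcongr

lemma IsBackwardTransport.continuousOn_integral_mollify (hw : IsBackwardTransport T v t₁ K R w)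
    (hv : IsLipField T L C v) (ht₁ : t₁ ≤ T) (hη : η.rOut ≤ 1) {ρ : ℝ → P2 d}
    (hρ : W2ContinuousOn T ρ) :
    ContinuousOn (fun s => ∫ x, mollify η (w s) x ∂(ρ s).meas) (Icc 0 t₁) := by
  have hK := hw.K_nonneg
  have hC := hv.C_nonneg
  obtain ⟨M, hM⟩ := hρ.exists_m2_le
  have hsub : Icc 0 t₁ ⊆ Icc 0 T := Icc_subset_Icc_right ht₁
  have hquad : ∀ s ∈ Icc 0 t₁, QuadLip (3 * K) (mollify η (w s)) := fun s hs =>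
    (hw.quadLip s hs).mollify hK hη
  have hint : ∀ s ∈ Icc 0 t₁, ∀ r, Integrable (mollify η (w s)) (ρ r).meas := fun s hs r =>
    (hquad s hs).integrable (by positivity) _
  intro s hs
  set B := 2 * K * C * Real.exp (C * T) ^ 2
  have htest := ((hquad s hs).continuousOn_integral (by positivity) hρ).mono hsub s hs
  have htime : Tendsto (fun r => ∫ x, (mollify η (w r) x - mollify η (w s) x) ∂(ρ r).meas)
      (𝓝[Icc 0 t₁] s) (𝓝 0) := by
    have hlim : Tendsto (fun r => 8 * B * |r - s| + 2 * B * |r - s| * M) (𝓝[Icc 0 t₁] s)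
        (𝓝 (8 * B * |s - s| + 2 * B * |s - s| * M)) :=
      (Continuous.tendsto (by fun_prop) s).mono_left nhdsWithin_le_nhds
    refine squeeze_zero_norm' ?_ (by simpa using hlim)
    filter_upwards [self_mem_nhdsWithin] with r hr
    refine P2.norm_integral_le (hM r (hsub hr)) (by positivity) fun x =>
      (hw.abs_mollify_sub_le hv ht₁ hη hr hs x).trans ?_
    have hsq : (2 + ‖x‖) ^ 2 ≤ 8 + 2 * ‖x‖ ^ 2 := by nlinarith [sq_nonneg (‖x‖ - 2)]
    calc B * (2 + ‖x‖) ^ 2 * |r - s| ≤ B * (8 + 2 * ‖x‖ ^ 2) * |r - s| := by gcongr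
      _ = _ := by ring
  refine ((htime.add htest).congr' ?_).trans_eq (by rw [zero_add])
  filter_upwards [self_mem_nhdsWithin] with r hr
  rw [integral_sub (hint r hr r) (hint s hs r), sub_add_cancel]

lemma eventually_norm_taylor_sub_le {E F : Type*} [NormedAddCommGroup E] [NormedSpace ℝ E]
    [NormedAddCommGroup F] [NormedSpace ℝ F] {f : E → F} (hf : ContDiff ℝ 2 f)
    (hc : HasCompactSupport f) {V : E → E} {s : Set E} {B : ℝ} (hV : ∀ x ∈ s, ‖V x‖ ≤ B) {κ : ℝ}
    (hκ : 0 < κ) :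
    ∀ᶠ h in 𝓝[>] 0, ∀ x ∈ s, ‖f (x - h • V x) - f x + h • fderiv ℝ f x (V x)‖ ≤ h * κ := by
  obtain ⟨A, hA, hLip⟩ := exists_lipschitz_of_hasCompactSupport
    (hf.fderiv_right (m := 1) (by norm_num)) (hc.fderiv ℝ)
  filter_upwards [eventually_mul_le (A * B ^ 2) hκ, self_mem_nhdsWithin] with h hh hpos x hx
  have hpos : 0 < h := hpos
  have htaylor := norm_image_add_sub_le_of_lipschitz_fderiv (hf.differentiable two_ne_zero) hA hLip
    x (-(h • V x))
  rw [← sub_eq_add_neg, map_neg, map_smul, sub_neg_eq_add, norm_neg, norm_smul,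
    Real.norm_of_nonneg hpos.le] at htaylor
  calc _ ≤ A * (h * ‖V x‖) ^ 2 := htaylor
    _ ≤ A * (h * B) ^ 2 := by gcongr; exact hV x hx
    _ = h * (A * B ^ 2 * h) := by ring
    _ ≤ h * κ := by gcongr

lemma IsBackwardTransport.eventually_abs_mollify_sub_mollify_le
    (hw : IsBackwardTransport T v t₁ K R w) (hv : IsLipField T L C v) (hη : η.rOut ≤ 1) {t : ℝ}
    (ht : t ∈ Ioo 0 t₁) (ht₁ : t₁ ≤ T) (R' : ℝ) {κ : ℝ} (hκ : 0 < κ) :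
    ∀ᶠ h in 𝓝[>] 0, ∀ x ∈ Metric.closedBall 0 R',
      |mollify η (w t) (x - h • v t x) - mollify η (w (t + h)) x| ≤
        h * (4 * K * (L * η.rOut) * (1 + ‖x‖) + κ) := by
  have hK := hw.K_nonneg
  have := hv.L_nonneg
  have := η.rOut_pos
  set κ' := κ / (4 * K * (1 + |R'|) + 1) with hκ'
  have hκ'0 : 0 < κ' := by positivity
  have hκ'κ : 4 * K * (1 + |R'|) * κ' ≤ κ := by
    rw [hκ', ← mul_div_assoc, div_le_iff₀ (by positivity)]
    linarith
  filter_upwards [hv.eventually_norm_flow_sub_sub_le ⟨ht.1, ht.2.trans_le ht₁⟩ R' hκ'0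
    (δ := η.rOut), eventually_mul_le (L * η.rOut + κ') one_pos, Ioo_mem_nhdsGT (sub_pos.2 ht.2)]
    with h hflow hsmall hh x hx
  have hth : t + h ∈ Icc 0 t₁ := ⟨by linarith [ht.1, hh.1], by linarith [hh.2]⟩
  have hx' : ‖x‖ ≤ |R'| := (mem_closedBall_zero_iff.1 hx).trans (le_abs_self R')
  refine abs_mollify_sub_mollify_le (hw.quadLip t ⟨ht.1.le, ht.2.le⟩).continuous
    (hw.quadLip _ hth).continuous fun z hz => ?_
  rw [← hw.apply_flow t (t + h) ht.1.le (by linarith [hh.1]) hth.2]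
  set y := flow T v t (t + h) (x - h • v t x - z)
  have hy : ‖y - (x - z)‖ ≤ h * (L * η.rOut + κ') := hflow x hx z hz
  have hyn : 1 + ‖y‖ + ‖x - z‖ ≤ 4 * (1 + ‖x‖) := by
    linarith [norm_le_norm_add_norm_sub' y (x - z), norm_sub_le x z, norm_nonneg x]
  calc |w (t + h) y - w (t + h) (x - z)|
      ≤ K * (1 + ‖y‖ + ‖x - z‖) * ‖y - (x - z)‖ := hw.quadLip _ hth _ _
    _ ≤ K * (4 * (1 + ‖x‖)) * (h * (L * η.rOut + κ')) := by gcongr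
    _ = h * (4 * K * (L * η.rOut) * (1 + ‖x‖) + 4 * K * (1 + ‖x‖) * κ') := by ring
    _ ≤ h * (4 * K * (L * η.rOut) * (1 + ‖x‖) + 4 * K * (1 + |R'|) * κ') := by
      have := hh.1.le
      gcongr
    _ ≤ _ := by
      have := hh.1.le
      gcongr

lemma IsBackwardTransport.eventually_abs_mollify_expansion_le
    (hw : IsBackwardTransport T v t₁ K R w) (hv : IsLipField T L C v) (hη : η.rOut ≤ 1) {t : ℝ}
    (ht : t ∈ Ioo 0 t₁) (ht₁ : t₁ ≤ T) {κ : ℝ} (hκ : 0 < κ) :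
    ∀ᶠ h in 𝓝[>] 0, ∀ x,
      |mollify η (w (t + h)) x - mollify η (w t) x + h * fderiv ℝ (mollify η (w t)) x (v t x)| ≤
        h * (4 * K * (L * η.rOut) * (1 + ‖x‖) + κ) := by
  have hK := hw.K_nonneg
  have hL := hv.L_nonneg
  have hC := hv.C_nonneg
  have hδ := η.rOut_pos
  have htI : t ∈ Icc 0 t₁ := Ioo_subset_Icc_self ht
  have hV : ∀ x ∈ Metric.closedBall 0 (R + 1), ‖v t x‖ ≤ C * (1 + (R + 1)) := fun x hx =>
    (hv.growth t ⟨ht.1, ht.2.trans_le ht₁⟩ x).trans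
      (by gcongr; exact mem_closedBall_zero_iff.1 hx)
  have hsmooth : ContDiff ℝ 2 (mollify η (w t)) :=
    (contDiff_mollify (hw.quadLip t htI).continuous).of_le (by norm_cast)
  filter_upwards [hw.eventually_abs_mollify_sub_mollify_le hv hη ht ht₁ (R + 1) (half_pos hκ),
    eventually_norm_taylor_sub_le hsmooth (hw.hasCompactSupport_mollify hη htI) hV (half_pos hκ),
    Ioo_mem_nhdsGT (sub_pos.2 ht.2)] with h hflow htaylor hh x
  by_cases hx : ‖x‖ ≤ R + 1
  · have h₁ := hflow x (by simpa using hx)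
    have h₂ := htaylor x (by simpa using hx)
    rw [Real.norm_eq_abs, smul_eq_mul] at h₂
    rw [abs_le] at h₁ h₂ ⊢
    constructor <;> linarith
  · have hth : t + h ∈ Icc 0 t₁ := ⟨by linarith [ht.1, hh.1], by linarith [hh.2]⟩
    rw [hw.mollify_eq_zero hη hth (not_le.1 hx), hw.mollify_eq_zero hη htI (not_le.1 hx),
      hw.fderiv_mollify_eq_zero hη htI (not_le.1 hx)]
    have := hh.1.le
    simp only [sub_self, zero_apply, mul_zero, add_zero, abs_zero]
    positivity

end BackwardTransport

section Duality

variable {d : ℕ} {T L C t₁ K R ε M : ℝ} {v : ℝ → Eucl d → Eucl d} {w : ℝ → Eucl d → ℝ}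
  {η : ContDiffBump (0 : Eucl d)} {μ₀ : P2 d} {ρ : ℝ → P2 d}

lemma continuous_laplacian {φ : Eucl d → ℝ} (hφ : ContDiff ℝ 2 φ) : Continuous (Δ φ) := by
  rw [InnerProductSpace.laplacian_eq_iteratedFDeriv_orthonormalBasis φ
    (EuclideanSpace.basisFun (Fin d) ℝ)]
  have := hφ.continuous_iteratedFDeriv (m := 2) le_rfl
  exact continuous_finsetSum _ fun i _ => by fun_prop

lemma hasCompactSupport_laplacian {φ : Eucl d → ℝ} (hφ : HasCompactSupport φ) :
    HasCompactSupport (Δ φ) :=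
  (hφ.iteratedFDeriv (𝕜 := ℝ) 2).mono fun x hx h => hx <| by
    simp [InnerProductSpace.laplacian_eq_iteratedFDeriv_orthonormalBasis φ
      (EuclideanSpace.basisFun (Fin d) ℝ), h]

lemma exists_quadLip_inner_gradient {V : Eucl d → Eucl d} (hL : 0 ≤ L)
    (hC : 0 ≤ C) (hlip : ∀ x y, ‖V x - V y‖ ≤ L * ‖x - y‖) (hgrowth : ∀ x, ‖V x‖ ≤ C * (1 + ‖x‖))
    {ψ : Eucl d → ℝ} (hψ : ContDiff ℝ 2 ψ) (hc : HasCompactSupport ψ) :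
    ∃ K, 0 ≤ K ∧ QuadLip K fun x => inner ℝ (V x) (∇ ψ x) := by
  have hψ' : ContDiff ℝ 1 (fderiv ℝ ψ) := hψ.fderiv_right (by norm_num)
  obtain ⟨A, hA, hALip⟩ := exists_lipschitz_of_hasCompactSupport hψ' (hc.fderiv ℝ)
  obtain ⟨G, hG⟩ := (hc.fderiv ℝ).exists_bound_of_continuous hψ'.continuous
  have hG0 : 0 ≤ G := (norm_nonneg _).trans (hG 0)
  refine ⟨L * G + C * A, by positivity, fun x y => ?_⟩
  have hsplit : inner ℝ (V x) (∇ ψ x) - inner ℝ (V y) (∇ ψ y) =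
      fderiv ℝ ψ x (V x - V y) + (fderiv ℝ ψ x - fderiv ℝ ψ y) (V y) := by
    simp only [inner_gradient, map_sub, sub_apply]
    ring
  rw [hsplit]
  calc _ ≤ G * (L * ‖x - y‖) + A * ‖x - y‖ * (C * (1 + ‖y‖)) :=
        (norm_add_le _ _).trans (add_le_add
          (ContinuousLinearMap.le_of_opNorm_le_of_le _ (hG x) (hlip x y))
          (ContinuousLinearMap.le_of_opNorm_le_of_le _ (hALip x y) (hgrowth y)))
    _ = (L * G * 1 + C * A * (1 + ‖y‖)) * ‖x - y‖ := by ring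
    _ ≤ (L * G * (1 + ‖x‖ + ‖y‖) + C * A * (1 + ‖x‖ + ‖y‖)) * ‖x - y‖ := by
        gcongr <;> linarith [norm_nonneg x, norm_nonneg y]
    _ = _ := by ring

lemma QuadLip.abs_integral_laplacian_mollify_le {φ : Eucl d → ℝ} (hφ : QuadLip K φ) (hK : 0 ≤ K)
    (hη : η.rOut ≤ 1) (hε : 0 ≤ ε) {μ : P2 d} (hM : μ.m2 ≤ M) :
    |∫ x, ε * Δ (mollify η φ) x ∂μ.meas| ≤ 6 * K * (ε * (d * bumpConst η)) * (1 + M) := by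
  have hb := bumpConst_nonneg η
  have hM0 := μ.m2_nonneg.trans hM
  set B := 3 * K * (ε * (d * bumpConst η))
  have hB : 0 ≤ B := by positivity
  suffices h : ∀ x, ‖ε * Δ (mollify η φ) x‖ ≤ 2 * B + B * ‖x‖ ^ 2 from
    (P2.norm_integral_le hM hB h).trans (by linarith [mul_nonneg hB hM0])
  intro x
  rw [norm_mul, Real.norm_of_nonneg hε]
  have hx : 1 + 2 * ‖x‖ ≤ 2 + ‖x‖ ^ 2 := by nlinarith [sq_nonneg (‖x‖ - 1)]
  calc ε * ‖Δ (mollify η φ) x‖ ≤ ε * (d * (3 * K * bumpConst η * (1 + 2 * ‖x‖))) := by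
        gcongr
        exact hφ.abs_laplacian_mollify_le hK hη x
    _ = B * (1 + 2 * ‖x‖) := by ring
    _ ≤ B * (2 + ‖x‖ ^ 2) := by gcongr
    _ = _ := by ring

lemma IsBackwardTransport.eventually_abs_integral_expansion_le
    (hw : IsBackwardTransport T v t₁ K R w) (hv : IsLipField T L C v) (hη : η.rOut ≤ 1) {t : ℝ}
    (ht : t ∈ Ioo 0 t₁) (ht₁ : t₁ ≤ T) (M : ℝ) {κ : ℝ} (hκ : 0 < κ) :
    ∀ᶠ h in 𝓝[>] 0, ∀ μ : P2 d, μ.m2 ≤ M →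
      |∫ x, mollify η (w (t + h)) x ∂μ.meas - ∫ x, mollify η (w t) x ∂μ.meas +
          h * ∫ x, inner ℝ (v t x) (∇ (mollify η (w t)) x) ∂μ.meas| ≤
        h * (6 * K * (L * η.rOut) * (1 + M) + κ) := by
  have hK := hw.K_nonneg
  have hL := hv.L_nonneg
  have hδ := η.rOut_pos
  have htT : t ∈ Ioo 0 T := ⟨ht.1, ht.2.trans_le ht₁⟩
  have htI : t ∈ Icc 0 t₁ := Ioo_subset_Icc_self ht
  have hint : ∀ s ∈ Icc 0 t₁, ∀ μ : P2 d, Integrable (mollify η (w s)) μ.meas := fun s hs μ =>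
    ((hw.quadLip s hs).mollify hK hη).integrable (by positivity) μ
  obtain ⟨K', hK', hf⟩ := exists_quadLip_inner_gradient hL hv.C_nonneg (hv.lip t htT)
    (hv.growth t htT) ((contDiff_mollify (hw.quadLip t htI).continuous).of_le (by norm_cast))
    (hw.hasCompactSupport_mollify hη htI)
  filter_upwards [hw.eventually_abs_mollify_expansion_le hv hη ht ht₁ hκ,
    Ioo_mem_nhdsGT (sub_pos.2 ht.2)] with h hexp hh μ hμ
  have hth : t + h ∈ Icc 0 t₁ := ⟨by linarith [ht.1, hh.1], by linarith [hh.2]⟩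
  have hh0 := hh.1.le
  have hM0 := μ.m2_nonneg.trans hμ
  have hdiff := (hint _ hth μ).sub (hint _ htI μ)
  have hprod := (hf.integrable hK' μ).const_mul h
  rw [← integral_const_mul, ← integral_sub' (hint _ hth μ) (hint _ htI μ),
    ← integral_add (μ := μ.meas) hdiff hprod]
  set B := K * (L * η.rOut)
  suffices hbound : ∀ x, ‖(mollify η (w (t + h)) - mollify η (w t)) x +
      h * inner ℝ (v t x) (∇ (mollify η (w t)) x)‖ ≤ h * (6 * B + κ) + h * (2 * B) * ‖x‖ ^ 2 by
    have : 0 ≤ h * (B * M) := by positivity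
    exact (P2.norm_integral_le hμ (by positivity) hbound).trans (by linarith)
  intro x
  have hx : 4 * (1 + ‖x‖) ≤ 6 + 2 * ‖x‖ ^ 2 := by nlinarith [sq_nonneg (‖x‖ - 1)]
  rw [inner_gradient]
  calc _ ≤ h * (4 * K * (L * η.rOut) * (1 + ‖x‖) + κ) := hexp x
    _ = h * (B * (4 * (1 + ‖x‖)) + κ) := by ring
    _ ≤ h * (B * (6 + 2 * ‖x‖ ^ 2) + κ) := by gcongr
    _ = _ := by ring

/-- The mollified duality pairing is almost constant: transport cancels between the two factors,
and only the mollification error and the viscosity contribute to its slope. -/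
lemma IsBackwardTransport.eventually_abs_integral_mollify_sub_le
    (hw : IsBackwardTransport T v t₁ K R w) (hv : IsLipField T L C v) (hε : 0 ≤ ε)
    (hρ : IsWeakSolution T ε (fun t x _ => v t x) μ₀ ρ) (hM : ∀ t ∈ Icc 0 T, (ρ t).m2 ≤ M)
    (hη : η.rOut ≤ 1) {t : ℝ} (ht : t ∈ Ioo 0 t₁) (ht₁ : t₁ ≤ T) {κ : ℝ} (hκ : 0 < κ) :
    ∀ᶠ z in 𝓝[>] t,
      |∫ x, mollify η (w z) x ∂(ρ z).meas - ∫ x, mollify η (w t) x ∂(ρ t).meas| ≤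
        (6 * K * (L * η.rOut + ε * (d * bumpConst η)) * (1 + M) + κ) * (z - t) := by
  have hK := hw.K_nonneg
  have htT : t ∈ Ioo 0 T := ⟨ht.1, ht.2.trans_le ht₁⟩
  have htI : t ∈ Icc 0 t₁ := Ioo_subset_Icc_self ht
  have hcont := (hw.quadLip t htI).continuous
  have hsmooth : ContDiff ℝ 2 (mollify η (w t)) := (contDiff_mollify hcont).of_le (by norm_cast)
  have hsupp := hw.hasCompactSupport_mollify hη htI
  set ψ := mollify η (w t)
  set f : Eucl d → ℝ := fun x => inner ℝ (v t x) (∇ ψ x)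
  obtain ⟨K', hK', hf⟩ : ∃ K', 0 ≤ K' ∧ QuadLip K' f := exists_quadLip_inner_gradient hv.L_nonneg
    hv.C_nonneg (hv.lip t htT) (hv.growth t htT) hsmooth hsupp
  have hder : HasDerivAt (fun s => ∫ x, ψ x ∂(ρ s).meas)
      (∫ x, f x ∂(ρ t).meas + ∫ x, ε * Δ ψ x ∂(ρ t).meas) t := by
    rw [← integral_add (hf.integrable hK' _)]
    · exact hρ.equation ψ (contDiff_mollify hcont) hsupp t htT
    · exact ((continuous_laplacian hsmooth).const_mul ε).integrable_of_hasCompactSupport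
        (hasCompactSupport_laplacian hsupp).mul_left
  have hlap := (hw.quadLip t htI).abs_integral_laplacian_mollify_le hK hη hε
    (hM t ⟨htT.1.le, htT.2.le⟩)
  have hshift : Tendsto (fun z => z - t) (𝓝[>] t) (𝓝[>] 0) := by
    simp [Tendsto, sub_eq_add_neg]
  have hfcont := (hf.continuousOn_integral hK' hρ.continuous).continuousAt
    (Icc_mem_nhds htT.1 htT.2)
  have hκ' : 0 < κ / 3 := by positivity
  filter_upwards [
    hshift.eventually (hw.eventually_abs_integral_expansion_le hv hη ht ht₁ M hκ'),
    nhdsWithin_le_nhds ((hasDerivAt_iff_isLittleO.1 hder).def hκ'),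
    nhdsWithin_le_nhds (Metric.continuousAt_iff'.1 hfcont _ hκ'),
    Ioo_mem_nhdsGT htT.2] with z hexp hderz hfz hz
  have hzt : 0 < z - t := sub_pos.2 hz.1
  have hexp := hexp (ρ z) (hM z ⟨htT.1.le.trans hz.1.le, hz.2.le⟩)
  rw [add_sub_cancel] at hexp
  rw [smul_eq_mul, Real.norm_eq_abs, Real.norm_eq_abs, abs_of_pos hzt] at hderz
  have hfz := mul_le_mul_of_nonneg_left hfz.le hzt.le
  rw [Real.dist_eq, ← abs_of_pos hzt, ← abs_mul, abs_of_pos hzt] at hfz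
  have hlap := mul_le_mul_of_nonneg_left hlap hzt.le
  rw [← abs_of_pos hzt, ← abs_mul, abs_of_pos hzt] at hlap
  rw [abs_le] at *
  constructor <;> linarith

lemma QuadLip.abs_integral_mollify_sub_le_of_m2_le {φ : Eucl d → ℝ} (hφ : QuadLip K φ)
    (hK : 0 ≤ K) (hη : η.rOut ≤ 1) {μ : P2 d} (hM : μ.m2 ≤ M) :
    |∫ x, mollify η φ x ∂μ.meas - ∫ x, φ x ∂μ.meas| ≤ 4 * K * η.rOut * (1 + M) := by
  have hδ := η.rOut_pos
  have hsq : (∫ x, ‖x‖ ∂μ.meas) ^ 2 ≤ M := μ.sq_integral_norm_le.trans hM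
  calc _ ≤ 2 * K * η.rOut * (1 + ∫ x, ‖x‖ ∂μ.meas) := hφ.abs_integral_mollify_sub_le hK hη μ
    _ ≤ 2 * K * η.rOut * (2 * (1 + M)) := by
        gcongr
        nlinarith [sq_nonneg (∫ x, ‖x‖ ∂μ.meas - 1), sq_nonneg (∫ x, ‖x‖ ∂μ.meas)]
    _ = _ := by ring

lemma IsBackwardTransport.abs_integral_sub_integral_le (hw : IsBackwardTransport T v t₁ K R w)
    (hv : IsLipField T L C v) (hε : 0 ≤ ε)
    (hρ : IsWeakSolution T ε (fun t x _ => v t x) μ₀ ρ) (hM : ∀ t ∈ Icc 0 T, (ρ t).m2 ≤ M)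
    (hη : η.rOut ≤ 1) (ht₁ : t₁ ∈ Icc 0 T) :
    |∫ x, w t₁ x ∂(ρ t₁).meas - ∫ x, w 0 x ∂μ₀.meas| ≤
      K * (1 + M) * (8 * η.rOut + 6 * (L * η.rOut + ε * (d * bumpConst η)) * t₁) := by
  have h0 : (0 : ℝ) ∈ Icc 0 t₁ := left_mem_Icc.2 ht₁.1
  have h1 : t₁ ∈ Icc 0 t₁ := right_mem_Icc.2 ht₁.1
  have hslope := abs_sub_le_of_right_slope ht₁.1
    (hw.continuousOn_integral_mollify hv ht₁.2 hη hρ.continuous) fun t ht κ hκ =>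
      hw.eventually_abs_integral_mollify_sub_le hv hε hρ hM hη ht ht₁.2 hκ
  have hstart := (hw.quadLip 0 h0).abs_integral_mollify_sub_le_of_m2_le hw.K_nonneg hη
    (hM 0 ⟨le_rfl, ht₁.1.trans ht₁.2⟩)
  have hend := (hw.quadLip t₁ h1).abs_integral_mollify_sub_le_of_m2_le hw.K_nonneg hη (hM t₁ ht₁)
  rw [hρ.initial] at hslope hstart
  rw [abs_le] at *
  constructor <;> linarith

lemma exists_abs_integral_sub_integral_flow_le (d : ℕ) (hT : 0 ≤ T) (hL : 0 ≤ L) (C : ℝ)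
    (hM : 0 ≤ M) (hK : 0 ≤ K) {κ : ℝ} (hκ : 0 < κ) :
    ∃ ε₀ > 0, ∀ ε ∈ Icc 0 ε₀, ∀ (v : ℝ → Eucl d → Eucl d) (μ₀ : P2 d) (ρ : ℝ → P2 d),
      IsLipField T L C v → IsWeakSolution T ε (fun t x _ => v t x) μ₀ ρ →
      (∀ t ∈ Icc 0 T, (ρ t).m2 ≤ M) → ∀ φ : Eucl d → ℝ, QuadLip K φ → HasCompactSupport φ →
      ∀ t ∈ Icc 0 T,
        |∫ x, φ x ∂(ρ t).meas - ∫ x, φ (flow T v 0 t x) ∂μ₀.meas| ≤ κ := by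
  set K' := 2 * K * Real.exp (C * T) * Real.exp (L * T)
  set A := K' * (1 + M) * (8 + 6 * L * T)
  have : 0 ≤ A := by positivity
  have hκA : 0 < κ / (2 * (A + 1)) := by positivity
  set δ := min 1 (κ / (2 * (A + 1)))
  have hδ : 0 < δ := lt_min one_pos hκA
  let η : ContDiffBump (0 : Eucl d) := ⟨δ / 2, δ, half_pos hδ, half_lt_self hδ⟩
  have hη : η.rOut ≤ 1 := min_le_left _ _
  set B := K' * (1 + M) * (6 * T * (d * bumpConst η))
  have hb := bumpConst_nonneg η
  have : 0 ≤ B := by positivity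
  refine ⟨κ / (2 * (B + 1)), by positivity, fun ε hε v μ₀ ρ hv hρ hρM φ hφ hc t ht => ?_⟩
  obtain ⟨R, hR⟩ := hc.isCompact.isBounded.exists_norm_le
  have hsupp : ∀ x, R < ‖x‖ → φ x = 0 := fun x hx =>
    image_eq_zero_of_notMem_tsupport fun h => (hR x h).not_gt hx
  have hmain := (hv.isBackwardTransport hφ hK hsupp ht.2).abs_integral_sub_integral_le hv hε.1 hρ
    hρM hη ht
  simp only [hv.flow_self ht] at hmain
  have hδA : A * δ ≤ κ / 2 := by
    have := (le_div_iff₀ (by positivity)).1 (min_le_right 1 (κ / (2 * (A + 1))))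
    linarith
  have hεB : B * ε ≤ κ / 2 := by
    have := (le_div_iff₀ (by positivity)).1 hε.2
    linarith [hε.1]
  have hε0 := hε.1
  calc _ ≤ K' * (1 + M) * (8 * δ + 6 * (L * δ + ε * (d * bumpConst η)) * t) := hmain
    _ ≤ K' * (1 + M) * (8 * δ + 6 * (L * δ + ε * (d * bumpConst η)) * T) := by
        gcongr
        exact ht.2
    _ = A * δ + B * ε := by ring
    _ ≤ κ := by linarith

end Duality

section Cells

variable {d : ℕ} {Ω ι : Type*} [MeasurableSpace Ω]

lemma exists_prod_measure_of_univ_eq {α : Type*} [MeasurableSpace α] (μ : Measure α)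
    (ν : Measure Ω) [IsFiniteMeasure μ] [IsFiniteMeasure ν] (h : μ univ = ν univ) :
    ∃ γ : Measure (α × Ω), γ.map Prod.fst = μ ∧ γ.map Prod.snd = ν := by
  rcases eq_or_ne (μ univ) 0 with h0 | h0
  · exact ⟨0, by simp [Measure.measure_univ_eq_zero.1 h0],
      by simp [Measure.measure_univ_eq_zero.1 (h ▸ h0)]⟩
  · refine ⟨(μ univ)⁻¹ • μ.prod ν, ?_, ?_⟩
    · rw [Measure.map_smul, Measure.map_fst_prod, ← h, smul_smul,
        ENNReal.inv_mul_cancel h0 (measure_ne_top _ _), one_smul]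
    · rw [Measure.map_smul, Measure.map_snd_prod, smul_smul,
        ENNReal.inv_mul_cancel h0 (measure_ne_top _ _), one_smul]

section Cost

variable {γ : Measure (Eucl d × Ω)} {ρ : Measure (Eucl d)} {m : Measure Ω} {X : Ω → Eucl d}

lemma lintegral_enorm_sub_sq_le_of_marginals (h₁ : γ.map Prod.fst = ρ) (h₂ : γ.map Prod.snd = m)
    (hX : Measurable X) :
    ∫⁻ p, ‖p.1 - X p.2‖ₑ ^ 2 ∂γ ≤ 2 * (∫⁻ x, ‖x‖ₑ ^ 2 ∂ρ + ∫⁻ a, ‖X a‖ₑ ^ 2 ∂m) := by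
  have hpoint : ∀ x y : Eucl d, ‖x - y‖ₑ ^ 2 ≤ 2 * (‖x‖ₑ ^ 2 + ‖y‖ₑ ^ 2) := fun x y => by
    simp only [← ofReal_norm, ← ENNReal.ofReal_pow (norm_nonneg _)]
    rw [← ENNReal.ofReal_add (by positivity) (by positivity)]
    refine (ENNReal.ofReal_le_ofReal (q := 2 * (‖x‖ ^ 2 + ‖y‖ ^ 2)) ?_).trans_eq
      (by rw [ENNReal.ofReal_mul zero_le_two, ENNReal.ofReal_ofNat])
    nlinarith [norm_sub_le x y, norm_nonneg (x - y), sq_nonneg (‖x‖ - ‖y‖)]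
  rw [← h₁, ← h₂, lintegral_map (by fun_prop) measurable_fst,
    lintegral_map (by fun_prop) measurable_snd, ← lintegral_add_left (by fun_prop),
    ← lintegral_const_mul _ (by fun_prop)]
  exact lintegral_mono fun p => hpoint _ _

lemma lintegral_enorm_sub_sq_le_of_ae_norm_sub_le (h₁ : γ.map Prod.fst = ρ)
    (h₂ : γ.map Prod.snd = m) {c : Eucl d} {r : ℝ} (hρ : ∀ᵐ x ∂ρ, ‖x - c‖ ≤ r)
    (hm : ∀ᵐ a ∂m, ‖X a - c‖ ≤ r) :
    ∫⁻ p, ‖p.1 - X p.2‖ₑ ^ 2 ∂γ ≤ ENNReal.ofReal ((2 * r) ^ 2) * ρ univ := by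
  rw [← h₁] at hρ
  rw [← h₂] at hm
  rw [← h₁, Measure.map_apply measurable_fst .univ, preimage_univ, ← lintegral_const]
  refine lintegral_mono_ae ?_
  filter_upwards [ae_of_ae_map measurable_fst.aemeasurable hρ,
    ae_of_ae_map measurable_snd.aemeasurable hm] with p hp₁ hp₂
  rw [← ofReal_norm, ← ENNReal.ofReal_pow (norm_nonneg _)]
  have := norm_sub_le_norm_sub_add_norm_sub p.1 c (X p.2)
  rw [norm_sub_rev c] at this
  gcongr
  linarith

lemma exists_coupling_of_blocks [Fintype ι] {ρ' : Measure (Eucl d)} {m' : Measure Ω}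
    {ρi : ι → Measure (Eucl d)} {mi : ι → Measure Ω} [IsProbabilityMeasure ρ]
    [IsProbabilityMeasure m] (hρ : ∑ i, ρi i + ρ' = ρ) (hm : ∑ i, mi i + m' = m)
    (hmass : ∀ i, ρi i univ = mi i univ) (hX : Measurable X) {c : ι → Eucl d} {r : ℝ}
    (hρc : ∀ i, ∀ᵐ x ∂ρi i, ‖x - c i‖ ≤ r) (hmc : ∀ i, ∀ᵐ a ∂mi i, ‖X a - c i‖ ≤ r) :
    ∃ γ : Measure (Eucl d × Ω), γ.map Prod.fst = ρ ∧ γ.map Prod.snd = m ∧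
      ∫⁻ p, ‖p.1 - X p.2‖ₑ ^ 2 ∂γ ≤ ENNReal.ofReal ((2 * r) ^ 2) +
        2 * (∫⁻ x, ‖x‖ₑ ^ 2 ∂ρ' + ∫⁻ a, ‖X a‖ₑ ^ 2 ∂m') := by
  have hρle : ∀ i, ρi i ≤ ρ := fun i => hρ ▸ Measure.le_add_right
    (Finset.single_le_sum (fun _ _ => Measure.zero_le _) (Finset.mem_univ i))
  have hmle : ∀ i, mi i ≤ m := fun i => hm ▸ Measure.le_add_right
    (Finset.single_le_sum (fun _ _ => Measure.zero_le _) (Finset.mem_univ i))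
  have := fun i => isFiniteMeasure_of_le ρ (hρle i)
  have := fun i => isFiniteMeasure_of_le m (hmle i)
  have := isFiniteMeasure_of_le ρ (hρ ▸ Measure.le_add_left le_rfl : ρ' ≤ ρ)
  have := isFiniteMeasure_of_le m (hm ▸ Measure.le_add_left le_rfl : m' ≤ m)
  have hsumρ : ∑ i, ρi i univ + ρ' univ = 1 := by
    simpa using (congrArg (· univ) hρ).trans measure_univ
  have hsumm : ∑ i, ρi i univ + m' univ = 1 := by
    simpa [hmass] using (congrArg (· univ) hm).trans measure_univ
  have hrest : ρ' univ = m' univ :=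
    (ENNReal.add_right_inj (ne_top_of_le_ne_top ENNReal.one_ne_top (hsumρ ▸ le_self_add))).1
      (hsumρ.trans hsumm.symm)
  choose γi hγi₁ hγi₂ using fun i => exists_prod_measure_of_univ_eq (ρi i) (mi i) (hmass i)
  obtain ⟨γ', hγ'₁, hγ'₂⟩ := exists_prod_measure_of_univ_eq ρ' m' hrest
  refine ⟨∑ i, γi i + γ', ?_, ?_, ?_⟩
  · rw [Measure.map_add _ _ measurable_fst, Measure.map_finset_sum' measurable_fst.aemeasurable]
    simp only [hγi₁, hγ'₁, hρ]
  · rw [Measure.map_add _ _ measurable_snd, Measure.map_finset_sum' measurable_snd.aemeasurable]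
    simp only [hγi₂, hγ'₂, hm]
  · rw [lintegral_add_measure, lintegral_finsetSum_measure]
    refine add_le_add ?_ (lintegral_enorm_sub_sq_le_of_marginals hγ'₁ hγ'₂ hX)
    calc _ ≤ ∑ i, ENNReal.ofReal ((2 * r) ^ 2) * ρi i univ := Finset.sum_le_sum fun i _ =>
          lintegral_enorm_sub_sq_le_of_ae_norm_sub_le (hγi₁ i) (hγi₂ i) (hρc i) (hmc i)
      _ ≤ ENNReal.ofReal ((2 * r) ^ 2) * 1 := by
          rw [← Finset.mul_sum, ← hsumρ]
          gcongr
          exact le_self_add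
      _ = _ := mul_one _

end Cost

section Trim

variable {α : Type*} [MeasurableSpace α]

/-- The measure `μ` scaled down so that its total mass is at most `k`. -/
def trimMass (k : ℝ≥0∞) (μ : Measure α) : Measure α := (min (μ univ) k / μ univ) • μ

/-- What `trimMass k μ` leaves of `μ`. -/
def trimRest (k : ℝ≥0∞) (μ : Measure α) : Measure α := (1 - min (μ univ) k / μ univ) • μ

variable {k : ℝ≥0∞} {μ : Measure α}

lemma trimMass_add_trimRest : trimMass k μ + trimRest k μ = μ := by
  rw [trimMass, trimRest, ← add_smul, add_tsub_cancel_of_le, one_smul]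
  exact ENNReal.div_le_of_le_mul (by simp)

lemma trimMass_univ [IsFiniteMeasure μ] : trimMass k μ univ = min (μ univ) k :=
  ENNReal.div_mul_cancel' (fun h => by simp [h]) fun h => absurd h (measure_ne_top _ _)

lemma trimRest_univ [IsFiniteMeasure μ] : trimRest k μ univ = μ univ - k := by
  have h : min (μ univ) k + trimRest k μ univ = μ univ := by
    rw [← trimMass_univ, ← Measure.add_apply, trimMass_add_trimRest]
  rw [← tsub_min]
  refine ENNReal.eq_sub_of_add_eq (min_lt_of_left_lt (measure_lt_top _ _)).ne (by rw [add_comm, h])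

end Trim

/-- Finitely many smooth functions `χ i`, each living in the ball of radius `r` around `c i`, that
form a partition of unity of the ball of radius `R` around the origin. -/
structure IsCellPartition [Fintype ι] (R r : ℝ) (χ : ι → Eucl d → ℝ) (c : ι → Eucl d) :
    Prop where
  contDiff : ∀ i, ContDiff ℝ ∞ (χ i)
  nonneg : ∀ i x, 0 ≤ χ i x
  sum_le_one : ∀ x, ∑ i, χ i x ≤ 1
  sum_eq_one : ∀ x, ‖x‖ ≤ R → ∑ i, χ i x = 1
  norm_center_le : ∀ i, ‖c i‖ ≤ R
  norm_sub_le : ∀ i x, χ i x ≠ 0 → ‖x - c i‖ ≤ r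

lemma exists_isCellPartition (d : ℕ) (R : ℝ) {r : ℝ} (hr : 0 < r) :
    ∃ (s : Finset (Eucl d)) (χ : s → Eucl d → ℝ), IsCellPartition R r χ (fun i => i) := by
  obtain ⟨s, hs, hsfin, hcover⟩ :=
    (isCompact_closedBall (0 : Eucl d) R).finite_cover_balls hr
  lift s to Finset (Eucl d) using hsfin
  obtain ⟨f, hf⟩ := SmoothPartitionOfUnity.exists_isSubordinate (modelWithCornersSelf ℝ (Eucl d))
    Metric.isClosed_closedBall (fun i : s => Metric.ball (i : Eucl d) r)
    (fun _ => Metric.isOpen_ball) (by simpa [iUnion_subtype] using hcover)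
  refine ⟨s, fun i => f i, fun i => (f i).contMDiff.contDiff, f.nonneg, fun x => ?_,
    fun x hx => ?_, fun i => ?_, fun i x hx => ?_⟩
  · simpa only [finsum_eq_sum_of_fintype] using f.sum_le_one x
  · simpa only [finsum_eq_sum_of_fintype] using f.sum_eq_one (mem_closedBall_zero_iff.2 hx)
  · simpa using hs i.2
  · rw [← dist_eq_norm]
    exact (hf i (subset_tsupport _ hx)).le

namespace IsCellPartition

variable [Fintype ι] {R r : ℝ} {χ : ι → Eucl d → ℝ} {c : ι → Eucl d}

lemma measurable (h : IsCellPartition R r χ c) (i : ι) : Measurable (χ i) :=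
  (h.contDiff i).continuous.measurable

lemma le_one (h : IsCellPartition R r χ c) (i : ι) (x : Eucl d) : χ i x ≤ 1 :=
  (Finset.single_le_sum (fun j _ => h.nonneg j x) (Finset.mem_univ i)).trans (h.sum_le_one x)

lemma hasCompactSupport (h : IsCellPartition R r χ c) (i : ι) : HasCompactSupport (χ i) :=
  HasCompactSupport.intro (isCompact_closedBall (c i) r) fun x hx => by
    contrapose! hx
    simpa [dist_eq_norm] using h.norm_sub_le i x hx

lemma exists_quadLip (h : IsCellPartition R r χ c) : ∃ K, 0 ≤ K ∧ ∀ i, QuadLip K (χ i) := by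
  choose K hK hχ using fun i => exists_lipschitz_of_hasCompactSupport
    ((h.contDiff i).of_le (by norm_cast)) (h.hasCompactSupport i)
  refine ⟨∑ i, K i, Finset.sum_nonneg fun i _ => hK i, fun i => ?_⟩
  have hle : K i ≤ ∑ j, K j := Finset.single_le_sum (fun j _ => hK j) (Finset.mem_univ i)
  exact .of_lipschitz ((hK i).trans hle) fun x y => (hχ i x y).trans (by gcongr)

end IsCellPartition

section Pieces

variable {m : Measure Ω} {X : Ω → Eucl d}

/-- The part of `m` that `X` carries to the cell with weight `χ`. -/
def cellMeasure (m : Measure Ω) (X : Ω → Eucl d) (χ : Eucl d → ℝ) : Measure Ω :=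
  m.withDensity fun a => ENNReal.ofReal (χ (X a))

variable [Fintype ι] {R r : ℝ} {χ : ι → Eucl d → ℝ} {c : ι → Eucl d}

/-- What remains of `m` when the part of each cell is trimmed to mass at most `k i`. -/
def cellRest (m : Measure Ω) (X : Ω → Eucl d) (χ : ι → Eucl d → ℝ) (k : ι → ℝ≥0∞) : Measure Ω :=
  ∑ i, trimRest (k i) (cellMeasure m X (χ i)) + cellMeasure m X fun x => 1 - ∑ i, χ i x

namespace IsCellPartition

lemma sum_cellMeasure_add (h : IsCellPartition R r χ c) (hX : Measurable X) :
    ∑ i, cellMeasure m X (χ i) + cellMeasure m X (fun x => 1 - ∑ i, χ i x) = m := by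
  have hmeas : ∀ i, Measurable fun a => ENNReal.ofReal (χ i (X a)) := fun i =>
    ((h.measurable i).comp hX).ennreal_ofReal
  ext s hs
  simp only [cellMeasure, Measure.add_apply, Measure.finsetSum_apply, withDensity_apply _ hs]
  rw [← lintegral_finsetSum _ fun i _ => hmeas i,
    ← lintegral_add_left (Finset.measurable_sum _ fun i _ => hmeas i), ← setLIntegral_one]
  refine lintegral_congr fun a => ?_
  rw [← ENNReal.ofReal_sum_of_nonneg fun i _ => h.nonneg i _,
    ← ENNReal.ofReal_add (Finset.sum_nonneg fun i _ => h.nonneg i _)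
      (sub_nonneg.2 (h.sum_le_one _)), add_sub_cancel, ENNReal.ofReal_one]

lemma sum_trimMass_add_cellRest (h : IsCellPartition R r χ c) (hX : Measurable X)
    (k : ι → ℝ≥0∞) :
    ∑ i, trimMass (k i) (cellMeasure m X (χ i)) + cellRest m X χ k = m := by
  rw [cellRest, ← add_assoc, ← Finset.sum_add_distrib]
  simpa only [trimMass_add_trimRest] using h.sum_cellMeasure_add hX

lemma ae_norm_sub_le (h : IsCellPartition R r χ c) (hX : Measurable X) (i : ι) :
    ∀ᵐ a ∂cellMeasure m X (χ i), ‖X a - c i‖ ≤ r := by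
  have hmeas : Measurable fun a => ENNReal.ofReal (χ i (X a)) :=
    ((h.measurable i).comp hX).ennreal_ofReal
  rw [cellMeasure, ae_withDensity_iff hmeas]
  refine ae_of_all _ fun a ha => h.norm_sub_le i _ fun h0 => ha ?_
  simp [h0]

lemma isFiniteMeasure_cellMeasure (h : IsCellPartition R r χ c) [IsFiniteMeasure m]
    (hX : Measurable X) (i : ι) : IsFiniteMeasure (cellMeasure m X (χ i)) := by
  refine isFiniteMeasure_of_le m (le_of_le_of_eq ?_ (h.sum_cellMeasure_add hX))
  exact Measure.le_add_right
    (Finset.single_le_sum (fun _ _ => Measure.zero_le _) (Finset.mem_univ i))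

lemma lintegral_trimRest_le (h : IsCellPartition R r χ c) [IsFiniteMeasure m]
    (hX : Measurable X) (i : ι) (k : ℝ≥0∞) :
    ∫⁻ a, ‖X a‖ₑ ^ 2 ∂trimRest k (cellMeasure m X (χ i)) ≤
      ENNReal.ofReal ((R + r) ^ 2) * (cellMeasure m X (χ i) univ - k) := by
  have := h.isFiniteMeasure_cellMeasure (m := m) hX i
  rw [← trimRest_univ, ← lintegral_const]
  refine lintegral_mono_ae (Measure.ae_smul_measure ?_ _)
  filter_upwards [h.ae_norm_sub_le hX i] with a ha
  rw [← ofReal_norm, ← ENNReal.ofReal_pow (norm_nonneg _)]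
  have := norm_le_norm_add_norm_sub' (X a) (c i)
  have := h.norm_center_le i
  gcongr
  linarith

lemma lintegral_cellMeasure_one_sub_le (h : IsCellPartition R r χ c) (hX : Measurable X) :
    ∫⁻ a, ‖X a‖ₑ ^ 2 ∂cellMeasure m X (fun x => 1 - ∑ i, χ i x) ≤
      ∫⁻ a in {a | R < ‖X a‖}, ‖X a‖ₑ ^ 2 ∂m := by
  have hmeas : Measurable fun a => ENNReal.ofReal (1 - ∑ i, χ i (X a)) :=
    (measurable_const.sub (Finset.measurable_sum _ fun i _ =>
      (h.measurable i).comp hX)).ennreal_ofReal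
  rw [cellMeasure, lintegral_withDensity_eq_lintegral_mul _ hmeas (by fun_prop),
    ← lintegral_indicator (measurableSet_lt measurable_const hX.norm)]
  refine lintegral_mono fun a => ?_
  rcases le_or_gt ‖X a‖ R with ha | ha
  · simp [h.sum_eq_one _ ha]
  · rw [indicator_of_mem (by exact ha)]
    refine mul_le_of_le_one_left zero_le (ENNReal.ofReal_le_one.2 ?_)
    exact sub_le_self _ (Finset.sum_nonneg fun i _ => h.nonneg i _)

lemma lintegral_cellRest_le (h : IsCellPartition R r χ c) [IsFiniteMeasure m]
    (hX : Measurable X) (k : ι → ℝ≥0∞) :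
    ∫⁻ a, ‖X a‖ₑ ^ 2 ∂cellRest m X χ k ≤
      ENNReal.ofReal ((R + r) ^ 2) * ∑ i, (cellMeasure m X (χ i) univ - k i) +
        ∫⁻ a in {a | R < ‖X a‖}, ‖X a‖ₑ ^ 2 ∂m := by
  rw [cellRest, lintegral_add_measure, lintegral_finsetSum_measure, Finset.mul_sum]
  exact add_le_add (Finset.sum_le_sum fun i _ => h.lintegral_trimRest_le hX i _)
    (h.lintegral_cellMeasure_one_sub_le hX)

lemma cellMeasure_univ (h : IsCellPartition R r χ c) [IsFiniteMeasure m] (hX : Measurable X)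
    (i : ι) : cellMeasure m X (χ i) univ = ENNReal.ofReal (∫ a, χ i (X a) ∂m) := by
  rw [cellMeasure, withDensity_apply _ .univ, setLIntegral_univ,
    ofReal_integral_eq_lintegral_ofReal _ (ae_of_all _ fun a => h.nonneg i _)]
  refine .of_bound ((h.measurable i).comp hX).aestronglyMeasurable 1 (ae_of_all _ fun a => ?_)
  rw [Real.norm_of_nonneg (h.nonneg i _)]
  exact h.le_one i _

lemma sum_cellMeasure_sub_le (h : IsCellPartition R r χ c) [IsFiniteMeasure m]
    (hX : Measurable X) {Ω' : Type*} [MeasurableSpace Ω'] {m' : Measure Ω'} [IsFiniteMeasure m']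
    {X' : Ω' → Eucl d} (hX' : Measurable X') {ζ : ℝ}
    (hζ : ∀ i, ∫ a, χ i (X a) ∂m - ∫ a, χ i (X' a) ∂m' ≤ ζ) :
    ∑ i, (cellMeasure m X (χ i) univ - cellMeasure m' X' (χ i) univ) ≤
      Fintype.card ι * ENNReal.ofReal ζ := by
  simp only [h.cellMeasure_univ hX, h.cellMeasure_univ hX']
  rw [← Finset.card_univ, ← nsmul_eq_mul]
  refine Finset.sum_le_card_nsmul _ _ _ fun i _ => ?_
  rw [← ENNReal.ofReal_sub _ (integral_nonneg fun a => h.nonneg i _)]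
  exact ENNReal.ofReal_le_ofReal (hζ i)

lemma exists_coupling (h : IsCellPartition R r χ c) {ρ : Measure (Eucl d)}
    [IsProbabilityMeasure ρ] [IsProbabilityMeasure m] (hX : Measurable X) {ζ : ℝ} {τ : ℝ≥0∞}
    (hζ : ∀ i, |∫ x, χ i x ∂ρ - ∫ a, χ i (X a) ∂m| ≤ ζ)
    (hρτ : ∫⁻ x in {x | R < ‖x‖}, ‖x‖ₑ ^ 2 ∂ρ ≤ τ)
    (hmτ : ∫⁻ a in {a | R < ‖X a‖}, ‖X a‖ₑ ^ 2 ∂m ≤ τ) :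
    ∃ γ : Measure (Eucl d × Ω), γ.map Prod.fst = ρ ∧ γ.map Prod.snd = m ∧
      ∫⁻ p, ‖p.1 - X p.2‖ₑ ^ 2 ∂γ ≤ ENNReal.ofReal ((2 * r) ^ 2) +
        4 * (ENNReal.ofReal ((R + r) ^ 2) * (Fintype.card ι * ENNReal.ofReal ζ) + τ) := by
  have hfin₁ := h.isFiniteMeasure_cellMeasure (m := ρ) measurable_id
  have hfin₂ := h.isFiniteMeasure_cellMeasure (m := m) hX
  obtain ⟨γ, h₁, h₂, hγ⟩ := exists_coupling_of_blocks
    (h.sum_trimMass_add_cellRest (m := ρ) measurable_id fun i => cellMeasure m X (χ i) univ)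
    (h.sum_trimMass_add_cellRest (m := m) hX fun i => cellMeasure ρ id (χ i) univ)
    (fun i => by rw [trimMass_univ, trimMass_univ, min_comm]) hX
    (fun i => Measure.ae_smul_measure (h.ae_norm_sub_le measurable_id i) _)
    (fun i => Measure.ae_smul_measure (h.ae_norm_sub_le hX i) _)
  refine ⟨γ, h₁, h₂, hγ.trans ?_⟩
  rw [show (4 : ℝ≥0∞) = 2 * 2 by norm_num, mul_assoc, two_mul (_ + τ)]
  gcongr
  · exact (h.lintegral_cellRest_le measurable_id _).trans (add_le_add (mul_le_mul_right
      (h.sum_cellMeasure_sub_le measurable_id hX fun i => (le_abs_self _).trans (hζ i)) _) hρτ)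
  · refine (h.lintegral_cellRest_le hX _).trans (add_le_add (mul_le_mul_right
      (h.sum_cellMeasure_sub_le hX measurable_id fun i => ?_) _) hmτ)
    exact (neg_sub _ _).symm.le.trans ((neg_le_abs _).trans (hζ i))

end IsCellPartition

end Pieces

lemma exists_coupling_of_abs_integral_sub_le (d : ℕ) {R κ : ℝ} (hR : 0 ≤ R) (hκ : 0 < κ) :
    ∃ K ζ : ℝ, 0 ≤ K ∧ 0 < ζ ∧ ∀ (ρ : Measure (Eucl d)) (m : Measure Ω) (X : Ω → Eucl d)
      [IsProbabilityMeasure ρ] [IsProbabilityMeasure m], Measurable X →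
      (∀ φ : Eucl d → ℝ, QuadLip K φ → HasCompactSupport φ →
        |∫ x, φ x ∂ρ - ∫ a, φ (X a) ∂m| ≤ ζ) →
      ∫⁻ x in {x | R < ‖x‖}, ‖x‖ₑ ^ 2 ∂ρ ≤ ENNReal.ofReal κ →
      ∫⁻ a in {a | R < ‖X a‖}, ‖X a‖ₑ ^ 2 ∂m ≤ ENNReal.ofReal κ →
      ∃ γ : Measure (Eucl d × Ω), γ.map Prod.fst = ρ ∧ γ.map Prod.snd = m ∧
        ∫⁻ p, ‖p.1 - X p.2‖ₑ ^ 2 ∂γ ≤ ENNReal.ofReal (9 * κ) := by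
  set r := √κ / 2 with hr
  have hr0 : 0 < r := by positivity
  obtain ⟨s, χ, h⟩ := exists_isCellPartition d R hr0
  obtain ⟨K, hK, hχ⟩ := h.exists_quadLip
  set n : ℝ := (Fintype.card s : ℝ)
  have hn0 : 0 ≤ n := by positivity
  refine ⟨K, κ / ((R + r) ^ 2 * (n + 1)), hK, by positivity,
    fun ρ m X _ _ hX hclose hρ hm => ?_⟩
  obtain ⟨γ, h₁, h₂, hγ⟩ := h.exists_coupling hX
    (fun i => hclose _ (hχ i) (h.hasCompactSupport i)) hρ hm
  refine ⟨γ, h₁, h₂, hγ.trans ?_⟩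
  rw [← ENNReal.ofReal_natCast, ← ENNReal.ofReal_mul hn0, ← ENNReal.ofReal_mul (by positivity),
    ← ENNReal.ofReal_add (by positivity) (by positivity),
    show (4 : ℝ≥0∞) = ENNReal.ofReal 4 by simp, ← ENNReal.ofReal_mul (by positivity),
    ← ENNReal.ofReal_add (by positivity) (by positivity)]
  refine ENNReal.ofReal_le_ofReal ?_
  have hcells : (R + r) ^ 2 * (n * (κ / ((R + r) ^ 2 * (n + 1)))) ≤ κ := by
    have : (R + r) ^ 2 * (n * (κ / ((R + r) ^ 2 * (n + 1)))) = n / (n + 1) * κ := by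
      field_simp
    rw [this]
    exact mul_le_of_le_one_left hκ.le (div_le_one_of_le₀ (by linarith) (by linarith))
  have hmesh : (2 * r) ^ 2 = κ := by rw [hr, mul_div_cancel₀ _ two_ne_zero, Real.sq_sqrt hκ.le]
  linarith

end Cells

section FlowCoupling

variable {d : ℕ} {T L C M R : ℝ}

lemma P2.integrable_sq_tail (μ : P2 d) (hR : 0 ≤ R) :
    Integrable (fun x : Eucl d => max 0 (‖x‖ - R) ^ 2) μ.meas := by
  refine μ.integrable_norm_sq.mono' (by fun_prop) (.of_forall fun x => ?_)
  rw [Real.norm_of_nonneg (by positivity)]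
  exact pow_le_pow_left₀ (le_max_left _ _) (max_le (norm_nonneg x) (by linarith)) 2

lemma P2.lintegral_tail_le (μ : P2 d) (hR : 0 ≤ R) :
    ∫⁻ x in {x | 2 * R < ‖x‖}, ‖x‖ₑ ^ 2 ∂μ.meas ≤
      ENNReal.ofReal (4 * ∫ x, max 0 (‖x‖ - R) ^ 2 ∂μ.meas) := by
  rw [← integral_const_mul, ofReal_integral_eq_lintegral_ofReal
    ((μ.integrable_sq_tail hR).const_mul 4) (.of_forall fun x => by positivity)]
  refine (setLIntegral_mono' (measurableSet_lt measurable_const measurable_norm)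
    fun x (hx : 2 * R < ‖x‖) => ?_).trans (setLIntegral_le_lintegral _ _)
  rw [← ofReal_norm, ← ENNReal.ofReal_pow (norm_nonneg _), max_eq_right (by linarith)]
  exact ENNReal.ofReal_le_ofReal (by nlinarith)

lemma P2.integrable_sq_affine_tail (μ : P2 d) {A : ℝ} (hA : 0 ≤ A) (hR : 0 ≤ R) :
    Integrable (fun x : Eucl d => max 0 (A * (1 + ‖x‖) - R) ^ 2) μ.meas :=
  μ.integrable_of_le_sq (K := 2 * A ^ 2) (by fun_prop) fun x => by
    rw [Real.norm_of_nonneg (by positivity)]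
    calc max 0 (A * (1 + ‖x‖) - R) ^ 2 ≤ (A * (1 + ‖x‖)) ^ 2 :=
          pow_le_pow_left₀ (le_max_left _ _) (max_le (by positivity) (by linarith)) 2
      _ ≤ 2 * A ^ 2 * (1 + ‖x‖ ^ 2) := by nlinarith [mul_nonneg (sq_nonneg A) (sq_nonneg (1 - ‖x‖))]

lemma P2.tendsto_integral_sq_affine_tail (μ : P2 d) {A : ℝ} (hA : 0 ≤ A) :
    Tendsto (fun R => ∫ x, max 0 (A * (1 + ‖x‖) - R) ^ 2 ∂μ.meas) atTop (𝓝 0) := by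
  suffices Tendsto (fun R => ∫ x, max 0 (A * (1 + ‖x‖) - R) ^ 2 ∂μ.meas) atTop
      (𝓝 (∫ _, 0 ∂μ.meas)) by simpa using this
  refine tendsto_integral_filter_of_dominated_convergence
    (fun x => max 0 (A * (1 + ‖x‖) - 0) ^ 2) (.of_forall fun R => by fun_prop) ?_
    (μ.integrable_sq_affine_tail hA le_rfl) (.of_forall fun x => ?_)
  · filter_upwards [eventually_ge_atTop 0] with R hR
    refine .of_forall fun x => ?_
    rw [Real.norm_of_nonneg (by positivity)]
    gcongr
  · refine tendsto_const_nhds.congr' ?_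
    filter_upwards [eventually_ge_atTop (A * (1 + ‖x‖))] with R hR
    rw [max_eq_left (by linarith), zero_pow two_ne_zero]

lemma P2.exists_meas_eq_map (μ : P2 d) {X : Eucl d → Eucl d} (hX : Measurable X) {A : ℝ}
    (hA : 0 ≤ A) (hgrowth : ∀ x, ‖X x‖ ≤ A * (1 + ‖x‖)) :
    ∃ ν : P2 d, ν.meas = μ.meas.map X := by
  have := Measure.isProbabilityMeasure_map (μ := μ.meas) hX.aemeasurable
  refine ⟨⟨⟨μ.meas.map X, this⟩, ?_⟩, rfl⟩
  change ∫⁻ x, ‖x‖ₑ ^ 2 ∂(μ.meas.map X) < ⊤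
  rw [lintegral_map (by fun_prop) hX]
  refine lt_of_le_of_lt (lintegral_mono fun x => ?_)
    (μ.integrable_sq_affine_tail hA le_rfl).lintegral_lt_top
  rw [← ofReal_norm, ← ENNReal.ofReal_pow (norm_nonneg _), sub_zero]
  exact ENNReal.ofReal_le_ofReal
    (pow_le_pow_left₀ (norm_nonneg _) ((hgrowth x).trans (le_max_right _ _)) 2)

lemma integral_sq_tail_le_of_abs_integral_shell_sub_le (hR : 0 ≤ R) {ρ ν : P2 d} {ζ : ℝ}
    (h : ∀ N, |∫ x, shell R N x ^ 2 ∂ρ.meas - ∫ x, shell R N x ^ 2 ∂ν.meas| ≤ ζ) :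
    ∫ x, max 0 (‖x‖ - R) ^ 2 ∂ρ.meas ≤ ∫ x, max 0 (‖x‖ - R) ^ 2 ∂ν.meas + ζ := by
  refine integral_sq_tail_le hR ρ fun N => ?_
  have hν : ∫ x, shell R N x ^ 2 ∂ν.meas ≤ ∫ x, max 0 (‖x‖ - R) ^ 2 ∂ν.meas :=
    integral_mono ((quadLip_sq_shell hR).integrable zero_le_one ν) (ν.integrable_sq_tail hR)
      fun x => pow_le_pow_left₀ (shell_nonneg R N x) (shell_le R N x) 2
  linarith [(abs_le.1 (h N)).2]

lemma P2.exists_integral_sq_tail_map_le (μ : P2 d) {A κ : ℝ} (hA : 0 ≤ A) (hκ : 0 < κ) :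
    ∃ R, 0 ≤ R ∧ ∀ (X : Eucl d → Eucl d) (ν : P2 d), Measurable X →
      (∀ x, ‖X x‖ ≤ A * (1 + ‖x‖)) → ν.meas = μ.meas.map X →
      ∫ x, max 0 (‖x‖ - R) ^ 2 ∂ν.meas ≤ κ := by
  obtain ⟨R, hμR, hR⟩ := (((μ.tendsto_integral_sq_affine_tail hA).eventually
    (ge_mem_nhds hκ)).and (eventually_ge_atTop 0)).exists
  refine ⟨R, hR, fun X ν hX hgrowth hν => ?_⟩
  rw [hν, integral_map hX.aemeasurable (by fun_prop)]
  refine (integral_mono_of_nonneg (.of_forall fun x => by positivity)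
    (μ.integrable_sq_affine_tail hA hR) (.of_forall fun x => ?_)).trans hμR
  dsimp only
  gcongr
  exact hgrowth x

lemma exists_coupling_flow (hT : 0 ≤ T) (hL : 0 ≤ L) (C : ℝ) (hM : 0 ≤ M) (μ₀ : P2 d) {κ : ℝ}
    (hκ : 0 < κ) :
    ∃ ε₀ > 0, ∀ ε ∈ Icc 0 ε₀, ∀ (v : ℝ → Eucl d → Eucl d) (ρ : ℝ → P2 d), IsLipField T L C v →
      IsWeakSolution T ε (fun t x _ => v t x) μ₀ ρ → (∀ t ∈ Icc 0 T, (ρ t).m2 ≤ M) →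
      ∀ t ∈ Icc 0 T, ∃ γ : Measure (Eucl d × Eucl d), γ.map Prod.fst = (ρ t).meas ∧
        γ.map Prod.snd = μ₀.meas ∧
        ∫⁻ p, ‖p.1 - flow T v 0 t p.2‖ₑ ^ 2 ∂γ ≤ ENNReal.ofReal κ := by
  have hτ : 0 < κ / 72 := by positivity
  obtain ⟨R, hR, htail⟩ := μ₀.exists_integral_sq_tail_map_le (Real.exp_pos (C * T)).le hτ
  obtain ⟨K, ζ, hK, hζ, hcoupling⟩ := exists_coupling_of_abs_integral_sub_le (Ω := Eucl d) d
    (mul_nonneg zero_le_two hR) (by positivity : 0 < κ / 9)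
  obtain ⟨ε₁, hε₁, hcells⟩ := exists_abs_integral_sub_integral_flow_le d hT hL C hM hK hζ
  obtain ⟨ε₂, hε₂, hshell⟩ := exists_abs_integral_sub_integral_flow_le d hT hL C hM zero_le_one hτ
  refine ⟨min ε₁ ε₂, lt_min hε₁ hε₂, fun ε hε v ρ hv hρ hρM t ht => ?_⟩
  set X := flow T v 0 t
  have hX : Measurable X := (hv.continuous_flow le_rfl ht).measurable
  have hgrowth : ∀ x, ‖X x‖ ≤ Real.exp (C * T) * (1 + ‖x‖) := fun x => by
    linarith [hv.flow_growth le_rfl ht x]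
  obtain ⟨ν, hν⟩ := μ₀.exists_meas_eq_map hX (Real.exp_pos _).le hgrowth
  have hνtail := htail X ν hX hgrowth hν
  have hρtail : ∫ x, max 0 (‖x‖ - R) ^ 2 ∂(ρ t).meas ≤ κ / 72 + κ / 72 := by
    refine (integral_sq_tail_le_of_abs_integral_shell_sub_le hR (ν := ν) fun N => ?_).trans
      (add_le_add_left hνtail _)
    rw [hν, integral_map hX.aemeasurable (quadLip_sq_shell hR).continuous.aestronglyMeasurable]
    exact hshell ε ⟨hε.1, hε.2.trans (min_le_right _ _)⟩ v μ₀ ρ hv hρ hρM _ (quadLip_sq_shell hR)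
      (hasCompactSupport_sq_shell R N) t ht
  have hνtail' := ν.lintegral_tail_le hR
  rw [hν, setLIntegral_map (measurableSet_lt measurable_const measurable_norm) (by fun_prop) hX]
    at hνtail'
  obtain ⟨γ, h₁, h₂, hγ⟩ := hcoupling (ρ t).meas μ₀.meas X hX
    (fun φ hφ hφc => hcells ε ⟨hε.1, hε.2.trans (min_le_left _ _)⟩ v μ₀ ρ hv hρ hρM φ hφ hφc t ht)
    (((ρ t).lintegral_tail_le hR).trans (ENNReal.ofReal_le_ofReal (by linarith)))
    (hνtail'.trans (ENNReal.ofReal_le_ofReal (by rw [← hν]; linarith)))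
  exact ⟨γ, h₁, h₂, by rwa [mul_div_cancel₀ _ (by norm_num : (9 : ℝ) ≠ 0)] at hγ⟩

end FlowCoupling

section Convergence

variable {d : ℕ} {T L C M ε κ S : ℝ} {b : ℝ → Eucl d → P2 d → Eucl d} {μ₀ : P2 d}

lemma P2.eq_of_W2_eq_zero {ρ ν : P2 d} (h : W2 ρ ν = 0) : ρ = ν := by
  have hlim : Tendsto (fun _ : ℕ => ρ.1) atTop (𝓝 ν.1) := by
    rw [tendsto_iff_forall_lipschitz_integral_tendsto]
    intro f _ ⟨K, hf⟩
    have hle := norm_integral_sub_le_of_lipschitz (f := f) K.2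
      (fun x y => by simpa [dist_eq_norm] using hf.dist_le_mul x y) ρ ν
    rw [h, mul_zero, norm_le_zero_iff, sub_eq_zero] at hle
    exact tendsto_const_nhds.congr fun _ => hle.symm
  exact Subtype.ext (tendsto_nhds_unique tendsto_const_nhds hlim)

lemma W2_sq_le_m2 (ρ ν : P2 d) : W2 ρ ν ^ 2 ≤ 2 * (ρ.m2 + ν.m2) := by
  have hγ : ρ.meas.prod ν.meas ∈ couplings ρ ν := by simp [couplings]
  have hρ := coupling_integrable_fst hγ ρ.integrable_norm_sq
  have hν := coupling_integrable_snd hγ ν.integrable_norm_sq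
  calc W2 ρ ν ^ 2 ≤ ∫ p, ‖p.1 - p.2‖ ^ 2 ∂(ρ.meas.prod ν.meas) := W2_sq_le hγ
    _ ≤ ∫ p, 2 * (‖p.1‖ ^ 2 + ‖p.2‖ ^ 2) ∂(ρ.meas.prod ν.meas) := by
        refine integral_mono (coupling_integrable_dist_sq hγ) ((hρ.add hν).const_mul 2)
          fun p => ?_
        nlinarith [norm_sub_le p.1 p.2, norm_nonneg (p.1 - p.2), sq_nonneg (‖p.1‖ - ‖p.2‖)]
    _ = 2 * (ρ.m2 + ν.m2) := by
        rw [integral_const_mul, integral_add hρ hν,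
          coupling_integral_fst hγ ρ.integrable_norm_sq,
          coupling_integral_snd hγ ν.integrable_norm_sq, P2.m2, P2.m2]

lemma W2_sq_le_of_coupling_of_map {ρ ν : P2 d} {X Z : Eucl d → Eucl d} (hX : Measurable X)
    (hZ : Measurable Z) {γ : Measure (Eucl d × Eucl d)} (h₁ : γ.map Prod.fst = ρ.meas)
    (h₂ : γ.map Prod.snd = μ₀.meas) (hκ : 0 ≤ κ)
    (hγ : ∫⁻ p, ‖p.1 - X p.2‖ₑ ^ 2 ∂γ ≤ ENNReal.ofReal κ) (hν : ν.meas = μ₀.meas.map Z)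
    (hXZ : ∀ y, ‖X y - Z y‖ ≤ S) : W2 ρ ν ^ 2 ≤ 2 * κ + 2 * S ^ 2 := by
  have hm : Measurable fun p : Eucl d × Eucl d => (p.1, Z p.2) := by fun_prop
  have hγ' : γ.map (fun p => (p.1, Z p.2)) ∈ couplings ρ ν := by
    refine ⟨by rwa [Measure.map_map measurable_fst hm], ?_⟩
    rw [Measure.map_map measurable_snd hm, hν, ← h₂, Measure.map_map hZ measurable_snd]
    rfl
  have hprob : IsProbabilityMeasure γ := by
    have : IsProbabilityMeasure (γ.map Prod.fst) := h₁ ▸ inferInstance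
    exact (Measure.isProbabilityMeasure_map_iff measurable_fst.aemeasurable).1 this
  have hpoint : ∀ p : Eucl d × Eucl d,
      ‖p.1 - Z p.2‖ₑ ^ 2 ≤ ENNReal.ofReal 2 * ‖p.1 - X p.2‖ₑ ^ 2 + ENNReal.ofReal (2 * S ^ 2) := by
    intro p
    simp only [← ofReal_norm, ← ENNReal.ofReal_pow (norm_nonneg _)]
    rw [← ENNReal.ofReal_mul zero_le_two, ← ENNReal.ofReal_add (by positivity) (by positivity)]
    refine ENNReal.ofReal_le_ofReal ?_
    have := norm_sub_le_norm_sub_add_norm_sub p.1 (X p.2) (Z p.2)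
    nlinarith [sq_nonneg (‖p.1 - X p.2‖ - ‖X p.2 - Z p.2‖), norm_nonneg (p.1 - X p.2),
      norm_nonneg (p.1 - Z p.2), norm_nonneg (X p.2 - Z p.2), hXZ p.2]
  refine (W2_sq_le hγ').trans ?_
  rw [← ENNReal.ofReal_le_ofReal_iff (by positivity), ← coupling_lintegral_eq hγ',
    lintegral_map (by fun_prop) hm, ENNReal.ofReal_add (by positivity) (by positivity),
    ENNReal.ofReal_mul zero_le_two]
  refine (lintegral_mono hpoint).trans ?_
  rw [lintegral_add_right _ measurable_const, lintegral_const_mul _ (by fun_prop), lintegral_const,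
    measure_univ, mul_one]
  gcongr

lemma meas_eq_map_flow {v : ℝ → Eucl d → Eucl d} {ρ : ℝ → P2 d} (hv : IsLipField T L C v)
    (hρ : IsWeakSolution T 0 (fun t x _ => v t x) μ₀ ρ) (hM : ∀ t ∈ Icc 0 T, (ρ t).m2 ≤ M)
    {t : ℝ} (ht : t ∈ Icc 0 T) : (ρ t).meas = μ₀.meas.map (flow T v 0 t) := by
  have hX : Measurable (flow T v 0 t) := (hv.continuous_flow le_rfl ht).measurable
  obtain ⟨ν, hν⟩ := μ₀.exists_meas_eq_map hX (Real.exp_pos (C * T)).le fun x => by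
    linarith [hv.flow_growth le_rfl ht x]
  suffices W2 (ρ t) ν = 0 by rw [P2.eq_of_W2_eq_zero this, hν]
  suffices W2 (ρ t) ν ^ 2 ≤ 0 from pow_eq_zero_iff two_ne_zero |>.1 (this.antisymm (sq_nonneg _))
  refine le_of_forall_pos_le_add fun κ hκ => ?_
  obtain ⟨ε₀, hε₀, h⟩ := exists_coupling_flow (ht.1.trans ht.2) hv.L_nonneg C
    ((ρ t).m2_nonneg.trans (hM t ht)) μ₀ (half_pos hκ)
  obtain ⟨γ, h₁, h₂, hγ⟩ := h 0 ⟨le_rfl, hε₀.le⟩ v ρ hv hρ hM t ht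
  have := W2_sq_le_of_coupling_of_map hX hX h₁ h₂ (half_pos hκ).le hγ hν (S := 0) (by simp)
  linarith

/-- The hypotheses on the mean field drift `b(t,x,μ)`, with constants normalised to be
nonnegative. -/
structure IsDrift (T L C : ℝ) (b : ℝ → Eucl d → P2 d → Eucl d) : Prop where
  L_nonneg : 0 ≤ L
  C_nonneg : 0 ≤ C
  time : ∀ x μ, ContinuousOn (fun t => b t x μ) (Ioo 0 T)
  lip : ∀ t ∈ Ioo 0 T, ∀ μ ν x y, ‖b t x μ - b t y ν‖ ≤ L * (W2 μ ν + ‖x - y‖)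
  growth : ∀ t ∈ Ioo 0 T, ∀ x μ, ‖b t x μ‖ ≤ C * (1 + ‖x‖ + ∫ y, ‖y‖ ∂μ.meas)

namespace IsDrift

lemma isLipField (hb : IsDrift T L C b) {ρ : ℝ → P2 d} (hρ : W2ContinuousOn T ρ) (hM : 0 ≤ M)
    (hρM : ∀ t ∈ Icc 0 T, (ρ t).m2 ≤ M) :
    IsLipField T L (C * (2 + M)) (fun t x => b t x (ρ t)) where
  L_nonneg := hb.L_nonneg
  C_nonneg := by positivity [hb.C_nonneg]
  time x t ht := by
    rw [ContinuousWithinAt, tendsto_iff_norm_sub_tendsto_zero]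
    have hlim : Tendsto (fun s => L * W2 (ρ s) (ρ t) + ‖b s x (ρ t) - b t x (ρ t)‖)
        (𝓝[Ioo 0 T] t) (𝓝 0) := by
      have hW := ((hρ t (Ioo_subset_Icc_self ht)).mono_left
        (nhdsWithin_mono t Ioo_subset_Icc_self)).const_mul L
      simpa using hW.add (tendsto_iff_norm_sub_tendsto_zero.1 (hb.time x (ρ t) t ht))
    refine squeeze_zero' (.of_forall fun _ => norm_nonneg _) ?_ hlim
    filter_upwards [self_mem_nhdsWithin] with s hs
    refine (norm_sub_le_norm_sub_add_norm_sub _ (b s x (ρ t)) _).trans ?_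
    gcongr
    simpa using hb.lip s hs (ρ s) (ρ t) x x
  lip t ht x y := by
    have h0 : W2 (ρ t) (ρ t) = 0 := tendsto_nhds_unique (tendsto_pure_nhds _ _)
      ((hρ t (Ioo_subset_Icc_self ht)).mono_left (pure_le_nhdsWithin (Ioo_subset_Icc_self ht)))
    simpa [h0] using hb.lip t ht (ρ t) (ρ t) x y
  growth t ht x := by
    refine (hb.growth t ht x (ρ t)).trans ?_
    have hmean : ∫ y, ‖y‖ ∂(ρ t).meas ≤ 1 + M := by
      have hsq : (∫ y, ‖y‖ ∂(ρ t).meas) ^ 2 ≤ (ρ t).m2 := (ρ t).sq_integral_norm_le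
      nlinarith [hρM t (Ioo_subset_Icc_self ht), sq_nonneg (∫ y, ‖y‖ ∂(ρ t).meas - 1)]
    rw [mul_assoc]
    refine mul_le_mul_of_nonneg_left ?_ hb.C_nonneg
    nlinarith [norm_nonneg x, mul_nonneg hM (norm_nonneg x)]

section FlowComparison

variable {C₁ C₂ : ℝ} {ρ ν : ℝ → P2 d}

lemma norm_flow_sub_flow_le_of_W2_le (hb : IsDrift T L C b)
    (hρ : IsLipField T L C₁ fun t x => b t x (ρ t)) (hν : IsLipField T L C₂ fun t x => b t x (ν t))
    {B B' : ℝ → ℝ} (hB : ∀ t, HasDerivAt B (B' t) t) (hB0 : B 0 = 0) {y : Eucl d}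
    (hbound : ∀ t ∈ Ioo 0 T, L * (W2 (ρ t) (ν t) + ‖flow T (fun t x => b t x (ρ t)) 0 t y -
      flow T (fun t x => b t x (ν t)) 0 t y‖) ≤ B' t) {t : ℝ} (ht : t ∈ Icc 0 T) :
    ‖flow T (fun t x => b t x (ρ t)) 0 t y - flow T (fun t x => b t x (ν t)) 0 t y‖ ≤ B t := by
  have h0 : (0 : ℝ) ∈ Icc 0 T := ⟨le_rfl, ht.1.trans ht.2⟩
  have hX := hρ.flow_trajectory h0 y
  have hZ := hν.flow_trajectory h0 y
  have h := norm_image_sub_le_of_interior (hX.continuousOn.sub hZ.continuousOn)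
    (fun s hs => (hX.hasDerivAt s hs).sub (hZ.hasDerivAt s hs)) hB
    (fun s hs => (hb.lip s hs _ _ _ _).trans (hbound s hs)) t ht
  simpa [hρ.flow_self h0, hν.flow_self h0, hB0] using h

lemma norm_flow_sub_flow_le_mul_exp {W : ℝ} (hb : IsDrift T L C b)
    (hρ : IsLipField T L C₁ fun t x => b t x (ρ t)) (hν : IsLipField T L C₂ fun t x => b t x (ν t))
    (hW : ∀ t ∈ Icc 0 T, W2 (ρ t) (ν t) ≤ W) {t : ℝ} (ht : t ∈ Icc 0 T) (y : Eucl d) :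
    ‖flow T (fun t x => b t x (ρ t)) 0 t y - flow T (fun t x => b t x (ν t)) 0 t y‖ ≤
      W * Real.exp (L * T) := by
  have h0 : (0 : ℝ) ∈ Icc 0 T := ⟨le_rfl, ht.1.trans ht.2⟩
  have hX := hρ.flow_trajectory h0 y
  have hZ := hν.flow_trajectory h0 y
  have hW0 : 0 ≤ W := (W2_nonneg _ _).trans (hW t ht)
  have h := gronwall_interior (hX.continuousOn.sub hZ.continuousOn)
    (fun s hs => (hX.hasDerivAt s hs).sub (hZ.hasDerivAt s hs)) (K := L) (κ := W)
    (fun s hs => (hb.lip s hs _ _ _ _).trans (mul_le_mul_of_nonneg_left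
      (add_le_add_left (hW s (Ioo_subset_Icc_self hs)) _) hb.L_nonneg)) t ht
  have hexp : W * Real.exp (L * t) ≤ W * Real.exp (L * T) := by
    have := hb.L_nonneg
    gcongr
    exact ht.2
  simp only [Pi.sub_apply, hρ.flow_self h0, hν.flow_self h0, sub_self, norm_zero, add_zero,
    sub_zero] at h
  linarith

lemma norm_flow_sub_flow_improve (hb : IsDrift T L C b)
    (hρ : IsLipField T L C₁ fun t x => b t x (ρ t)) (hν : IsLipField T L C₂ fun t x => b t x (ν t))
    (hW : ∀ t ∈ Icc 0 T, ∀ S, (∀ y, ‖flow T (fun t x => b t x (ρ t)) 0 t y -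
      flow T (fun t x => b t x (ν t)) 0 t y‖ ≤ S) → W2 (ρ t) (ν t) ≤ κ + 2 * S)
    {B : ℝ} (hB0 : 0 ≤ B)
    (hB : ∀ t ∈ Icc 0 T, ∀ y, ‖flow T (fun t x => b t x (ρ t)) 0 t y -
      flow T (fun t x => b t x (ν t)) 0 t y‖ ≤ B * Real.exp ((6 * L + 1) * t))
    {t : ℝ} (ht : t ∈ Icc 0 T) (y : Eucl d) :
    ‖flow T (fun t x => b t x (ρ t)) 0 t y - flow T (fun t x => b t x (ν t)) 0 t y‖ ≤
      L * κ * t + B / 2 * (Real.exp ((6 * L + 1) * t) - 1) := by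
  refine hb.norm_flow_sub_flow_le_of_W2_le hρ hν
    (B := fun s => L * κ * s + B / 2 * (Real.exp ((6 * L + 1) * s) - 1))
    (B' := fun s => L * κ + B / 2 * (Real.exp ((6 * L + 1) * s) * (6 * L + 1)))
    (fun s => ?_) (by simp) (fun s hs => ?_) ht
  · have hexp := (((hasDerivAt_id s).const_mul (6 * L + 1)).exp.sub_const 1).const_mul (B / 2)
    have hlin := (hasDerivAt_id s).const_mul (L * κ)
    simpa using hlin.fun_add hexp
  · have hs' := Ioo_subset_Icc_self hs
    have hL := hb.L_nonneg
    calc L * (W2 (ρ s) (ν s) + ‖flow T (fun t x => b t x (ρ t)) 0 s y -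
          flow T (fun t x => b t x (ν t)) 0 s y‖)
        ≤ L * ((κ + 2 * (B * Real.exp ((6 * L + 1) * s))) + B * Real.exp ((6 * L + 1) * s)) := by
          gcongr
          exacts [hW s hs' _ (hB s hs'), hB s hs' y]
      _ = L * κ + B / 2 * (Real.exp ((6 * L + 1) * s) * (6 * L)) := by ring
      _ ≤ L * κ + B / 2 * (Real.exp ((6 * L + 1) * s) * (6 * L + 1)) := by
          gcongr
          linarith

lemma norm_flow_sub_flow_le {W : ℝ} (hb : IsDrift T L C b)
    (hρ : IsLipField T L C₁ fun t x => b t x (ρ t)) (hν : IsLipField T L C₂ fun t x => b t x (ν t))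
    (hκ : 0 ≤ κ) (hWb : ∀ t ∈ Icc 0 T, W2 (ρ t) (ν t) ≤ W)
    (hW : ∀ t ∈ Icc 0 T, ∀ S, (∀ y, ‖flow T (fun t x => b t x (ρ t)) 0 t y -
      flow T (fun t x => b t x (ν t)) 0 t y‖ ≤ S) → W2 (ρ t) (ν t) ≤ κ + 2 * S)
    {t : ℝ} (ht : t ∈ Icc 0 T) (y : Eucl d) :
    ‖flow T (fun t x => b t x (ρ t)) 0 t y - flow T (fun t x => b t x (ν t)) 0 t y‖ ≤
      2 * (L * κ * T) * Real.exp ((6 * L + 1) * T) := by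
  set X := flow T (fun t x => b t x (ρ t)) 0
  set Z := flow T (fun t x => b t x (ν t)) 0
  have hL := hb.L_nonneg
  have hT : 0 ≤ T := ht.1.trans ht.2
  -- The weight `exp (-(6L+1)s)` makes the comparison of the flows self-improving.
  have hweight : ∀ s ∈ Icc 0 T, ∀ z K, Real.exp (-((6 * L + 1) * s)) * ‖X s z - Z s z‖ ≤ K ↔
      ‖X s z - Z s z‖ ≤ K * Real.exp ((6 * L + 1) * s) := fun s _ z K => by
    rw [Real.exp_neg, inv_mul_le_iff₀ (Real.exp_pos _), mul_comm K]
  have hself := le_two_mul_of_self_improving (ι := Icc 0 T × Eucl d) (q := L * κ * T)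
    (f := fun i => Real.exp (-((6 * L + 1) * i.1)) * ‖X i.1 i.2 - Z i.1 i.2‖) ?_
    (by positivity) ?_ (⟨t, ht⟩, y)
  · refine ((hweight t ht y _).1 hself).trans ?_
    have := ht.2
    gcongr
  · refine ⟨W * Real.exp (L * T), fun ⟨s, z⟩ => ?_⟩
    refine (mul_le_of_le_one_left (norm_nonneg _) ?_).trans
      (hb.norm_flow_sub_flow_le_mul_exp hρ hν hWb s.2 z)
    have := s.2.1
    exact Real.exp_le_one_iff.2 (neg_nonpos.2 (by positivity))
  · rintro B hB0 hB ⟨s, z⟩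
    refine (hweight s s.2 z _).2 ?_
    have h := hb.norm_flow_sub_flow_improve hρ hν hW hB0
      (fun r hr w => (hweight r hr w B).1 (hB (⟨r, hr⟩, w))) s.2 z
    have hexp : 1 ≤ Real.exp ((6 * L + 1) * s) := Real.one_le_exp (by have := s.2.1; positivity)
    have hs : L * κ * s ≤ L * κ * T := by have := s.2.2; gcongr
    have := mul_le_mul_of_nonneg_left hexp (by positivity : 0 ≤ L * κ * T)
    linarith

lemma W2_le_of_W2_le_add_flow {W : ℝ} (hb : IsDrift T L C b)
    (hρ : IsLipField T L C₁ fun t x => b t x (ρ t)) (hν : IsLipField T L C₂ fun t x => b t x (ν t))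
    (hκ : 0 ≤ κ) (hWb : ∀ t ∈ Icc 0 T, W2 (ρ t) (ν t) ≤ W)
    (hW : ∀ t ∈ Icc 0 T, ∀ S, (∀ y, ‖flow T (fun t x => b t x (ρ t)) 0 t y -
      flow T (fun t x => b t x (ν t)) 0 t y‖ ≤ S) → W2 (ρ t) (ν t) ≤ κ + 2 * S)
    {t : ℝ} (ht : t ∈ Icc 0 T) :
    W2 (ρ t) (ν t) ≤ κ * (1 + 4 * (L * T) * Real.exp ((6 * L + 1) * T)) := by
  have h := hW t ht _ (hb.norm_flow_sub_flow_le hρ hν hκ hWb hW ht)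
  linarith

end FlowComparison

lemma exists_forall_W2_le (hT : 0 ≤ T) (hb : IsDrift T L C b) (μ₀ : P2 d) (hκ : 0 < κ) :
    ∃ ε₀ > 0, ∀ ε ∈ Icc 0 ε₀, ∀ ρ ν, IsWeakSolution T ε b μ₀ ρ → IsWeakSolution T 0 b μ₀ ν →
      ∀ t ∈ Icc 0 T, W2 (ρ t) (ν t) ≤ κ := by
  have hL := hb.L_nonneg
  set E := 1 + 4 * (L * T) * Real.exp ((6 * L + 1) * T)
  have hE : 0 < E := by positivity
  obtain ⟨M, hM⟩ := exists_m2_le_of_isWeakSolution T hb.C_nonneg μ₀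
  obtain ⟨ε₀, hε₀, hcoupling⟩ := exists_coupling_flow (M := max M 0) hT hL (C * (2 + max M 0))
    (le_max_right _ _) μ₀ (by positivity : 0 < (κ / E) ^ 2 / 2)
  refine ⟨min ε₀ 1, lt_min hε₀ one_pos, fun ε hε ρ ν hρ hν t ht => ?_⟩
  have hMρ : ∀ s ∈ Icc 0 T, (ρ s).m2 ≤ max M 0 := fun s hs =>
    (hM b ε ρ hb.growth ⟨hε.1, hε.2.trans (min_le_right _ _)⟩ hρ s hs).trans (le_max_left _ _)
  have hMν : ∀ s ∈ Icc 0 T, (ν s).m2 ≤ max M 0 := fun s hs =>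
    (hM b 0 ν hb.growth ⟨le_rfl, zero_le_one⟩ hν s hs).trans (le_max_left _ _)
  have hvρ := hb.isLipField hρ.continuous (le_max_right M 0) hMρ
  have hvν := hb.isLipField hν.continuous (le_max_right M 0) hMν
  have hbounded : ∀ s ∈ Icc 0 T, W2 (ρ s) (ν s) ≤ √(4 * max M 0) := fun s hs =>
    Real.le_sqrt_of_sq_le ((W2_sq_le_m2 _ _).trans (by linarith [hMρ s hs, hMν s hs]))
  refine (hb.W2_le_of_W2_le_add_flow hvρ hvν (by positivity : 0 ≤ κ / E) hbounded
    (fun s hs S hS => ?_) ht).trans (div_mul_cancel₀ κ hE.ne').le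
  obtain ⟨γ, h₁, h₂, hγ⟩ := hcoupling ε ⟨hε.1, hε.2.trans (min_le_left _ _)⟩ _ ρ hvρ
    ⟨hρ.continuous, hρ.initial, hρ.equation⟩ hMρ s hs
  have hmap := meas_eq_map_flow hvν ⟨hν.continuous, hν.initial, hν.equation⟩ hMν hs
  have hsq := W2_sq_le_of_coupling_of_map (hvρ.continuous_flow le_rfl hs).measurable
    (hvν.continuous_flow le_rfl hs).measurable h₁ h₂ (by positivity) hγ hmap hS
  have hS0 : 0 ≤ S := (norm_nonneg _).trans (hS 0)
  refine (abs_le_of_sq_le_sq' ?_ (by positivity)).2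
  nlinarith [mul_nonneg (by positivity : 0 ≤ κ / E) hS0, sq_nonneg S]

end IsDrift

end Convergence

section QuadraticForm

variable {E F G : Type*} [NormedAddCommGroup E] [InnerProductSpace ℝ E] [NormedAddCommGroup F]
  [NormedAddCommGroup G]

lemma abs_inner_apply_le (A : E →L[ℝ] E) (x : E) : |inner ℝ x (A x)| ≤ ‖A‖ * ‖x‖ ^ 2 := by
  refine (abs_real_inner_le_norm _ _).trans ?_
  linarith [mul_le_mul_of_nonneg_left (A.le_opNorm x) (norm_nonneg x)]

lemma abs_inner_apply_sub_le (A : E →L[ℝ] E) (x y : E) :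
    |inner ℝ x (A x) - inner ℝ y (A y)| ≤ ‖A‖ * (‖x‖ + ‖y‖) * ‖x - y‖ := by
  have hsplit : inner ℝ x (A x) - inner ℝ y (A y) =
      inner ℝ (x - y) (A x) + inner ℝ y (A (x - y)) := by
    simp [inner_sub_left, inner_sub_right]
  rw [hsplit]
  refine (abs_add_le _ _).trans ?_
  have h₁ := (abs_real_inner_le_norm (x - y) (A x)).trans
    (mul_le_mul_of_nonneg_left (A.le_opNorm x) (norm_nonneg _))
  have h₂ := (abs_real_inner_le_norm y (A (x - y))).trans
    (mul_le_mul_of_nonneg_left (A.le_opNorm (x - y)) (norm_nonneg _))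
  linarith

lemma QuadLip.inner_apply (A : E →L[ℝ] E) {v : F → E} {l k : ℝ} (hk : 0 ≤ k)
    (hl : ∀ x y, ‖v x - v y‖ ≤ l * ‖x - y‖) (hv : ∀ x, ‖v x‖ ≤ k * (1 + ‖x‖)) :
    QuadLip (2 * ‖A‖ * k * l) fun x => (inner ℝ (v x) (A (v x)) : ℝ) := fun x y => by
  refine (abs_inner_apply_sub_le A _ _).trans ?_
  calc ‖A‖ * (‖v x‖ + ‖v y‖) * ‖v x - v y‖
      ≤ ‖A‖ * (2 * k * (1 + ‖x‖ + ‖y‖)) * (l * ‖x - y‖) := by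
        gcongr
        · nlinarith [hv x, hv y, mul_nonneg hk (norm_nonneg x), mul_nonneg hk (norm_nonneg y)]
        · exact hl x y
    _ = 2 * ‖A‖ * k * l * (1 + ‖x‖ + ‖y‖) * ‖x - y‖ := by ring

lemma QuadLip.add {K K' : ℝ} {f g : F → G} (hf : QuadLip K f) (hg : QuadLip K' g) :
    QuadLip (K + K') fun x => f x + g x := fun x y => by
  rw [add_sub_add_comm, add_mul, add_mul]
  exact (norm_add_le _ _).trans (add_le_add (hf x y) (hg x y))

lemma QuadLip.const_mul {K : ℝ} {f : F → ℝ} (hf : QuadLip K f) (a : ℝ) :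
    QuadLip (|a| * K) fun x => a * f x := fun x y => by
  rw [← mul_sub, norm_mul, Real.norm_eq_abs, mul_assoc, mul_assoc, ← mul_assoc K]
  exact mul_le_mul_of_nonneg_left (hf x y) (abs_nonneg _)

end QuadraticForm

section QuadCost

variable {d : ℕ} {T : ℝ} {Q R S Qb : Eucl d →L[ℝ] Eucl d} {v : Eucl d → Eucl d} {l k : ℝ}

/-- The common shape of the running cost at a fixed time, with `v` the feedback control at that
time, and of the final cost, where `R = 0` and `v = 0`. -/
def quadCost (Q R S Qb : Eucl d →L[ℝ] Eucl d) (v : Eucl d → Eucl d) (ν : P2 d) (x : Eucl d) : ℝ :=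
  (1 / 2) * (inner ℝ x (Q x) + inner ℝ (v x) (R (v x)) +
    inner ℝ (x - S (barycenter ν)) (Qb (x - S (barycenter ν))))

lemma running_eq_quadCost (c : QuadraticCost d T) (t : ℝ) (ν : P2 d) (v : Eucl d → Eucl d)
    (x : Eucl d) :
    c.running t x ν (v x) = quadCost (c.Q t) (c.R t) (c.S t) (c.Qbar t) v ν x := rfl

lemma final_eq_quadCost (c : QuadraticCost d T) (ν : P2 d) (x : Eucl d) :
    c.final x ν = quadCost c.QT 0 c.ST c.QbarT 0 ν x := by
  simp [QuadraticCost.final, quadCost]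

lemma exists_quadLip_quadCost (Q R S Qb : Eucl d →L[ℝ] Eucl d)
    (hl : ∀ x y, ‖v x - v y‖ ≤ l * ‖x - y‖) (hv : ∀ x, ‖v x‖ ≤ k * (1 + ‖x‖)) (ν : P2 d) :
    ∃ K, 0 ≤ K ∧ QuadLip K (quadCost Q R S Qb v ν) := by
  have hk : 0 ≤ k := by simpa using (norm_nonneg _).trans (hv 0)
  have hl' : ∀ x y, ‖v x - v y‖ ≤ |l| * ‖x - y‖ := fun x y =>
    (hl x y).trans (mul_le_mul_of_nonneg_right (le_abs_self l) (norm_nonneg _))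
  have hstate := QuadLip.inner_apply Q (v := fun x : Eucl d => x) (l := 1) zero_le_one (by simp)
    (fun x => by linarith)
  have hcontrol := QuadLip.inner_apply R hk hl' hv
  have hmean := QuadLip.inner_apply Qb (v := fun x => x - S (barycenter ν)) (l := 1)
    (k := 1 + ‖S (barycenter ν)‖) (by positivity) (by simp) (fun x => by
      nlinarith [norm_sub_le x (S (barycenter ν)), norm_nonneg x,
        mul_nonneg (norm_nonneg x) (norm_nonneg (S (barycenter ν)))])
  exact ⟨_, by positivity, ((hstate.add hcontrol).add hmean).const_mul (1 / 2)⟩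

lemma norm_barycenter_sub_le (μ ν : P2 d) : ‖barycenter μ - barycenter ν‖ ≤ W2 μ ν := by
  simpa [barycenter] using
    norm_integral_sub_le_of_lipschitz (f := fun x : Eucl d => x) zero_le_one (by simp) μ ν

lemma norm_barycenter_sq_le (ν : P2 d) : ‖barycenter ν‖ ^ 2 ≤ ν.m2 :=
  (pow_le_pow_left₀ (norm_nonneg _) (norm_integral_le_integral_norm _) 2).trans
    ν.sq_integral_norm_le

lemma abs_quadCost_sub_le (Q R S Qb : Eucl d →L[ℝ] Eucl d) (v : Eucl d → Eucl d)
    (ν ν₀ : P2 d) (x : Eucl d) :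
    |quadCost Q R S Qb v ν x - quadCost Q R S Qb v ν₀ x| ≤ 1 / 2 * (‖Qb‖ *
      (2 * ‖x‖ + 2 * ‖S (barycenter ν₀)‖ + ‖S‖ * W2 ν ν₀) * (‖S‖ * W2 ν ν₀)) := by
  set w := S (barycenter ν₀)
  set w' := S (barycenter ν)
  have hw : ‖w' - w‖ ≤ ‖S‖ * W2 ν ν₀ := by
    rw [← map_sub]
    exact S.le_opNorm_of_le (norm_barycenter_sub_le ν ν₀)
  have hdiff : quadCost Q R S Qb v ν x - quadCost Q R S Qb v ν₀ x =
      1 / 2 * (inner ℝ (x - w') (Qb (x - w')) - inner ℝ (x - w) (Qb (x - w))) := by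
    unfold quadCost
    ring
  have hsum : ‖x - w'‖ + ‖x - w‖ ≤ 2 * ‖x‖ + 2 * ‖w‖ + ‖S‖ * W2 ν ν₀ := by
    linarith [norm_sub_le x w, norm_sub_le x w', norm_le_norm_add_norm_sub' w' w]
  have hnorm : ‖(x - w') - (x - w)‖ = ‖w' - w‖ := by rw [sub_sub_sub_cancel_left, norm_sub_rev]
  have h := abs_inner_apply_sub_le Qb (x - w') (x - w)
  rw [hnorm] at h
  have hW := W2_nonneg ν ν₀
  rw [hdiff, abs_mul, abs_of_pos one_half_pos]
  refine mul_le_mul_of_nonneg_left (h.trans ?_) one_half_pos.le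
  gcongr

lemma norm_integral_quadCost_sub_le {K : ℝ} (hK : 0 ≤ K)
    (hl : ∀ x y, ‖v x - v y‖ ≤ l * ‖x - y‖) (hv : ∀ x, ‖v x‖ ≤ k * (1 + ‖x‖)) (ν ν₀ : P2 d)
    (hq : QuadLip K (quadCost Q R S Qb v ν₀)) {M : ℝ} (hM : ν.m2 ≤ M) :
    ‖∫ x, quadCost Q R S Qb v ν x ∂ν.meas - ∫ x, quadCost Q R S Qb v ν₀ x ∂ν₀.meas‖ ≤
      1 / 2 * (‖Qb‖ * ((1 + M) + 2 * ‖S (barycenter ν₀)‖ + ‖S‖ * W2 ν ν₀) * (‖S‖ * W2 ν ν₀)) +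
        K * √(3 * (1 + M + ν₀.m2)) * W2 ν ν₀ := by
  obtain ⟨K', hK', hq'⟩ := exists_quadLip_quadCost Q R S Qb hl hv ν
  have hW := W2_nonneg ν ν₀
  have hsub := integral_sub (hq'.integrable hK' ν) (hq.integrable hK ν)
  refine (norm_sub_le_norm_sub_add_norm_sub _ (∫ x, quadCost Q R S Qb v ν₀ x ∂ν.meas) _).trans
    (add_le_add ?_ ?_)
  · rw [← hsub]
    set a := 2 * ‖S (barycenter ν₀)‖ + ‖S‖ * W2 ν ν₀
    set e := 1 / 2 * ‖Qb‖ * (‖S‖ * W2 ν ν₀)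
    suffices h : ∀ x, ‖quadCost Q R S Qb v ν x - quadCost Q R S Qb v ν₀ x‖ ≤
        e * (1 + a) + e * ‖x‖ ^ 2 by
      exact (P2.norm_integral_le hM (by positivity) h).trans (by simp only [e, a]; linarith)
    intro x
    have he : 0 ≤ e := by positivity
    refine (abs_quadCost_sub_le Q R S Qb v ν ν₀ x).trans ?_
    have := mul_le_mul_of_nonneg_left (two_mul_le_add_sq 1 ‖x‖) he
    simp only [e, a] at *
    linarith
  · refine (hq.norm_integral_sub_le hK ν ν₀).trans ?_
    gcongr

lemma tendsto_integral_quadCost {ι : Type*} {F : Filter ι} {ν : ι → P2 d} {ν₀ : P2 d}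
    (hν : Tendsto (fun i => W2 (ν i) ν₀) F (𝓝 0)) (Q R S Qb : Eucl d →L[ℝ] Eucl d)
    (hl : ∀ x y, ‖v x - v y‖ ≤ l * ‖x - y‖) (hv : ∀ x, ‖v x‖ ≤ k * (1 + ‖x‖)) :
    Tendsto (fun i => ∫ x, quadCost Q R S Qb v (ν i) x ∂(ν i).meas) F
      (𝓝 (∫ x, quadCost Q R S Qb v ν₀ x ∂ν₀.meas)) := by
  obtain ⟨K, hK, hq⟩ := exists_quadLip_quadCost Q R S Qb hl hv ν₀
  rw [tendsto_iff_norm_sub_tendsto_zero]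
  have hcont : Continuous fun w : ℝ => 1 / 2 * (‖Qb‖ * ((1 + (2 * ν₀.m2 + 2 * w ^ 2)) +
      2 * ‖S (barycenter ν₀)‖ + ‖S‖ * w) * (‖S‖ * w)) +
      K * √(3 * (1 + (2 * ν₀.m2 + 2 * w ^ 2) + ν₀.m2)) * w := by fun_prop
  refine squeeze_zero (fun _ => norm_nonneg _) (fun i => norm_integral_quadCost_sub_le hK hl hv
    (ν i) ν₀ hq ((ν i).m2_le ν₀)) ?_
  simpa [Function.comp_def] using (hcont.tendsto 0).comp hν

lemma norm_sub_apply_barycenter_sq_le {B M : ℝ} (hS : ‖S‖ ≤ B) {ν : P2 d} (hM : ν.m2 ≤ M)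
    (x : Eucl d) : ‖x - S (barycenter ν)‖ ^ 2 ≤ 2 * ‖x‖ ^ 2 + 2 * (B ^ 2 * M) := by
  have hmean : ‖S (barycenter ν)‖ ^ 2 ≤ B ^ 2 * M :=
    calc ‖S (barycenter ν)‖ ^ 2 ≤ (B * ‖barycenter ν‖) ^ 2 := by
          gcongr; exact S.le_of_opNorm_le hS _
      _ = B ^ 2 * ‖barycenter ν‖ ^ 2 := mul_pow _ _ 2
      _ ≤ B ^ 2 * M := by gcongr; exact (norm_barycenter_sq_le ν).trans hM
  nlinarith [norm_sub_le x (S (barycenter ν)), sq_nonneg (‖x‖ - ‖S (barycenter ν)‖),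
    norm_nonneg (x - S (barycenter ν))]

lemma abs_quadCost_le {B M : ℝ} (hQ : ‖Q‖ ≤ B) (hR : ‖R‖ ≤ B) (hS : ‖S‖ ≤ B) (hQb : ‖Qb‖ ≤ B)
    (hv : ∀ x, ‖v x‖ ≤ k * (1 + ‖x‖)) {ν : P2 d} (hM : ν.m2 ≤ M) (x : Eucl d) :
    |quadCost Q R S Qb v ν x| ≤ (3 * B + B ^ 3 * M) * (1 + k ^ 2) * (1 + ‖x‖ ^ 2) := by
  have hB : 0 ≤ B := (norm_nonneg _).trans hQ
  have hM0 : 0 ≤ M := ν.m2_nonneg.trans hM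
  have hstate : |inner ℝ x (Q x)| ≤ B * ‖x‖ ^ 2 := (abs_inner_apply_le Q x).trans (by gcongr)
  have hcontrol : |inner ℝ (v x) (R (v x))| ≤ B * (k ^ 2 * (2 * (1 + ‖x‖ ^ 2))) :=
    calc |inner ℝ (v x) (R (v x))| ≤ ‖R‖ * ‖v x‖ ^ 2 := abs_inner_apply_le R (v x)
      _ ≤ B * (k * (1 + ‖x‖)) ^ 2 := by gcongr; exact hv x
      _ = B * (k ^ 2 * (1 + ‖x‖) ^ 2) := by ring
      _ ≤ B * (k ^ 2 * (2 * (1 + ‖x‖ ^ 2))) := by gcongr; nlinarith [sq_nonneg (‖x‖ - 1)]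
  have hmean : |inner ℝ (x - S (barycenter ν)) (Qb (x - S (barycenter ν)))| ≤
      B * (2 * ‖x‖ ^ 2 + 2 * (B ^ 2 * M)) :=
    (abs_inner_apply_le Qb _).trans (by gcongr; exact norm_sub_apply_barycenter_sq_le hS hM x)
  calc |quadCost Q R S Qb v ν x|
      ≤ 1 / 2 * (B * ‖x‖ ^ 2 + B * (k ^ 2 * (2 * (1 + ‖x‖ ^ 2))) +
        B * (2 * ‖x‖ ^ 2 + 2 * (B ^ 2 * M))) := by
        rw [quadCost, abs_mul, abs_of_pos one_half_pos]
        gcongr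
        exact (abs_add_three _ _ _).trans (by gcongr)
    _ ≤ (3 * B + B ^ 3 * M) * (1 + k ^ 2) * (1 + ‖x‖ ^ 2) := by
        have h₁ : 0 ≤ B * k ^ 2 * (1 + ‖x‖ ^ 2) := by positivity
        have h₂ : 0 ≤ B * ‖x‖ ^ 2 := by positivity
        have h₃ : 0 ≤ B ^ 3 * M * (k ^ 2 + ‖x‖ ^ 2 + k ^ 2 * ‖x‖ ^ 2) := by positivity
        nlinarith

end QuadCost

section Measurability

lemma exists_mem_ae_stronglyMeasurable_indicator {α X β : Type*} [MeasurableSpace α]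
    {m : Measure α} [TopologicalSpace X] [TopologicalSpace.SeparableSpace X]
    [FrechetUrysohnSpace X] [TopologicalSpace β] [TopologicalSpace.PseudoMetrizableSpace β]
    [Zero β] {F : α → X → β} {P : α → Prop} (hF : ∀ x, AEStronglyMeasurable (fun t => F t x) m)
    (hP : ∀ᵐ t ∂m, P t) (hPF : ∀ t, P t → Continuous (F t)) :
    ∃ A ∈ ae m, (∀ t ∈ A, P t) ∧ ∀ x, StronglyMeasurable fun t => A.indicator F t x := by
  obtain ⟨D, hDc, hD⟩ := TopologicalSpace.exists_countable_dense X
  obtain ⟨A, hA, hAm, hAF⟩ := (hP.and ((ae_ball_iff hDc).2 fun x _ =>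
    (hF x).ae_eq_mk)).exists_measurable_mem
  refine ⟨A, hA, fun t ht => (hAF t ht).1, fun x => ?_⟩
  have hdense : ∀ y ∈ D, StronglyMeasurable fun t => A.indicator F t y := fun y hy => by
    convert (hF y).stronglyMeasurable_mk.indicator hAm using 2 with t
    by_cases ht : t ∈ A
    · simpa [ht] using (hAF t ht).2 y hy
    · simp [ht]
  obtain ⟨y, hyD, hyx⟩ := mem_closure_iff_seq_limit.1 (hD x)
  refine stronglyMeasurable_of_tendsto atTop (fun n => hdense (y n) (hyD n))
    (tendsto_pi_nhds.2 fun t => ?_)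
  by_cases ht : t ∈ A
  · simpa [ht, Function.comp_def] using ((hPF t (hAF t ht).1).tendsto x).comp hyx
  · simpa [ht] using tendsto_const_nhds

variable {d : ℕ} {T : ℝ}

lemma aestronglyMeasurable_integral_curve (hT : 0 ≤ T) {ρ : ℝ → P2 d}
    (hρ : W2ContinuousOn T ρ) {F : ℝ → Eucl d → ℝ}
    (hF : ∀ x, AEStronglyMeasurable (fun t => F t x) (volume.restrict (Ioo 0 T)))
    (hFq : ∀ᵐ t ∂volume.restrict (Ioo 0 T), ∃ K, 0 ≤ K ∧ QuadLip K (F t)) :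
    AEStronglyMeasurable (fun t => ∫ x, F t x ∂(ρ t).meas) (volume.restrict (Ioo 0 T)) := by
  obtain ⟨A, hA, hAq, hAm⟩ := exists_mem_ae_stronglyMeasurable_indicator hF hFq
    fun t ⟨_, _, hq⟩ => hq.continuous
  set G := A.indicator F
  have hGq : ∀ t, ∃ K, 0 ≤ K ∧ QuadLip K (G t) := fun t => by
    by_cases ht : t ∈ A
    · simpa [G, ht] using hAq t ht
    · exact ⟨0, le_rfl, fun x y => by simp [G, ht]⟩
  have hGj : StronglyMeasurable (Function.uncurry fun (x : Eucl d) t => G t x) :=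
    stronglyMeasurable_uncurry_of_continuous_of_stronglyMeasurable
      (fun t => (hGq t).choose_spec.2.continuous) hAm
  -- Freezing the measure at time `s` and the integrand at time `t` gives a Carathéodory function.
  have hI : StronglyMeasurable
      (Function.uncurry fun (s : Icc 0 T) t => ∫ x, G t x ∂(ρ s).meas) := by
    refine stronglyMeasurable_uncurry_of_continuous_of_stronglyMeasurable (fun t => ?_)
      fun s => hGj.integral_prod_left'
    obtain ⟨K, hK, hq⟩ := hGq t
    exact continuousOn_iff_continuous_domRestrict.1 (hq.continuousOn_integral hK hρ)
  have hdiag : Measurable fun t : ℝ => (projIcc 0 T hT t, t) :=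
    continuous_projIcc.measurable.prodMk measurable_id
  refine ⟨_, hI.comp_measurable hdiag, ?_⟩
  filter_upwards [hA, ae_restrict_mem measurableSet_Ioo] with t ht htI
  simp [G, ht, projIcc_of_mem hT (Ioo_subset_Icc_self htI)]

end Measurability

section Cost

variable {d : ℕ} {T M B : ℝ} {ρ : ℝ → P2 d} {u : ℝ → Eucl d → Eucl d} {k : ℝ → ℝ}

lemma continuousOn_barycenter (hρ : W2ContinuousOn T ρ) :
    ContinuousOn (fun t => barycenter (ρ t)) (Icc 0 T) := fun s hs => by
  rw [ContinuousWithinAt, tendsto_iff_norm_sub_tendsto_zero]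
  exact squeeze_zero (fun _ => norm_nonneg _) (fun t => norm_barycenter_sub_le _ _) (hρ s hs)

lemma aestronglyMeasurable_apply_of_continuousOn {A : ℝ → Eucl d →L[ℝ] Eucl d} {w : ℝ → Eucl d}
    (hA : ContinuousOn A (Icc 0 T))
    (hw : AEStronglyMeasurable w (volume.restrict (Ioo 0 T))) :
    AEStronglyMeasurable (fun t => A t (w t)) (volume.restrict (Ioo 0 T)) :=
  isBoundedBilinearMap_apply.continuous.comp_aestronglyMeasurable
    (((hA.mono Ioo_subset_Icc_self).aestronglyMeasurable measurableSet_Ioo).prodMk hw)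

lemma integrable_const_mul_one_add_sq (hk : MemLp k 2 (volume.restrict (Ioo 0 T))) (a b : ℝ) :
    Integrable (fun t => a * (1 + k t ^ 2) * b) (volume.restrict (Ioo 0 T)) :=
  (((integrable_const 1).add hk.integrable_sq).const_mul a).mul_const b

namespace QuadraticCost

variable (c : QuadraticCost d T)

/-- The operator norms of the matrices of the running cost are bounded by `B` on `[0, T]`. -/
def BoundedBy (B : ℝ) : Prop :=
  ∀ t ∈ Icc 0 T, ‖c.Q t‖ ≤ B ∧ ‖c.R t‖ ≤ B ∧ ‖c.S t‖ ≤ B ∧ ‖c.Qbar t‖ ≤ B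

lemma exists_boundedBy : ∃ B, c.BoundedBy B := by
  obtain ⟨B₁, h₁⟩ := isCompact_Icc.exists_bound_of_continuousOn c.continuous_Q
  obtain ⟨B₂, h₂⟩ := isCompact_Icc.exists_bound_of_continuousOn c.continuous_R
  obtain ⟨B₃, h₃⟩ := isCompact_Icc.exists_bound_of_continuousOn c.continuous_S
  obtain ⟨B₄, h₄⟩ := isCompact_Icc.exists_bound_of_continuousOn c.continuous_Qbar
  exact ⟨max (max B₁ B₂) (max B₃ B₄), fun t ht =>
    ⟨(h₁ t ht).trans (by simp), (h₂ t ht).trans (by simp), (h₃ t ht).trans (by simp),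
      (h₄ t ht).trans (by simp)⟩⟩

variable {c}

lemma BoundedBy.abs_integral_running_le (hB : c.BoundedBy B) {t : ℝ} (ht : t ∈ Icc 0 T)
    {v : Eucl d → Eucl d} {κ : ℝ} (hv : ∀ x, ‖v x‖ ≤ κ * (1 + ‖x‖)) {ν : P2 d}
    (hM : ν.m2 ≤ M) :
    |∫ x, c.running t x ν (v x) ∂ν.meas| ≤ (3 * B + B ^ 3 * M) * (1 + κ ^ 2) * (1 + M) := by
  obtain ⟨hQ, hR, hS, hQbar⟩ := hB t ht
  have hB0 : 0 ≤ B := (norm_nonneg _).trans hQ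
  have hM0 : 0 ≤ M := ν.m2_nonneg.trans hM
  set a := (3 * B + B ^ 3 * M) * (1 + κ ^ 2)
  have hpt : ∀ x, ‖c.running t x ν (v x)‖ ≤ a + a * ‖x‖ ^ 2 := fun x => by
    rw [running_eq_quadCost, Real.norm_eq_abs, ← mul_one_add]
    exact abs_quadCost_le hQ hR hS hQbar hv hM x
  rw [mul_one_add]
  exact P2.norm_integral_le hM (by positivity) hpt

variable (c)

lemma aestronglyMeasurable_running (hu : IsControl T u) (hρ : W2ContinuousOn T ρ) (x : Eucl d) :
    AEStronglyMeasurable (fun t => c.running t x (ρ t) (u t x)) (volume.restrict (Ioo 0 T)) := by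
  have hx : AEStronglyMeasurable (fun _ : ℝ => x) (volume.restrict (Ioo 0 T)) :=
    aestronglyMeasurable_const
  have hbar : AEStronglyMeasurable (fun t => barycenter (ρ t)) (volume.restrict (Ioo 0 T)) :=
    ((continuousOn_barycenter hρ).mono Ioo_subset_Icc_self).aestronglyMeasurable measurableSet_Ioo
  have hdev := hx.sub (aestronglyMeasurable_apply_of_continuousOn c.continuous_S hbar)
  have hstate := hx.inner (𝕜 := ℝ) (aestronglyMeasurable_apply_of_continuousOn c.continuous_Q hx)
  have hcontrol := (hu.measurable x).inner (𝕜 := ℝ)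
    (aestronglyMeasurable_apply_of_continuousOn c.continuous_R (hu.measurable x))
  have hmean := hdev.inner (𝕜 := ℝ)
    (aestronglyMeasurable_apply_of_continuousOn c.continuous_Qbar hdev)
  exact ((hstate.add hcontrol).add hmean).const_mul (1 / 2)

lemma aestronglyMeasurable_integral_running (hT : 0 ≤ T) (hu : IsControl T u)
    (hk : ∀ᵐ t ∂volume.restrict (Ioo 0 T), ∀ x, ‖u t x‖ ≤ k t * (1 + ‖x‖))
    (hρ : W2ContinuousOn T ρ) :
    AEStronglyMeasurable (fun t => ∫ x, c.running t x (ρ t) (u t x) ∂(ρ t).meas)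
      (volume.restrict (Ioo 0 T)) := by
  obtain ⟨l, -, hl⟩ := hu.lipschitz
  refine aestronglyMeasurable_integral_curve hT hρ (c.aestronglyMeasurable_running hu hρ) ?_
  filter_upwards [hl, hk] with t hlt hkt
  exact exists_quadLip_quadCost _ _ _ _ hlt hkt _

lemma isFinite (hT : 0 ≤ T) (hu : IsControl T u) (hk2 : MemLp k 2 (volume.restrict (Ioo 0 T)))
    (hk : ∀ᵐ t ∂volume.restrict (Ioo 0 T), ∀ x, ‖u t x‖ ≤ k t * (1 + ‖x‖))
    (hρ : W2ContinuousOn T ρ) : c.IsFinite ρ u where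
  inner_integrable := by
    obtain ⟨l, -, hl⟩ := hu.lipschitz
    filter_upwards [hl, hk] with t hlt hkt
    obtain ⟨K, hK, hq⟩ := exists_quadLip_quadCost (c.Q t) (c.R t) (c.S t) (c.Qbar t) hlt hkt (ρ t)
    exact hq.integrable hK _
  time_integrable := by
    obtain ⟨M, hM⟩ := hρ.exists_m2_le
    obtain ⟨B, hB⟩ := c.exists_boundedBy
    rw [intervalIntegrable_iff_integrableOn_Ioo_of_le hT]
    refine (integrable_const_mul_one_add_sq hk2 (3 * B + B ^ 3 * M) (1 + M)).mono'
      (c.aestronglyMeasurable_integral_running hT hu hk hρ) ?_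
    filter_upwards [hk, ae_restrict_mem measurableSet_Ioo] with t hkt ht
    exact hB.abs_integral_running_le (Ioo_subset_Icc_self ht) hkt (hM t (Ioo_subset_Icc_self ht))
  final_integrable := by
    simp_rw [final_eq_quadCost]
    obtain ⟨K, hK, hq⟩ := exists_quadLip_quadCost c.QT 0 c.ST c.QbarT (v := 0) (l := 0) (k := 0)
      (by simp) (by simp) (ρ T)
    exact hq.integrable hK _

lemma tendsto_J (hT : 0 ≤ T) (hu : IsControl T u) (hk2 : MemLp k 2 (volume.restrict (Ioo 0 T)))
    (hk : ∀ᵐ t ∂volume.restrict (Ioo 0 T), ∀ x, ‖u t x‖ ≤ k t * (1 + ‖x‖))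
    {ι : Type*} {F : Filter ι} [F.IsCountablyGenerated] {ν : ι → ℝ → P2 d}
    (hνc : ∀ᶠ i in F, W2ContinuousOn T (ν i)) (hM : ∀ᶠ i in F, ∀ t ∈ Icc 0 T, (ν i t).m2 ≤ M)
    (hν : ∀ t ∈ Icc 0 T, Tendsto (fun i => W2 (ν i t) (ρ t)) F (𝓝 0)) :
    Tendsto (fun i => c.J (ν i) u) F (𝓝 (c.J ρ u)) := by
  obtain ⟨l, -, hl⟩ := hu.lipschitz
  obtain ⟨B, hB⟩ := c.exists_boundedBy
  refine Tendsto.add ?_ ?_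
  · simp_rw [intervalIntegral.integral_of_le hT, integral_Ioc_eq_integral_Ioo]
    refine tendsto_integral_filter_of_dominated_convergence
      (fun t => (3 * B + B ^ 3 * M) * (1 + k t ^ 2) * (1 + M)) ?_ ?_
      (integrable_const_mul_one_add_sq hk2 _ _) ?_
    · filter_upwards [hνc] with i hi
      exact c.aestronglyMeasurable_integral_running hT hu hk hi
    · filter_upwards [hM] with i hi
      filter_upwards [hk, ae_restrict_mem measurableSet_Ioo] with t hkt ht
      exact hB.abs_integral_running_le (Ioo_subset_Icc_self ht) hkt (hi t (Ioo_subset_Icc_self ht))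
    · filter_upwards [hl, hk, ae_restrict_mem measurableSet_Ioo] with t hlt hkt ht
      exact tendsto_integral_quadCost (hν t (Ioo_subset_Icc_self ht)) _ _ _ _ hlt hkt
  · simp_rw [final_eq_quadCost]
    exact tendsto_integral_quadCost (hν T (right_mem_Icc.2 hT)) _ _ _ _ (l := 0) (k := 0)
      (by simp) (by simp)

end QuadraticCost

end Cost

section UniformConvergence

variable {d : ℕ} {T : ℝ} {ι : Type*} {F : Filter ι} {ν : ι → ℝ → P2 d} {ρ : ℝ → P2 d}

lemma tendsto_iSup_W2 (h : ∀ κ > 0, ∀ᶠ i in F, ∀ t ∈ Icc 0 T, W2 (ν i t) (ρ t) ≤ κ) :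
    Tendsto (fun i => ⨆ t ∈ Icc 0 T, ENNReal.ofReal (W2 (ν i t) (ρ t))) F (𝓝 0) := by
  rw [ENNReal.tendsto_nhds_zero]
  intro κ hκ
  rcases eq_or_ne κ ⊤ with rfl | hκ_top
  · simp
  filter_upwards [h κ.toReal (ENNReal.toReal_pos hκ.ne' hκ_top)] with i hi
  exact iSup₂_le fun t ht => ENNReal.ofReal_le_of_le_toReal (hi t ht)

lemma tendstoUniformlyOn_barycenter
    (h : ∀ κ > 0, ∀ᶠ i in F, ∀ t ∈ Icc 0 T, W2 (ν i t) (ρ t) ≤ κ) :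
    TendstoUniformlyOn (fun i t => barycenter (ν i t)) (fun t => barycenter (ρ t)) F
      (Icc 0 T) := by
  rw [Metric.tendstoUniformlyOn_iff]
  intro κ hκ
  filter_upwards [h (κ / 2) (half_pos hκ)] with i hi t ht
  rw [dist_comm, dist_eq_norm]
  linarith [norm_barycenter_sub_le (ν i t) (ρ t), hi t ht]

lemma tendsto_W2 (h : ∀ κ > 0, ∀ᶠ i in F, ∀ t ∈ Icc 0 T, W2 (ν i t) (ρ t) ≤ κ) {t : ℝ}
    (ht : t ∈ Icc 0 T) : Tendsto (fun i => W2 (ν i t) (ρ t)) F (𝓝 0) := by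
  rw [Metric.tendsto_nhds]
  intro κ hκ
  filter_upwards [h (κ / 2) (half_pos hκ)] with i hi
  rw [Real.dist_0_eq_abs, abs_of_nonneg (W2_nonneg _ _)]
  linarith [hi t ht]

lemma exists_isDrift {b : ℝ → Eucl d → P2 d → Eucl d}
    (htime : ∀ (x : Eucl d) (μ : P2 d), ContinuousOn (fun t => b t x μ) (Ioo 0 T))
    (hlip : ∃ L : ℝ, ∀ t ∈ Ioo 0 T, ∀ (μ ν : P2 d) (x y : Eucl d),
      ‖b t x μ - b t y ν‖ ≤ L * (W2 μ ν + ‖x - y‖))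
    (hgrowth : ∃ C : ℝ, ∀ t ∈ Ioo 0 T, ∀ (x : Eucl d) (μ : P2 d),
      ‖b t x μ‖ ≤ C * (1 + ‖x‖ + ∫ y, ‖y‖ ∂μ.meas)) :
    ∃ L C, IsDrift T L C b := by
  obtain ⟨L, hL⟩ := hlip
  obtain ⟨C, hC⟩ := hgrowth
  exact ⟨|L|, |C|, abs_nonneg L, abs_nonneg C, htime,
    fun t ht μ ν x y => (hL t ht μ ν x y).trans (mul_le_mul_of_nonneg_right (le_abs_self L)
      (add_nonneg (W2_nonneg μ ν) (norm_nonneg _))),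
    fun t ht x μ => (hC t ht x μ).trans (mul_le_mul_of_nonneg_right (le_abs_self C)
      (add_nonneg (by positivity) (integral_nonneg fun y => norm_nonneg y)))⟩

end UniformConvergence

end VanishingViscosity

end

theorem lemma2_general {d : ℕ} {T : ℝ} (hT : 0 ≤ T)
    (b : ℝ → Eucl d → P2 d → Eucl d)
    (hb_time : ∀ (x : Eucl d) (μ : P2 d), ContinuousOn (fun t => b t x μ) (Ioo 0 T))
    (hb_lip : ∃ L : ℝ, ∀ t ∈ Ioo 0 T, ∀ (μ ν : P2 d) (x y : Eucl d),
      ‖b t x μ - b t y ν‖ ≤ L * (W2 μ ν + ‖x - y‖))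
    (hb_growth : ∃ C : ℝ, ∀ t ∈ Ioo 0 T, ∀ (x : Eucl d) (μ : P2 d),
      ‖b t x μ‖ ≤ C * (1 + ‖x‖ + ∫ y, ‖y‖ ∂μ.meas))
    (u : ℝ → Eucl d → Eucl d) (hu : IsControl T u)
    (hu_growth : ∃ k : ℝ → ℝ, MemLp k 2 (volume.restrict (Ioo 0 T)) ∧
      ∀ᵐ t ∂volume.restrict (Ioo 0 T), ∀ x, ‖u t x‖ ≤ k t * (1 + ‖x‖))
    (c : QuadraticCost d T) (μ₀ : P2 d)
    (μ : ℝ → P2 d) (hμ : IsWeakSolution T 0 b μ₀ μ)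
    (μe : ℝ → ℝ → P2 d) (hμe : ∀ ε > 0, IsWeakSolution T ε b μ₀ (μe ε)) :
    Tendsto (fun ε => ⨆ t ∈ Icc 0 T, ENNReal.ofReal (W2 (μe ε t) (μ t))) (𝓝[>] 0) (𝓝 0) ∧
    TendstoUniformlyOn (fun ε t => barycenter (μe ε t)) (fun t => barycenter (μ t))
      (𝓝[>] 0) (Icc 0 T) ∧
    c.IsFinite μ u ∧ (∀ ε > 0, c.IsFinite (μe ε) u) ∧
    Tendsto (fun ε => c.J (μe ε) u) (𝓝[>] 0) (𝓝 (c.J μ u)) := by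
  obtain ⟨L, C, hb⟩ := exists_isDrift hb_time hb_lip hb_growth
  obtain ⟨k, hk2, hk⟩ := hu_growth
  obtain ⟨M, hM⟩ := exists_m2_le_of_isWeakSolution T hb.C_nonneg μ₀
  have hW : ∀ κ > 0, ∀ᶠ ε in 𝓝[>] 0, ∀ t ∈ Icc 0 T, W2 (μe ε t) (μ t) ≤ κ := fun κ hκ => by
    obtain ⟨ε₀, hε₀, hle⟩ := hb.exists_forall_W2_le hT μ₀ hκ
    filter_upwards [Ioc_mem_nhdsGT hε₀] with ε hε
    exact hle ε (Ioc_subset_Icc_self hε) (μe ε) μ (hμe ε hε.1) hμ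
  have hcont : ∀ᶠ ε in 𝓝[>] 0, W2ContinuousOn T (μe ε) := by
    filter_upwards [self_mem_nhdsWithin] with ε hε using (hμe ε hε).continuous
  have hmoment : ∀ᶠ ε in 𝓝[>] 0, ∀ t ∈ Icc 0 T, (μe ε t).m2 ≤ M := by
    filter_upwards [Ioc_mem_nhdsGT zero_lt_one] with ε hε
    exact hM b ε (μe ε) hb.growth (Ioc_subset_Icc_self hε) (hμe ε hε.1)
  exact ⟨tendsto_iSup_W2 hW, tendstoUniformlyOn_barycenter hW,
    c.isFinite hT hu hk2 hk hμ.continuous,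
    fun ε hε => c.isFinite hT hu hk2 hk (hμe ε hε).continuous,
    c.tendsto_J hT hu hk2 hk hcont hmoment fun t ht => tendsto_W2 hW ht⟩

theorem lemma2 {d : ℕ} {T : ℝ} (hT : 0 < T)
    (b : ℝ → Eucl d → P2 d → Eucl d)
    (hb_time : ∀ (x : Eucl d) (μ : P2 d), ContinuousOn (fun t => b t x μ) (Ioo 0 T))
    (hb_lip : ∃ L : ℝ, ∀ t ∈ Ioo 0 T, ∀ (μ ν : P2 d) (x y : Eucl d),
      ‖b t x μ - b t y ν‖ ≤ L * (W2 μ ν + ‖x - y‖))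
    (hb_growth : ∃ C : ℝ, ∀ t ∈ Ioo 0 T, ∀ (x : Eucl d) (μ : P2 d),
      ‖b t x μ‖ ≤ C * (1 + ‖x‖ + ∫ y, ‖y‖ ∂μ.meas))
    (u : ℝ → Eucl d → Eucl d) (hu : IsControl T u)
    (hu_growth : ∃ k : ℝ → ℝ, MemLp k 2 (volume.restrict (Ioo 0 T)) ∧
      ∀ᵐ t ∂volume.restrict (Ioo 0 T), ∀ x, ‖u t x‖ ≤ k t * (1 + ‖x‖))
    (c : QuadraticCost d T)
    (μ₀ : P2 d) (hμ₀ : μ₀.IsCompactAC)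
    (μ : ℝ → P2 d) (hμ : IsWeakSolution T 0 b μ₀ μ)
    (μe : ℝ → ℝ → P2 d) (hμe : ∀ ε > 0, IsWeakSolution T ε b μ₀ (μe ε)) :
    Tendsto (fun ε => ⨆ t ∈ Icc 0 T, ENNReal.ofReal (W2 (μe ε t) (μ t))) (𝓝[>] 0) (𝓝 0) ∧
    TendstoUniformlyOn (fun ε t => barycenter (μe ε t)) (fun t => barycenter (μ t))
      (𝓝[>] 0) (Icc 0 T) ∧
    c.IsFinite μ u ∧ (∀ ε > 0, c.IsFinite (μe ε) u) ∧
    Tendsto (fun ε => c.J (μe ε) u) (𝓝[>] 0) (𝓝 (c.J μ u)) := by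
  exact lemma2_general hT.le b hb_time hb_lip hb_growth u hu hu_growth c μ₀ μ hμ μe hμe
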